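/- Let $G=(N,E)$ be a connected undirected simple graph with $N=\{0,\dots,n-1\}$, and let $v:2^N\to\mathbb R$ satisfy $v(\emptyset)=0$ and be independent of disconnected members: for all distinct $i,j\in N$ with $\{i,j\}\notin E$ and all $C\subseteq N\setminus\{i,j\}$, $$v(C\cup\{i\})-v(C)=v(C\cup\{i,j\})-v(C\cup\{j\}).$$ The graph coalition structure generation (GCSG) problem for $(G,v)$ is to find a partition $\mathcal C$ of $N$ into nonempty coalitions that maximises $\sum_{C\in\mathcal C}v(C)$ over all partitions of $N$; the output is required to be a maximising partition in which every coalition induces a connected subgraph of $G$. Steps are counted on a unit-cost random access machine with integer and real storage (addition, subtraction, comparison, and array access by integer indices), which has access to $n$ and to single entries of the adjacency matrix of $G$ at unit cost, and which can evaluate $v$ at a coalition given by its characteristic vector in $n+1$ steps. Then: 1. there is a program that solves the GCSG problem in $O(n^2)$ steps for all $(G,v)$ such that $G$ is a tree; 2. there is a program that solves the GCSG problem in $O(n^3)$ steps for all $(G,v)$ such that $G$ has no $K_{2,3}$ minor; 3. there is a program that solves the GCSG problem in $O(n^3)$ steps for all $(G,v)$ such that $G$ has no $K_4$ minor. In each case,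 the constant in the $O$ is the same for all instances $(G,v)$ of the class. -/

import Mathlib

namespace GCSG

/-! ### Graph minors -/

/-- `H` is a minor of `G`: there are pairwise disjoint nonempty connected vertex sets of `G`
(branch sets), one for each vertex of `H`, such that the branch sets of adjacent vertices of `H`
are joined by an edge of `G`. -/
def HasMinor {V W : Type*} (G : SimpleGraph V) (H : SimpleGraph W) : Prop :=
  ∃ B : W → Set V,
    (∀ w, (G.induce (B w)).Connected) ∧
    (∀ w w', w ≠ w' → Disjoint (B w) (B w')) ∧
    (∀ w w', H.Adj w w' → ∃ x ∈ B w, ∃ y ∈ B w', G.Adj x y)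

/-! ### Coalition valuations and coalition structures -/

/-- Independence of disconnected members: two distinct nodes `i`, `j` that are not joined by an
edge (so that `C` separates `i` from `j` inside the coalition `C ∪ {i, j}`) have no effect on each
other's marginal contribution to the coalition `C`. -/
def IDM {n : ℕ} (G : SimpleGraph (Fin n)) (v : Finset (Fin n) → ℝ) : Prop :=
  ∀ (i j : Fin n) (C : Finset (Fin n)), i ≠ j → ¬ G.Adj i j → i ∉ C → j ∉ C →
    v (insert i C) - v C = v (insert i (insert j C)) - v (insert j C)

/-- A coalition structure: a partition of the node set into nonempty coalitions. -/
abbrev CoalitionStructure (n : ℕ) : Type := Finpartition (Finset.univ : Finset (Fin n))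

/-- The total value of a coalition structure. -/
noncomputable def totalValue {n : ℕ} (v : Finset (Fin n) → ℝ) (P : CoalitionStructure n) : ℝ :=
  ∑ C ∈ P.parts, v C

/-- Every coalition induces a connected subgraph. -/
def IsConnectedStructure {n : ℕ} (G : SimpleGraph (Fin n)) (P : CoalitionStructure n) : Prop :=
  ∀ C ∈ P.parts, (G.induce (C : Set (Fin n))).Connected

/-- A problem input: a number of nodes, a graph on these nodes, and a coalition valuation. -/
structure Input where
  /-- The number of nodes. -/
  n : ℕ
  /-- The graph. -/
  graph : SimpleGraph (Fin n)
  /-- The coalition valuation function. -/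
  value : Finset (Fin n) → ℝ

/-- The inputs that are instances of the graph coalition structure generation problem. -/
def Input.IsInstance (I : Input) : Prop :=
  I.graph.Connected ∧ I.value ∅ = 0 ∧ IDM I.graph I.value

/-- The labelling `label` of the nodes encodes a solution: the coalition structure whose coalitions
are the classes of equally labelled nodes is connected, and its total value is the maximum over all
coalition structures (connected or not). -/
def Input.IsSolution (I : Input) (label : Fin I.n → ℕ) : Prop :=
  ∃ P : CoalitionStructure I.n,
    (∀ i j, label i = label j ↔ P.part i = P.part j) ∧
    IsConnectedStructure I.graph P ∧
    ∀ Q : CoalitionStructure I.n, totalValue I.value Q ≤ totalValue I.value P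

/-! ### The machine model

A unit-cost random access machine with integer and real storage. A program is a finite text in the
structured language `Cmd`; it uses finitely many integer variables, real variables, one-dimensional
integer arrays and real arrays. Integers can be added, subtracted and compared, and used as array
indices; reals can be added, subtracted and compared. There is no multiplication, there are no real
constants besides `0`, and nothing converts between the two kinds of numbers. The input is read
through the number of nodes, single entries of the adjacency matrix, and the valuation, which is
evaluated at the coalition whose characteristic vector is stored in an integer array. Every
operation, variable access, array access and adjacency matrix access counts as one step; one
evaluation of the valuation on a graph with `n` nodes counts as `n + 1` steps. -/

/-- The contents of the storage. -/
structure Store where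
  /-- Integer variables. -/
  ivar : ℕ → ℕ
  /-- Real variables. -/
  rvar : ℕ → ℝ
  /-- Integer arrays: `iarr a i` is the entry with index `i` of the array `a`. -/
  iarr : ℕ → ℕ → ℕ
  /-- Real arrays. -/
  rarr : ℕ → ℕ → ℝ

/-- The initial storage: everything is zero. -/
def Store.init : Store := ⟨fun _ => 0, fun _ => 0, fun _ _ => 0, fun _ _ => 0⟩

/-- Integer expressions. -/
inductive IExpr : Type
  | const (k : ℕ)
  | size
  | var (x : ℕ)
  | get (a : ℕ) (e : IExpr)
  | plus (e₁ e₂ : IExpr)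
  | minus (e₁ e₂ : IExpr)

/-- The value of an integer expression (subtraction is truncated at zero). -/
def IExpr.eval (I : Input) (s : Store) : IExpr → ℕ
  | .const k => k
  | .size => I.n
  | .var x => s.ivar x
  | .get a e => s.iarr a (e.eval I s)
  | .plus e₁ e₂ => e₁.eval I s + e₂.eval I s
  | .minus e₁ e₂ => e₁.eval I s - e₂.eval I s

/-- The number of steps for evaluating an integer expression. -/
def IExpr.cost : IExpr → ℕ
  | .const _ => 1
  | .size => 1
  | .var _ => 1
  | .get _ e => e.cost + 1
  | .plus e₁ e₂ => e₁.cost + e₂.cost + 1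
  | .minus e₁ e₂ => e₁.cost + e₂.cost + 1

/-- Real expressions. -/
inductive RExpr : Type
  | zero
  | var (x : ℕ)
  | get (a : ℕ) (e : IExpr)
  | plus (e₁ e₂ : RExpr)
  | minus (e₁ e₂ : RExpr)

/-- The value of a real expression. -/
noncomputable def RExpr.eval (I : Input) (s : Store) : RExpr → ℝ
  | .zero => 0
  | .var x => s.rvar x
  | .get a e => s.rarr a (e.eval I s)
  | .plus e₁ e₂ => e₁.eval I s + e₂.eval I s
  | .minus e₁ e₂ => e₁.eval I s - e₂.eval I s

/-- The number of steps for evaluating a real expression. -/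
def RExpr.cost : RExpr → ℕ
  | .zero => 1
  | .var _ => 1
  | .get _ e => e.cost + 1
  | .plus e₁ e₂ => e₁.cost + e₂.cost + 1
  | .minus e₁ e₂ => e₁.cost + e₂.cost + 1

/-- Conditions. -/
inductive BExpr : Type
  | ilt (e₁ e₂ : IExpr)
  | ieq (e₁ e₂ : IExpr)
  | rlt (e₁ e₂ : RExpr)
  | adj (e₁ e₂ : IExpr)
  | not (b : BExpr)
  | and (b₁ b₂ : BExpr)

/-- The truth value of a condition; `adj` looks up an entry of the adjacency matrix (and is false
for numbers that are not nodes). -/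
def BExpr.Holds (I : Input) (s : Store) : BExpr → Prop
  | .ilt e₁ e₂ => e₁.eval I s < e₂.eval I s
  | .ieq e₁ e₂ => e₁.eval I s = e₂.eval I s
  | .rlt e₁ e₂ => e₁.eval I s < e₂.eval I s
  | .adj e₁ e₂ => ∃ (h₁ : e₁.eval I s < I.n) (h₂ : e₂.eval I s < I.n),
      I.graph.Adj ⟨e₁.eval I s, h₁⟩ ⟨e₂.eval I s, h₂⟩
  | .not b => ¬ b.Holds I s
  | .and b₁ b₂ => b₁.Holds I s ∧ b₂.Holds I s

/-- The number of steps for evaluating a condition. -/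
def BExpr.cost : BExpr → ℕ
  | .ilt e₁ e₂ => e₁.cost + e₂.cost + 1
  | .ieq e₁ e₂ => e₁.cost + e₂.cost + 1
  | .rlt e₁ e₂ => e₁.cost + e₂.cost + 1
  | .adj e₁ e₂ => e₁.cost + e₂.cost + 1
  | .not b => b.cost + 1
  | .and b₁ b₂ => b₁.cost + b₂.cost + 1

/-- Programs. -/
inductive Cmd : Type
  | skip
  | iset (x : ℕ) (e : IExpr)
  | rset (x : ℕ) (e : RExpr)
  | iput (a : ℕ) (e₁ e₂ : IExpr)
  | rput (a : ℕ) (e₁ : IExpr) (e₂ : RExpr)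
  | query (x a : ℕ)
  | seq (c₁ c₂ : Cmd)
  | ite (b : BExpr) (c₁ c₂ : Cmd)
  | loop (b : BExpr) (c : Cmd)

/-- The coalition whose characteristic vector is stored in the integer array `a`. -/
def Store.coalition (I : Input) (s : Store) (a : ℕ) : Finset (Fin I.n) :=
  Finset.univ.filter fun i => s.iarr a i ≠ 0

/-- `Exec I c s s' t`: on the input `I`, the program `c`, started with the storage `s`, halts after
exactly `t` steps with the storage `s'`. -/
inductive Exec (I : Input) : Cmd → Store → Store → ℕ → Prop
  | skip (s : Store) : Exec I .skip s s 1
  | iset (s : Store) (x : ℕ) (e : IExpr) :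
      Exec I (.iset x e) s
        { s with ivar := Function.update s.ivar x (e.eval I s) } (e.cost + 1)
  | rset (s : Store) (x : ℕ) (e : RExpr) :
      Exec I (.rset x e) s
        { s with rvar := Function.update s.rvar x (e.eval I s) } (e.cost + 1)
  | iput (s : Store) (a : ℕ) (e₁ e₂ : IExpr) :
      Exec I (.iput a e₁ e₂) s
        { s with
          iarr := Function.update s.iarr a
                    (Function.update (s.iarr a) (e₁.eval I s) (e₂.eval I s)) } (e₁.cost + e₂.cost + 1)
  | rput (s : Store) (a : ℕ) (e₁ : IExpr) (e₂ : RExpr) :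
      Exec I (.rput a e₁ e₂) s
        { s with
          rarr := Function.update s.rarr a
                    (Function.update (s.rarr a) (e₁.eval I s) (e₂.eval I s)) } (e₁.cost + e₂.cost + 1)
  | query (s : Store) (x a : ℕ) :
      Exec I (.query x a) s
        { s with rvar := Function.update s.rvar x (I.value (s.coalition I a)) } (I.n + 1)
  | seq {s s₁ s₂ : Store} {c₁ c₂ : Cmd} {t₁ t₂ : ℕ} :
      Exec I c₁ s s₁ t₁ → Exec I c₂ s₁ s₂ t₂ → Exec I (.seq c₁ c₂) s s₂ (t₁ + t₂)
  | ite_true {s s₁ : Store} {b : BExpr} {c₁ c₂ : Cmd} {t : ℕ} :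
      b.Holds I s → Exec I c₁ s s₁ t → Exec I (.ite b c₁ c₂) s s₁ (b.cost + 1 + t)
  | ite_false {s s₁ : Store} {b : BExpr} {c₁ c₂ : Cmd} {t : ℕ} :
      ¬ b.Holds I s → Exec I c₂ s s₁ t → Exec I (.ite b c₁ c₂) s s₁ (b.cost + 1 + t)
  | loop_true {s s₁ s₂ : Store} {b : BExpr} {c : Cmd} {t₁ t₂ : ℕ} :
      b.Holds I s → Exec I c s s₁ t₁ → Exec I (.loop b c) s₁ s₂ t₂ →
        Exec I (.loop b c) s s₂ (b.cost + 1 + t₁ + t₂)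
  | loop_false {s : Store} {b : BExpr} {c : Cmd} :
      ¬ b.Holds I s → Exec I (.loop b c) s s (b.cost + 1)

/-- The graph coalition structure generation problem over the graphs of the class `S` can be solved
in `O(f n)` steps: one program and one constant work for all instances over graphs of the class.
The output labelling of the nodes is read from the integer array `0`. -/
def SolvableInSteps (S : ∀ n : ℕ, SimpleGraph (Fin n) → Prop) (f : ℕ → ℕ) : Prop :=
  ∃ (c : Cmd) (K : ℕ), ∀ I : Input, I.IsInstance → S I.n I.graph →
    ∃ (s : Store) (t : ℕ), Exec I c Store.init s t ∧ t ≤ K * f I.n ∧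
      I.IsSolution fun i => s.iarr 0 i

end GCSG

namespace GCSG

/-! ### Minors -/

/-! Partitions are handled as labellings, with `obj` the total value of the label classes.
Independence says that the marginal contribution of a vertex `u` depends only on the trace of the
coalition on the neighbourhood of `u` (`IDMOn.insert_sub`), hence the value is additive over sets
not joined by edges (`IDMOn.union`). So any optimal partition suffices: cutting its classes into
connected components keeps the total (`IDMOn.obj_refine`, `isSolution_of_isOpt`).

For the excluded minors, vertices are eliminated one at a time. Let the neighbours of `u` be among
`a`, `b`, `c`. Once the other vertices are partitioned, the best place for `u` is alone or in the
class of largest gain, and this best gain depends only on the partition induced on `{a, b, c}`.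
There are five such partitions, and a function of them is a constant plus weights for `ab`, `ac`,
`bc` and `abc`. Adding these weights to the value function therefore allows `u` to be dropped
(`IDMOn.extend_isOpt`), and the new value function is independent with respect to the graph in which
the neighbourhood of `u` has become a clique (`IDMOn.eliminate`). If `u` has at most two neighbours
or a clique as neighbourhood, that graph arises by deletion or contraction and so has no new minors
(`HasMinor.of_eliminate`). A suitable vertex always exists: rotating a longest path yields
`exists_degree_le_two` for `K₄` and `exists_degree_le_two_or_simplicial` for `K₂,₃`. Three isolated
worthless pads `n`, `n + 1`, `n + 2` replace missing neighbours and are all that is left after `n`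
eliminations; then the recorded choices are undone in reverse order. Each elimination costs a
quadratic search and boundedly many evaluations of the reduced value function, each consisting of
one query and at most `n` recorded terms. Splitting into components costs linear time per pair of
nodes. Both give a cubic total.

In a tree there are no triangles, so the value is a sum of single values and of synergies of edges
(`value_eq_sum`). An edge of a forest whose ends are connected by positive edges is itself positive,
so the components of the positive edges collect exactly the positive synergies (`isOpt_positive`).
Linear work is spent only on the `n - 1` edges and constant work on the other pairs, which makes the
total quadratic. -/

/-- A minor of `H` is a minor of `G` if the non-isolated vertices of `H` are modelled by pairwise
disjoint connected vertex sets of `G`, joined by edges where the vertices of `H` are. -/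
theorem HasMinor.of_model {V V' W : Type*} {G : SimpleGraph V} {H : SimpleGraph V'}
    {K : SimpleGraph W} (D : V' → Set V)
    (hK : ∀ w, ∃ w', K.Adj w w')
    (hc : ∀ x y, H.Adj x y → (G.induce (D x)).Connected)
    (hd : ∀ x y, x ≠ y → Disjoint (D x) (D y))
    (ha : ∀ x y, H.Adj x y → ∃ p ∈ D x, ∃ q ∈ D y, G.Adj p q)
    (h : HasMinor H K) : HasMinor G K := by
  obtain ⟨B, hB, hBd, hBa⟩ := h
  -- As `w` has a neighbour in `K`, some vertex of `B w` has an edge leaving `B w`, and any other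
  -- vertex of `B w` has one inside. So isolated vertices of `H` lie in no branch set, and their
  -- models may be empty.
  have hiso : ∀ w, ∀ x ∈ B w, ∃ y, H.Adj x y := by
    intro w x hx
    obtain ⟨w', hw⟩ := hK w
    obtain ⟨x0, hx0, y0, -, hxy⟩ := hBa w w' hw
    by_cases hxx : x = x0
    · exact ⟨y0, hxx ▸ hxy⟩
    · obtain ⟨W⟩ := (hB w).preconnected ⟨x, hx⟩ ⟨x0, hx0⟩
      cases W with
      | nil => exact absurd rfl hxx
      | cons hadj _ => exact ⟨_, hadj⟩
  have hreach : ∀ w, ∀ x y : B w, (H.induce (B w)).Walk x y →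
      ∀ (p q : V) (hp : p ∈ ⋃ x ∈ B w, D x) (hq : q ∈ ⋃ x ∈ B w, D x), p ∈ D x → q ∈ D y →
        (G.induce (⋃ x ∈ B w, D x)).Reachable ⟨p, hp⟩ ⟨q, hq⟩ := by
    intro w x y W
    have key : ∀ x : B w, ∀ (p q : V) (hp : p ∈ ⋃ x ∈ B w, D x) (hq : q ∈ ⋃ x ∈ B w, D x),
        p ∈ D x → q ∈ D x → (G.induce (⋃ x ∈ B w, D x)).Reachable ⟨p, hp⟩ ⟨q, hq⟩ := by
      intro x p q hp hq hpx hqx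
      obtain ⟨z, hz⟩ := hiso w x x.2
      have hsub : D x ⊆ ⋃ x ∈ B w, D x := Set.subset_biUnion_of_mem (u := fun x => D x) x.2
      have := (hc x z hz).preconnected ⟨p, hpx⟩ ⟨q, hqx⟩
      exact this.map (G.induceHomOfLE hsub).toHom
    induction W with
    | nil => exact fun p q hp hq hpx hqx => key _ p q hp hq hpx hqx
    | @cons x z y hadj _ ih =>
      intro p q hp hq hpx hqy
      obtain ⟨p', hp', q', hq', hpq⟩ := ha x z hadj
      have hp'' : p' ∈ ⋃ x ∈ B w, D x := Set.mem_biUnion x.2 hp'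
      have hq'' : q' ∈ ⋃ x ∈ B w, D x := Set.mem_biUnion z.2 hq'
      refine (key x p p' hp hp'' hpx hp').trans (.trans ?_ (ih q' q hq'' hq hq' hqy))
      exact SimpleGraph.Adj.reachable hpq
  refine ⟨fun w => ⋃ x ∈ B w, D x, fun w => ?_, fun w w' hne => ?_, fun w w' hww => ?_⟩
  · obtain ⟨⟨x, hx⟩⟩ := (hB w).nonempty
    obtain ⟨z, hz⟩ := hiso w x hx
    obtain ⟨⟨p, hp⟩⟩ := (hc x z hz).nonempty
    refine (SimpleGraph.connected_iff _).2 ⟨?_, ⟨⟨p, Set.mem_biUnion hx hp⟩⟩⟩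
    rintro ⟨p, hp⟩ ⟨q, hq⟩
    obtain ⟨x, hx, hpx⟩ := Set.mem_iUnion₂.1 hp
    obtain ⟨y, hy, hqy⟩ := Set.mem_iUnion₂.1 hq
    obtain ⟨W⟩ := (hB w).preconnected ⟨x, hx⟩ ⟨y, hy⟩
    exact hreach w _ _ W p q hp hq hpx hqy
  · simp only [Set.disjoint_iUnion_left, Set.disjoint_iUnion_right]
    intro x hx y hy
    exact hd _ _ (by rintro rfl; exact Set.disjoint_left.1 (hBd w w' hne) hy hx)
  · obtain ⟨x, hx, y, hy, hxy⟩ := hBa w w' hww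
    obtain ⟨p, hp, q, hq, hpq⟩ := ha x y hxy
    exact ⟨p, Set.mem_biUnion hx hp, q, Set.mem_biUnion hy hq, hpq⟩

theorem induce_singleton_connected {V : Type*} (G : SimpleGraph V) (x : V) :
    (G.induce {x}).Connected := by
  refine (SimpleGraph.connected_iff _).2 ⟨?_, ⟨⟨x, rfl⟩⟩⟩
  rintro ⟨p, rfl⟩ ⟨q, rfl⟩
  rfl

theorem HasMinor.mono {V W : Type*} {G H : SimpleGraph V} {K : SimpleGraph W}
    (hK : ∀ w, ∃ w', K.Adj w w') (hGH : H ≤ G) (h : HasMinor H K) : HasMinor G K :=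
  h.of_model (fun x => {x}) hK (fun x _ _ => induce_singleton_connected G x)
    (fun x y hxy => by simpa using hxy)
    (fun x y hxy => ⟨x, rfl, y, rfl, hGH hxy⟩)

/-- Deleting the vertex `u` and turning its neighbourhood into a clique. -/
def eliminate {V : Type*} (H : SimpleGraph V) (u : V) : SimpleGraph V where
  Adj x y := x ≠ u ∧ y ≠ u ∧ (H.Adj x y ∨ (x ≠ y ∧ H.Adj u x ∧ H.Adj u y))
  symm := ⟨fun _ _ h =>
    ⟨h.2.1, h.1, h.2.2.imp SimpleGraph.Adj.symm fun h => ⟨h.1.symm, h.2.2, h.2.1⟩⟩⟩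
  loopless := ⟨fun _ h => h.2.2.elim H.irrefl fun h => h.1 rfl⟩

theorem eliminate_adj {V : Type*} {H : SimpleGraph V} {u x y : V} :
    (eliminate H u).Adj x y ↔
      x ≠ u ∧ y ≠ u ∧ (H.Adj x y ∨ (x ≠ y ∧ H.Adj u x ∧ H.Adj u y)) := Iff.rfl

/-- The neighbourhood of `u` is a clique or has at most two elements. -/
def Simple {V : Type*} (H : SimpleGraph V) (u : V) : Prop :=
  (∀ x y, H.Adj u x → H.Adj u y → x ≠ y → H.Adj x y) ∨ ∃ a b, ∀ x, H.Adj u x → x = a ∨ x = b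

/-- If the neighbourhood is a clique, elimination is mere deletion of `u`. Otherwise `u` has exactly
two neighbours `a`, `b`, and the only new edge `ab` arises by contracting `u` into `a`. -/
theorem HasMinor.of_eliminate {V W : Type*} {H : SimpleGraph V} {K : SimpleGraph W} {u : V}
    (hK : ∀ w, ∃ w', K.Adj w w') (hu : Simple H u) (h : HasMinor (eliminate H u) K) :
    HasMinor H K := by
  classical
  by_cases hcl : ∀ x y, H.Adj u x → H.Adj u y → x ≠ y → H.Adj x y
  · refine h.mono hK fun x y hxy => ?_
    rcases hxy.2.2 with h | h
    · exact h
    · exact hcl x y h.2.1 h.2.2 h.1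
  · obtain ⟨a, b, hab⟩ := hu.resolve_left hcl
    push Not at hcl
    obtain ⟨x, y, hx, hy, hxy, -⟩ := hcl
    have hua : H.Adj u a := by
      rcases hab x hx with rfl | rfl
      · exact hx
      · rcases hab y hy with rfl | rfl
        · exact hy
        · exact absurd rfl hxy
    -- The vertex `u` is isolated in `eliminate H u`, so its model may be empty; it is absorbed by
    -- the model of `a`.
    refine h.of_model (fun x => if x = u then ∅ else if x = a then {u, a} else {x}) hK ?_ ?_ ?_
    · intro x y hxy
      have hxu : x ≠ u := hxy.1
      rw [if_neg hxu]
      by_cases hxa : x = a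
      · rw [if_pos hxa]
        exact SimpleGraph.induce_pair_connected_of_adj hua
      · rw [if_neg hxa]
        exact induce_singleton_connected H x
    · intro x y hxy
      have := hua.ne
      simp only [Set.disjoint_left]
      intro z
      split_ifs <;> simp <;> grind
    · intro x y hxy
      obtain ⟨hxu, hyu, h⟩ := hxy
      simp only [hxu, hyu, if_false]
      by_cases hadj : H.Adj x y
      · exact ⟨x, by split_ifs <;> simp_all, y, by split_ifs <;> simp_all, hadj⟩
      · obtain ⟨hne, h1, h2⟩ := h.resolve_left hadj
        by_cases hxa : x = a
        · refine ⟨u, by simp [hxa], y, ?_, h2⟩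
          split_ifs <;> simp_all
        · have hya : y = a := by
            rcases hab x h1 with h | h
            · exact absurd h hxa
            · rcases hab y h2 with h' | h'
              · exact h'
              · exact absurd (h.trans h'.symm) hne
          refine ⟨x, by simp [hxa], u, by simp [hya], h1.symm⟩

/-! ### Longest paths -/

/-- The vertices `p 0, …, p m` form a path. -/
structure IsPathSeq {V : Type*} (H : SimpleGraph V) (p : ℕ → V) (m : ℕ) : Prop where
  adj : ∀ i < m, H.Adj (p i) (p (i + 1))
  inj : ∀ i ≤ m, ∀ j ≤ m, p i = p j → i = j

theorem IsPathSeq.segment_connected {V : Type*} {H : SimpleGraph V} {p : ℕ → V} {m : ℕ}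
    (hp : IsPathSeq H p m) {a b : ℕ} (hab : a ≤ b) (hb : b ≤ m) :
    (H.induce (p '' Set.Icc a b)).Connected := by
  have key : ∀ t (h1 : a ≤ t) (h2 : t ≤ b), (H.induce (p '' Set.Icc a b)).Reachable
      ⟨p a, a, ⟨le_rfl, hab⟩, rfl⟩ ⟨p t, t, ⟨h1, h2⟩, rfl⟩ := by
    intro t h1
    induction t, h1 using Nat.le_induction with
    | base => exact fun _ => SimpleGraph.Reachable.refl _
    | succ t ht ih =>
      intro h2
      refine (ih (by omega)).trans (SimpleGraph.Adj.reachable ?_)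
      exact hp.adj t (by omega)
  refine (SimpleGraph.connected_iff _).2 ⟨?_, ⟨⟨p a, a, ⟨le_rfl, hab⟩, rfl⟩⟩⟩
  rintro ⟨_, s, hs, rfl⟩ ⟨_, t, ht, rfl⟩
  exact (key s hs.1 hs.2).symm.trans (key t ht.1 ht.2)

/-- A minor whose branch sets are segments of a path. -/
theorem IsPathSeq.hasMinor {V W : Type*} {H : SimpleGraph V} {K : SimpleGraph W} {p : ℕ → V}
    {m : ℕ} (hp : IsPathSeq H p m) (lo hi : W → ℕ) (hle : ∀ w, lo w ≤ hi w ∧ hi w ≤ m)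
    (hdis : ∀ w w', w ≠ w' → hi w < lo w' ∨ hi w' < lo w)
    (hadj : ∀ w w', K.Adj w w' → ∃ x y, (lo w ≤ x ∧ x ≤ hi w) ∧ (lo w' ≤ y ∧ y ≤ hi w') ∧
      H.Adj (p x) (p y)) : HasMinor H K := by
  refine ⟨fun w => p '' Set.Icc (lo w) (hi w),
    fun w => hp.segment_connected (hle w).1 (hle w).2, fun w w' hne => ?_, fun w w' hww => ?_⟩
  · rw [Set.disjoint_left]
    rintro _ ⟨s, hs, rfl⟩ ⟨t, ht, hst⟩
    have h1 := hle w
    have h2 := hle w'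
    simp only [Set.mem_Icc] at hs ht
    have := hp.inj t (by omega) s (by omega) hst
    have := hdis w w' hne
    omega
  · obtain ⟨x, y, hx, hy, h⟩ := hadj w w' hww
    exact ⟨p x, ⟨x, hx, rfl⟩, p y, ⟨y, hy, rfl⟩, h⟩

/-- Pósa's rotation: the tail after position `j` is reversed and attached to `p j` through the edge
from the old end, so that `p (j + 1)` becomes the new end and the first `j + 1` positions stay. -/
theorem IsPathSeq.rotate {V : Type*} {H : SimpleGraph V} {p : ℕ → V} {m j : ℕ}
    (hp : IsPathSeq H p m) (hj : j < m) (hadj : H.Adj (p m) (p j)) :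
    IsPathSeq H (fun t => if t ≤ j then p t else p (m + j + 1 - t)) m := by
  constructor
  · intro i hi
    rcases lt_trichotomy i j with h | rfl | h
    · have h1 : i ≤ j := h.le
      have h2 : i + 1 ≤ j := h
      simpa [h1, h2] using hp.adj i hi
    · have h2 : ¬ i + 1 ≤ i := by omega
      have h3 : m + i + 1 - (i + 1) = m := by omega
      simpa [h2, h3] using hadj.symm
    · have h1 : ¬ i ≤ j := by omega
      have h2 : ¬ i + 1 ≤ j := by omega
      have h3 : m + j + 1 - i = (m + j + 1 - (i + 1)) + 1 := by omega
      simp only [h1, h2, if_false, h3]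
      exact (hp.adj _ (by omega)).symm
  · intro s hs t ht hst
    split_ifs at hst with h1 h2 h2
    · exact hp.inj _ hs _ ht hst
    · have := hp.inj _ hs _ (by omega) hst; omega
    · have := hp.inj _ (by omega) _ ht hst; omega
    · have := hp.inj _ (by omega) _ (by omega) hst; omega

theorem exists_greatest_of_bounded {P : ℕ → Prop} (N : ℕ) (hne : ∃ m, P m)
    (hb : ∀ m, P m → m ≤ N) : ∃ m, P m ∧ ∀ k, P k → k ≤ m := by
  classical
  obtain ⟨m, hm⟩ := hne
  exact ⟨Nat.findGreatest P N, Nat.findGreatest_spec (hb m hm) hm,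
    fun k hk => Nat.le_findGreatest (hb k hk) hk⟩

/-- In a finite graph of minimum degree at least three there is a longest path whose end has a
lowest neighbour that is as late as possible. -/
theorem exists_extremal_path {V : Type*} [DecidableEq V] {H : SimpleGraph V} [DecidableRel H.Adj]
    {R : Finset V} (hR : ∀ x y, H.Adj x y → y ∈ R) (hne : R.Nonempty)
    (hdeg : ∀ x ∈ R, 3 ≤ (R.filter (H.Adj x)).card) :
    ∃ (p : ℕ → V) (m i : ℕ), IsPathSeq H p m ∧ p m ∈ R ∧
      (∀ x, H.Adj (p m) x → ∃ t < m, x = p t) ∧ i < m ∧ H.Adj (p m) (p i) ∧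
      (∀ t ≤ m, H.Adj (p m) (p t) → i ≤ t) ∧
      (∃ j, i < j ∧ j + 1 < m ∧ H.Adj (p m) (p j)) ∧
      ∀ j, i < j → j + 1 < m → H.Adj (p m) (p j) → ∃ k < j, H.Adj (p (j + 1)) (p k) := by
  have hmem : ∀ p m, IsPathSeq H p m → p 0 ∈ R → ∀ i ≤ m, p i ∈ R := by
    intro p m hp h0 i hi
    cases i with
    | zero => exact h0
    | succ i => exact hR _ _ (hp.adj i (by omega))
  obtain ⟨m, ⟨p₀, hp₀, hp₀R⟩, hmax⟩ :=
    exists_greatest_of_bounded (P := fun m => ∃ p, IsPathSeq H p m ∧ p 0 ∈ R) R.card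
    (by
      obtain ⟨r, hr⟩ := hne
      exact ⟨0, fun _ => r, ⟨fun i hi => by omega, fun i hi j hj _ => by omega⟩, hr⟩)
    (by
      rintro m ⟨p, hp, h0⟩
      have := Finset.card_le_card_of_injOn (s := Finset.range (m + 1)) (t := R) p
        (fun i hi => hmem p m hp h0 i (by simpa [Nat.lt_succ_iff] using hi))
        (fun i hi j hj h => hp.inj i (by simpa [Nat.lt_succ_iff] using hi) j
          (by simpa [Nat.lt_succ_iff] using hj) h)
      simp at this
      omega)
  -- A neighbour of the end outside the path would prolong a longest path.
  have hnb : ∀ p, IsPathSeq H p m → p 0 ∈ R → ∀ x, H.Adj (p m) x → ∃ t < m, x = p t := by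
    intro p hp h0 x hx
    by_contra hcon
    push Not at hcon
    have hxm : ∀ t ≤ m, p t ≠ x := by
      intro t ht htx
      rcases ht.lt_or_eq with h | rfl
      · exact hcon t h htx.symm
      · rw [htx] at hx
        exact H.irrefl hx
    have hp' : IsPathSeq H (fun t => if t ≤ m then p t else x) (m + 1) := by
      constructor
      · intro i hi
        by_cases him : i + 1 ≤ m
        · simpa [him, (by omega : i ≤ m)] using hp.adj i (by omega)
        · have : i = m := by omega
          subst this
          simpa using hx
      · intro s hs t ht hst
        split_ifs at hst with h1 h2 h2
        · exact hp.inj _ h1 _ h2 hst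
        · exact absurd hst (hxm s h1)
        · exact absurd hst.symm (hxm t h2)
        · omega
    have := hmax (m + 1) ⟨_, hp', by simpa using h0⟩
    omega
  have hthree : ∀ p, IsPathSeq H p m → p 0 ∈ R →
      3 ≤ ((Finset.range m).filter fun t => H.Adj (p m) (p t)).card := by
    intro p hp h0
    refine (hdeg _ (hmem p m hp h0 m le_rfl)).trans ?_
    have : R.filter (H.Adj (p m)) ⊆
        ((Finset.range m).filter fun t => H.Adj (p m) (p t)).image p := by
      intro x hx
      rw [Finset.mem_filter] at hx
      obtain ⟨t, ht, rfl⟩ := hnb p hp h0 x hx.2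
      exact Finset.mem_image.2 ⟨t, by simp [ht, hx.2], rfl⟩
    exact (Finset.card_le_card this).trans Finset.card_image_le
  -- Second extremal choice: among the longest paths, maximise a lower bound for the positions of
  -- the neighbours of the end. Maximality makes the bound attained.
  obtain ⟨i, ⟨p, hp, h0, hi⟩, himax⟩ :=
    exists_greatest_of_bounded
      (P := fun i => ∃ p, IsPathSeq H p m ∧ p 0 ∈ R ∧ ∀ t ≤ m, H.Adj (p m) (p t) → i ≤ t) m
    ⟨0, p₀, hp₀, hp₀R, fun _ _ _ => Nat.zero_le _⟩
    (by
      rintro i ⟨p, hp, h0, hi⟩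
      have := hthree p hp h0
      obtain ⟨t, ht⟩ := Finset.card_pos.1 (by omega : 0 <
        ((Finset.range m).filter fun t => H.Adj (p m) (p t)).card)
      simp only [Finset.mem_filter, Finset.mem_range] at ht
      exact (hi t ht.1.le ht.2).trans ht.1.le)
  have h3 := hthree p hp h0
  have hadji : H.Adj (p m) (p i) := by
    by_contra hcon
    have := himax (i + 1) ⟨p, hp, h0, fun t ht hadj => by
      have := hi t ht hadj
      rcases this.lt_or_eq with h | rfl
      · exact h
      · exact absurd hadj hcon⟩
    omega
  have him : i < m := by
    obtain ⟨t, ht⟩ := Finset.card_pos.1 (by omega : 0 <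
      ((Finset.range m).filter fun t => H.Adj (p m) (p t)).card)
    simp only [Finset.mem_filter, Finset.mem_range] at ht
    exact (hi t ht.1.le ht.2).trans_lt ht.1
  refine ⟨p, m, i, hp, hmem p m hp h0 m le_rfl, hnb p hp h0, him, hadji, hi, ?_, ?_⟩
  -- Of three neighbours of the end, at least one is at neither position `i` nor `m - 1`.
  · have hlt : ({i, m - 1} : Finset ℕ).card <
        ((Finset.range m).filter fun t => H.Adj (p m) (p t)).card :=
      lt_of_le_of_lt Finset.card_le_two (by omega)
    obtain ⟨j, hj, hj'⟩ := Finset.exists_mem_notMem_of_card_lt_card hlt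
    simp only [Finset.mem_filter, Finset.mem_range, Finset.mem_insert, Finset.mem_singleton,
      not_or] at hj hj'
    have := hi j hj.1.le hj.2
    exact ⟨j, by omega, by omega, hj.2⟩
  · intro j hij hjm hadj
    by_contra hcon
    push Not at hcon
    -- If `p (j + 1)` had no neighbour before `p j`, the rotated path would have all neighbours of
    -- its end at positions at least `j > i`, against the choice of `i`.
    have := himax j ⟨_, hp.rotate (by omega) hadj, by simpa using h0, fun t ht hadjt => by
      by_contra hlt
      have h1 : ¬ m ≤ j := by omega
      have h2 : t ≤ j := by omega
      have h3 : m + j + 1 - m = j + 1 := by omega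
      simp only [h1, h2, if_true, if_false, h3] at hadjt
      exact hcon t (by omega) hadjt⟩
    omega

/-! ### Vertices of low degree from excluded minors -/

/-- A finite nonempty graph without a `K₄` minor has a vertex of degree at most two. -/
theorem exists_degree_le_two {V : Type*} [DecidableEq V] {H : SimpleGraph V} [DecidableRel H.Adj]
    {R : Finset V} (hR : ∀ x y, H.Adj x y → y ∈ R) (hne : R.Nonempty)
    (hH : ¬ HasMinor H (⊤ : SimpleGraph (Fin 4))) :
    ∃ x ∈ R, (R.filter (H.Adj x)).card ≤ 2 := by
  by_contra hcon
  push Not at hcon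
  obtain ⟨p, m, i, hp, -, -, him, hadji, -, ⟨j, hij, hjm, hadjj⟩, hk⟩ :=
    exists_extremal_path hR hne hcon
  obtain ⟨k, hkj, hadjk⟩ := hk j hij hjm hadjj
  apply hH
  have hj := hp.adj j (by omega)
  have hj' := hp.adj (j - 1) (by omega)
  have hm' := hp.adj (m - 1) (by omega)
  rw [show j - 1 + 1 = j by omega] at hj'
  rw [show m - 1 + 1 = m by omega] at hm'
  -- The path is cut into the segments before `j`, `{j}`, between `j` and `m`, and `{m}`. Three of
  -- the six connections are path edges; the chords `im`, `jm` and `k(j + 1)` supply the rest.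
  refine hp.hasMinor ![0, j, j + 1, m] ![j - 1, j, m - 1, m] ?_ ?_ ?_
  · intro w
    fin_cases w <;> simp <;> omega
  · intro w w' hne
    fin_cases w <;> fin_cases w' <;> simp at hne ⊢ <;> omega
  · have hsymm : ∀ w w' : Fin 4, w < w' → ∃ x y,
        (![0, j, j + 1, m] w ≤ x ∧ x ≤ ![j - 1, j, m - 1, m] w) ∧
        (![0, j, j + 1, m] w' ≤ y ∧ y ≤ ![j - 1, j, m - 1, m] w') ∧ H.Adj (p x) (p y) := by
      intro w w' hlt
      fin_cases w <;> fin_cases w' <;> simp only [Fin.reduceFinMk, Fin.reduceLT, Fin.zero_eta,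
        Fin.mk_one, Fin.isValue, lt_self_iff_false, Fin.zero_lt_one, not_lt_zero] at hlt
      · exact ⟨j - 1, j, by simp, by simp, hj'⟩
      · exact ⟨k, j + 1, by simp; omega, by simp; omega, hadjk.symm⟩
      · exact ⟨i, m, by simp; omega, by simp, hadji.symm⟩
      · exact ⟨j, j + 1, by simp, by simp; omega, hj⟩
      · exact ⟨j, m, by simp, by simp, hadjj.symm⟩
      · exact ⟨m - 1, m, by simp; omega, by simp, hm'⟩
    intro w w' hww
    rcases lt_or_gt_of_ne hww with h | h
    · exact hsymm w w' h
    · obtain ⟨x, y, hx, hy, hxy⟩ := hsymm w' w h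
      exact ⟨y, x, hy, hx, hxy.symm⟩

/-- A `K₂,₃` minor whose branch sets are segments of a path. -/
theorem IsPathSeq.hasMinor_two_three {V : Type*} {H : SimpleGraph V} {p : ℕ → V} {m : ℕ}
    (hp : IsPathSeq H p m) (lo hi : Fin 2 → ℕ) (lo' hi' : Fin 3 → ℕ)
    (hle : ∀ w, lo w ≤ hi w ∧ hi w ≤ m) (hle' : ∀ w, lo' w ≤ hi' w ∧ hi' w ≤ m)
    (hdis : hi 0 < lo 1 ∨ hi 1 < lo 0)
    (hdis' : ∀ w w', w < w' → hi' w < lo' w' ∨ hi' w' < lo' w)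
    (hdis'' : ∀ w w', hi w < lo' w' ∨ hi' w' < lo w)
    (hadj : ∀ w w', ∃ x y, (lo w ≤ x ∧ x ≤ hi w) ∧ (lo' w' ≤ y ∧ y ≤ hi' w') ∧
      H.Adj (p x) (p y)) : HasMinor H (completeBipartiteGraph (Fin 2) (Fin 3)) := by
  refine hp.hasMinor (Sum.elim lo lo') (Sum.elim hi hi') ?_ ?_ ?_
  · rintro (w | w)
    · exact hle w
    · exact hle' w
  · rintro (w | w) (w' | w') hne
    · fin_cases w <;> fin_cases w' <;> simp at hne ⊢
      · exact hdis
      · exact hdis.symm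
    · exact hdis'' w w'
    · exact (hdis'' w' w).symm
    · have hne' : w ≠ w' := fun h => hne (h ▸ rfl)
      rcases lt_or_gt_of_ne hne' with h | h
      · exact hdis' w w' h
      · exact (hdis' w' w h).symm
  · rintro (w | w) (w' | w') hww
    · simp at hww
    · exact hadj w w'
    · obtain ⟨x, y, hx, hy, hxy⟩ := hadj w' w
      exact ⟨y, x, hy, hx, hxy.symm⟩
    · simp at hww

/-- A finite nonempty graph without a `K₂,₃` minor has a vertex of degree at most two or a vertex
of degree three whose neighbours are pairwise adjacent. -/
theorem exists_degree_le_two_or_simplicial {V : Type*} [DecidableEq V] {H : SimpleGraph V}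
    [DecidableRel H.Adj] {R : Finset V} (hR : ∀ x y, H.Adj x y → y ∈ R) (hne : R.Nonempty)
    (hH : ¬ HasMinor H (completeBipartiteGraph (Fin 2) (Fin 3))) :
    ∃ x ∈ R, (R.filter (H.Adj x)).card ≤ 2 ∨ (R.filter (H.Adj x)).card = 3 ∧
      ∀ y z, H.Adj x y → H.Adj x z → y ≠ z → H.Adj y z := by
  by_cases hdeg : ∃ x ∈ R, (R.filter (H.Adj x)).card ≤ 2
  · obtain ⟨x, hx, h⟩ := hdeg
    exact ⟨x, hx, .inl h⟩
  push Not at hdeg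
  obtain ⟨p, m, i, hp, hpR, hnb, him, hadji, himin, ⟨j₀, hij₀, hjm₀, hadjj₀⟩, hk⟩ :=
    exists_extremal_path hR hne hdeg
  have hm' := hp.adj (m - 1) (by omega)
  rw [show m - 1 + 1 = m by omega] at hm'
  -- If position `j + 2` still precedes `m`, then `j + 1` and `m` are both joined to the segment
  -- before `j`, to `j`, and to the segment between `j + 1` and `m`. Hence the neighbours of the end
  -- are at `i`, `m - 2` and `m - 1` only.
  have hj : ∀ j, i < j → j + 1 < m → H.Adj (p m) (p j) → j + 2 = m := by
    intro j hij hjm hadjj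
    by_contra hne
    obtain ⟨k, hkj, hadjk⟩ := hk j hij hjm hadjj
    have hj1 := hp.adj j (by omega)
    have hj2 := hp.adj (j + 1) (by omega)
    refine hH (hp.hasMinor_two_three ![j + 1, m] ![j + 1, m] ![0, j, j + 2] ![j - 1, j, m - 1]
      ?_ ?_ ?_ ?_ ?_ ?_)
    · intro w; fin_cases w <;> simp <;> omega
    · intro w; fin_cases w <;> simp <;> omega
    · simp; omega
    · intro w w' h; fin_cases w <;> fin_cases w' <;> simp at h ⊢ <;> omega
    · intro w w'; fin_cases w <;> fin_cases w' <;> simp <;> omega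
    · intro w w'
      fin_cases w <;> fin_cases w'
      · exact ⟨j + 1, k, by simp, by simp; omega, hadjk⟩
      · exact ⟨j + 1, j, by simp, by simp, hj1.symm⟩
      · exact ⟨j + 1, j + 2, by simp, by simp; omega, hj2⟩
      · exact ⟨m, i, by simp, by simp; omega, hadji⟩
      · exact ⟨m, j, by simp, by simp, hadjj⟩
      · exact ⟨m, m - 1, by simp, by simp; omega, hm'.symm⟩
  obtain rfl := hj j₀ hij₀ hjm₀ hadjj₀
  obtain ⟨k, hkj, hadjk⟩ := hk j₀ hij₀ hjm₀ hadjj₀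
  have hj1 := hp.adj j₀ (by omega)
  have hj2 := hp.adj (j₀ + 1) (by omega)
  have hj0 := hp.adj (j₀ - 1) (by omega)
  rw [show j₀ - 1 + 1 = j₀ by omega] at hj0
  have hi1 := hp.adj i (by omega)
  -- The earlier neighbour of `p (m - 1)` given by the rotation must be the earliest neighbour of `p
  -- m`. If it came before or after, cutting the path at the later of `i` and `k` would exhibit
  -- `K₂,₃`, with the segment from there to `j₀ - 1` as one of the two vertices on the small side.
  have hki : k = i := by
    rcases lt_trichotomy k i with hlt | h | hlt
    · exfalso
      have hi0 := hp.adj (i - 1) (by omega)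
      rw [show i - 1 + 1 = i by omega] at hi0
      refine hH (hp.hasMinor_two_three ![j₀ + 1, i] ![j₀ + 1, j₀ - 1] ![k, j₀, j₀ + 2]
        ![i - 1, j₀, j₀ + 2] ?_ ?_ ?_ ?_ ?_ ?_)
      · intro w; fin_cases w <;> simp <;> omega
      · intro w; fin_cases w <;> simp <;> omega
      · simp
      · intro w w' h; fin_cases w <;> fin_cases w' <;> simp at h ⊢ <;> omega
      · intro w w'; fin_cases w <;> fin_cases w' <;> simp <;> omega
      · intro w w'
        fin_cases w <;> fin_cases w'
        · exact ⟨j₀ + 1, k, by simp, by simp; omega, hadjk⟩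
        · exact ⟨j₀ + 1, j₀, by simp, by simp, hj1.symm⟩
        · exact ⟨j₀ + 1, j₀ + 2, by simp, by simp, hj2⟩
        · exact ⟨i, i - 1, by simp; omega, by simp; omega, hi0.symm⟩
        · exact ⟨j₀ - 1, j₀, by simp; omega, by simp, hj0⟩
        · exact ⟨i, j₀ + 2, by simp; omega, by simp, hadji.symm⟩
    · exact h
    · exfalso
      have hk0 := hp.adj (k - 1) (by omega)
      rw [show k - 1 + 1 = k by omega] at hk0
      refine hH (hp.hasMinor_two_three ![j₀ + 2, k] ![j₀ + 2, j₀ - 1] ![i, j₀, j₀ + 1]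
        ![k - 1, j₀, j₀ + 1] ?_ ?_ ?_ ?_ ?_ ?_)
      · intro w; fin_cases w <;> simp <;> omega
      · intro w; fin_cases w <;> simp <;> omega
      · simp; omega
      · intro w w' h; fin_cases w <;> fin_cases w' <;> simp at h ⊢ <;> omega
      · intro w w'; fin_cases w <;> fin_cases w' <;> simp <;> omega
      · intro w w'
        fin_cases w <;> fin_cases w'
        · exact ⟨j₀ + 2, i, by simp, by simp; omega, hadji⟩
        · exact ⟨j₀ + 2, j₀, by simp, by simp, hadjj₀⟩
        · exact ⟨j₀ + 2, j₀ + 1, by simp, by simp, hj2.symm⟩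
        · exact ⟨k, k - 1, by simp; omega, by simp; omega, hk0.symm⟩
        · exact ⟨j₀ - 1, j₀, by simp; omega, by simp, hj0⟩
        · exact ⟨k, j₀ + 1, by simp; omega, by simp, hadjk.symm⟩
  subst hki
  -- A nonempty segment strictly between `k` and `j₀` would be a third common neighbour of `p k` and
  -- `p j₀`, besides the last two vertices of the path.
  have hkj' : k + 1 = j₀ := by
    by_contra hne
    refine hH (hp.hasMinor_two_three ![k, j₀] ![k, j₀] ![k + 1, j₀ + 2, j₀ + 1]
        ![j₀ - 1, j₀ + 2, j₀ + 1] ?_ ?_ ?_ ?_ ?_ ?_)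
    · intro w; fin_cases w <;> simp <;> omega
    · intro w; fin_cases w <;> simp <;> omega
    · simp; omega
    · intro w w' h; fin_cases w <;> fin_cases w' <;> simp at h ⊢ <;> omega
    · intro w w'; fin_cases w <;> fin_cases w' <;> simp <;> omega
    · intro w w'
      fin_cases w <;> fin_cases w'
      · exact ⟨k, k + 1, by simp, by simp; omega, hi1⟩
      · exact ⟨k, j₀ + 2, by simp, by simp, hadji.symm⟩
      · exact ⟨k, j₀ + 1, by simp, by simp, hadjk.symm⟩
      · exact ⟨j₀, j₀ - 1, by simp, by simp; omega, hj0.symm⟩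
      · exact ⟨j₀, j₀ + 2, by simp, by simp, hadjj₀.symm⟩
      · exact ⟨j₀, j₀ + 1, by simp, by simp, hj1⟩
  subst hkj'
  have hN : ∀ x, H.Adj (p (k + 1 + 2)) x → x = p k ∨ x = p (k + 1) ∨ x = p (k + 1 + 1) := by
    intro x hx
    obtain ⟨t, ht, rfl⟩ := hnb x hx
    have h1 := himin t ht.le hx
    by_cases h2 : t = k
    · exact .inl (h2 ▸ rfl)
    by_cases h3 : t = k + 1 + 1
    · exact .inr (.inr (h3 ▸ rfl))
    have := hj t (by omega) (by omega) hx
    exact .inr (.inl (by rw [show t = k + 1 by omega]))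
  refine ⟨_, hpR, .inr ⟨le_antisymm ?_ (hdeg _ hpR), ?_⟩⟩
  · have : R.filter (H.Adj (p (k + 1 + 2))) ⊆ {p k, p (k + 1), p (k + 1 + 1)} := by
      intro x hx
      simpa using hN x (Finset.mem_filter.1 hx).2
    exact (Finset.card_le_card this).trans Finset.card_le_three
  · intro y z hy hz hyz
    rcases hN y hy with rfl | rfl | rfl <;> rcases hN z hz with rfl | rfl | rfl
    · exact absurd rfl hyz
    · exact hi1
    · exact hadjk.symm
    · exact hi1.symm
    · exact absurd rfl hyz
    · exact hj1
    · exact hadjk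
    · exact hj1.symm
    · exact absurd rfl hyz

/-! ### The objective function on labellings -/

section Objective

set_option linter.unusedSectionVars false

variable {α : Type*} [DecidableEq α]

/-- The total value of the partition of `R` into the classes of equally labelled elements. -/
noncomputable def obj (v : Finset α → ℝ) (R : Finset α) (l : α → ℕ) : ℝ :=
  ∑ c ∈ R.image l, v (R.filter (l · = c))

/-- The labelling `l` maximises the total value on `R`. -/
def IsOpt (v : Finset α → ℝ) (R : Finset α) (l : α → ℕ) : Prop :=
  ∀ l' : α → ℕ, obj v R l' ≤ obj v R l

/-- Unused labels contribute the empty class, which has value zero. So the sum may run over any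
larger label set. -/
theorem obj_eq_sum {v : Finset α → ℝ} (hv : v ∅ = 0) {R : Finset α} {l : α → ℕ} {L : Finset ℕ}
    (hL : ∀ x ∈ R, l x ∈ L) : obj v R l = ∑ c ∈ L, v (R.filter (l · = c)) := by
  refine Finset.sum_subset (fun c hc => ?_) fun c _ hc => ?_
  · obtain ⟨x, hx, rfl⟩ := Finset.mem_image.1 hc
    exact hL x hx
  · rw [Finset.filter_eq_empty_iff.2, hv]
    intro x hx hxc
    exact hc (Finset.mem_image.2 ⟨x, hx, hxc⟩)

theorem obj_congr (v : Finset α → ℝ) {R : Finset α} {l l' : α → ℕ} (h : ∀ x ∈ R, l x = l' x) :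
    obj v R l = obj v R l' := by
  unfold obj
  rw [Finset.image_congr (g := l') fun x hx => h x hx]
  refine Finset.sum_congr rfl fun c _ => ?_
  rw [Finset.filter_congr fun x hx => by rw [h x hx]]

theorem obj_insert {v : Finset α → ℝ} (hv : v ∅ = 0) (R : Finset α) (u : α) (l : α → ℕ) :
    obj v (insert u R) l = obj v R l +
      (v (insert u (R.filter (l · = l u))) - v (R.filter (l · = l u))) := by
  rw [obj_eq_sum hv (R := R) (L := (insert u R).image l)
    fun x hx => Finset.mem_image_of_mem _ (Finset.mem_insert_of_mem hx), obj, ← sub_eq_iff_eq_add',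
    ← Finset.sum_sub_distrib, Finset.sum_eq_single (l u)]
  · rw [Finset.filter_insert, if_pos rfl]
  · intro c _ hc
    rw [Finset.filter_insert, if_neg (Ne.symm hc), sub_self]
  · exact fun h => absurd (Finset.mem_image_of_mem _ (Finset.mem_insert_self _ _)) h

theorem obj_add (v w : Finset α → ℝ) (R : Finset α) (l : α → ℕ) :
    obj (fun S => v S + w S) R l = obj v R l + obj w R l :=
  Finset.sum_add_distrib

theorem obj_pair {R : Finset α} (l : α → ℕ) {a b : α} (ha : a ∈ R) (hb : b ∈ R) (r : ℝ) :
    obj (fun S => if a ∈ S ∧ b ∈ S then r else 0) R l = if l a = l b then r else 0 := by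
  rw [obj, Finset.sum_eq_single (l a)]
  · simp [ha, hb, eq_comm]
  · intro c _ hc
    simp [Ne.symm hc]
  · exact fun h => absurd (Finset.mem_image_of_mem _ ha) h

theorem obj_triple {R : Finset α} (l : α → ℕ) {a b c : α} (ha : a ∈ R) (hb : b ∈ R) (hc : c ∈ R)
    (r : ℝ) : obj (fun S => if a ∈ S ∧ b ∈ S ∧ c ∈ S then r else 0) R l =
      if l a = l b ∧ l a = l c then r else 0 := by
  rw [obj, Finset.sum_eq_single (l a)]
  · simp [ha, hb, hc, eq_comm]
  · intro c _ hc
    simp [Ne.symm hc]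
  · exact fun h => absurd (Finset.mem_image_of_mem _ ha) h

/-! ### Independence of disconnected members on a set of vertices -/

/-- Independence of disconnected members for coalitions contained in `R`. -/
def IDMOn (H : SimpleGraph α) (R : Finset α) (v : Finset α → ℝ) : Prop :=
  ∀ (i j : α) (C : Finset α), i ∈ R → j ∈ R → C ⊆ R → i ≠ j → ¬ H.Adj i j → i ∉ C → j ∉ C →
    v (insert i C) + v (insert j C) = v (insert i (insert j C)) + v C

/-- Vertices of `B` outside `A` are not adjacent to `u`, so adding them one by one leaves the
marginal contribution of `u` unchanged. With `A` the trace of `B` on the neighbourhood of `u`, this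
is the locality on which elimination rests. -/
theorem IDMOn.insert_sub {H : SimpleGraph α} {R : Finset α} {v : Finset α → ℝ}
    (h : IDMOn H R v) {u : α} (hu : u ∈ R) {A B : Finset α} (hAB : A ⊆ B) (hB : B ⊆ R) (huB : u ∉ B)
    (hN : ∀ x ∈ B, x ∉ A → ¬ H.Adj u x) :
    v (insert u B) - v B = v (insert u A) - v A := by
  obtain ⟨D, rfl⟩ : ∃ D, B = D ∪ A := ⟨B, (Finset.union_eq_left.2 hAB).symm⟩
  clear hAB
  induction D using Finset.induction_on with
  | empty => simp
  | insert x D hx ih =>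
    rw [Finset.insert_union] at *
    by_cases hxA : x ∈ D ∪ A
    · rw [Finset.insert_eq_of_mem hxA] at *
      exact ih hB huB hN
    · have hB' := (Finset.insert_subset_iff.1 hB)
      rw [Finset.mem_insert, not_or] at huB
      have h1 := ih hB'.2 huB.2 fun y hy => hN y (Finset.mem_insert_of_mem hy)
      have h2 := h u x (D ∪ A) hu hB'.1 hB'.2 huB.1
        (hN x (Finset.mem_insert_self _ _) fun h => hxA (Finset.mem_union_right _ h)) huB.2 hxA
      linarith

/-- The value is additive on sets that are not joined by edges. -/
theorem IDMOn.union {H : SimpleGraph α} {R : Finset α} {v : Finset α → ℝ}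
    (h : IDMOn H R v) (hv : v ∅ = 0) {A B : Finset α} (hA : A ⊆ R) (hB : B ⊆ R)
    (hAB : Disjoint A B) (hN : ∀ x ∈ A, ∀ y ∈ B, ¬ H.Adj x y) : v (A ∪ B) = v A + v B := by
  induction A using Finset.induction_on with
  | empty => simp [hv]
  | insert x A hx ih =>
    rw [Finset.insert_subset_iff] at hA
    rw [Finset.disjoint_insert_left] at hAB
    have h1 := ih hA.2 hAB.2 fun z hz => hN z (Finset.mem_insert_of_mem hz)
    have h2 := h.insert_sub hA.1 (A := A) (B := A ∪ B) Finset.subset_union_left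
      (Finset.union_subset hA.2 hB) (by simp [hx, hAB.1]) (by
        intro y hy hyA
        exact hN x (Finset.mem_insert_self _ _) y
          ((Finset.mem_union.1 hy).resolve_left hyA))
    rw [Finset.insert_union]
    linarith

/-- If `l` is constant along the edges inside `S`, the value of `S` is the total value of the
classes of `l` on `S`. -/
theorem IDMOn.eq_obj {H : SimpleGraph α} {R : Finset α} {v : Finset α → ℝ}
    (h : IDMOn H R v) (hv : v ∅ = 0) {S : Finset α} (hS : S ⊆ R) {l : α → ℕ}
    (hl : ∀ x ∈ S, ∀ y ∈ S, H.Adj x y → l x = l y) : v S = obj v S l := by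
  -- Classes are split off one label at a time: no edge inside `S` joins the new class to the
  -- earlier ones, so `IDMOn.union` applies.
  have key : ∀ L : Finset ℕ, v (S.filter (l · ∈ L)) = ∑ c ∈ L, v (S.filter (l · = c)) := by
    intro L
    induction L using Finset.induction_on with
    | empty => simp [hv]
    | insert c L hc ih =>
      rw [Finset.sum_insert hc, ← ih]
      have : S.filter (l · ∈ insert c L) = S.filter (l · = c) ∪ S.filter (l · ∈ L) := by
        ext x; simp only [Finset.mem_filter, Finset.mem_insert, Finset.mem_union]; tauto
      rw [this]
      refine h.union hv ((Finset.filter_subset _ _).trans hS) ((Finset.filter_subset _ _).trans hS)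
        ?_ ?_
      · rw [Finset.disjoint_left]
        intro x hx hx'
        rw [Finset.mem_filter] at hx hx'
        exact hc (hx.2 ▸ hx'.2)
      · intro x hx y hy hxy
        rw [Finset.mem_filter] at hx hy
        have := hl x hx.1 y hy.1 hxy
        rw [← this, hx.2] at hy
        exact hc hy.2
  have := key (S.image l)
  rwa [Finset.filter_true_of_mem fun x hx => Finset.mem_image_of_mem _ hx] at this

/-- Splitting every class of `l` into pieces that are not joined by edges keeps the total value. -/
theorem IDMOn.obj_refine {H : SimpleGraph α} {R : Finset α} {v : Finset α → ℝ}
    (h : IDMOn H R v) (hv : v ∅ = 0) {l l' : α → ℕ}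
    (hl : ∀ x ∈ R, ∀ y ∈ R, l' x = l' y → l x = l y)
    (hl' : ∀ x ∈ R, ∀ y ∈ R, H.Adj x y → l x = l y → l' x = l' y) : obj v R l' = obj v R l := by
  have h1 : ∀ c, v (R.filter (l · = c)) =
      ∑ d ∈ R.image l', v ((R.filter (l · = c)).filter (l' · = d)) := by
    intro c
    rw [← obj_eq_sum hv fun x hx => Finset.mem_image_of_mem _ (Finset.mem_filter.1 hx).1]
    refine h.eq_obj hv (Finset.filter_subset _ _) ?_
    intro x hx y hy hxy
    rw [Finset.mem_filter] at hx hy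
    exact hl' x hx.1 y hy.1 hxy (hx.2.trans hy.2.symm)
  unfold obj
  rw [Finset.sum_congr rfl fun c _ => h1 c, Finset.sum_comm]
  refine Finset.sum_congr rfl fun d hd => ?_
  obtain ⟨z, hz, rfl⟩ := Finset.mem_image.1 hd
  -- The finer class of `z` lies within a single class of `l`, so all other terms are values of the
  -- empty set.
  rw [Finset.sum_eq_single (l z)]
  · congr 1
    ext x
    simp only [Finset.mem_filter]
    exact ⟨fun hx => ⟨⟨hx.1, hl x hx.1 z hz hx.2⟩, hx.2⟩, fun hx => ⟨hx.1.1, hx.2⟩⟩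
  · intro c _ hc
    rw [Finset.filter_eq_empty_iff.2, hv]
    intro x hx hxz
    rw [Finset.mem_filter] at hx
    exact hc (hx.2.symm.trans (hl x hx.1 z hz hxz))
  · exact fun hz' => absurd (Finset.mem_image_of_mem _ hz) hz'

/-- Without edges and without value on single vertices all total values are zero. -/
theorem IDMOn.obj_eq_zero {H : SimpleGraph α} {R : Finset α} {v : Finset α → ℝ}
    (h : IDMOn H R v) (hv : v ∅ = 0) (hH : ∀ x ∈ R, ∀ y ∈ R, ¬ H.Adj x y)
    (h1 : ∀ x ∈ R, v {x} = 0) (l : α → ℕ) : obj v R l = 0 := by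
  have key : ∀ S ⊆ R, v S = 0 := by
    intro S hS
    induction S using Finset.induction_on with
    | empty => exact hv
    | insert x S hx ih =>
      rw [Finset.insert_subset_iff] at hS
      rw [Finset.insert_eq, h.union hv (by simpa using hS.1) hS.2 (by simpa using hx)
        (fun y hy z hz => hH y (by simp at hy; exact hy ▸ hS.1) z (hS.2 hz)), h1 x hS.1, ih hS.2,
        add_zero]
  exact Finset.sum_eq_zero fun c _ => key _ (Finset.filter_subset _ _)

end Objective

/-! ### Eliminating a vertex -/

/-- The first pair of largest value among `(0, u)` and the pairs in the list. -/
noncomputable def best (u : ℕ) (q : List (ℝ × ℕ)) : ℝ × ℕ :=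
  q.foldl (fun p q => if p.1 < q.1 then q else p) (0, u)

theorem best_foldl_fst (q : List (ℝ × ℕ)) (p : ℝ × ℕ) :
    (q.foldl (fun p q => if p.1 < q.1 then q else p) p).1 =
      (q.map Prod.fst).foldl max p.1 := by
  induction q generalizing p with
  | nil => rfl
  | cons x q ih =>
    simp only [List.foldl_cons, List.map_cons, ih]
    congr 1
    split_ifs with h
    · exact (max_eq_right h.le).symm
    · exact (max_eq_left (not_lt.1 h)).symm

theorem best_fst (u : ℕ) (q : List (ℝ × ℕ)) : (best u q).1 = (q.map Prod.fst).foldl max 0 :=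
  best_foldl_fst q (0, u)

theorem best_mem (u : ℕ) (q : List (ℝ × ℕ)) : best u q = (0, u) ∨ best u q ∈ q := by
  have : ∀ p : ℝ × ℕ, q.foldl (fun p q => if p.1 < q.1 then q else p) p = p ∨
      q.foldl (fun p q => if p.1 < q.1 then q else p) p ∈ q := by
    induction q with
    | nil => simp
    | cons x q ih =>
      intro p
      rw [List.foldl_cons]
      rcases ih (if p.1 < x.1 then x else p) with h | h
      · rw [h]
        split_ifs <;> simp
      · exact .inr (List.mem_cons_of_mem _ h)
  exact this _

/-- The data recorded when a vertex is eliminated: the vertex, three vertices that include its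
neighbours, the weights of pairs and of the triple, and, for each of the five partitions of
the triple, the vertex whose label is to be copied (or the vertex itself). -/
structure Record where
  /-- The eliminated vertex. -/
  u : ℕ
  /-- The first neighbour. -/
  a : ℕ
  /-- The second neighbour. -/
  b : ℕ
  /-- The third neighbour. -/
  c : ℕ
  /-- The weight of the first and second neighbour. -/
  wab : ℝ
  /-- The weight of the first and third neighbour. -/
  wac : ℝ
  /-- The weight of the second and third neighbour. -/
  wbc : ℝ
  /-- The weight of the triple. -/
  wabc : ℝ
  /-- The choice when the neighbours are in different classes. -/
  chz : ℕ
  /-- The choice when just the first and the second neighbour share a class. -/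
  chab : ℕ
  /-- The choice when just the first and the third neighbour share a class. -/
  chac : ℕ
  /-- The choice when just the second and the third neighbour share a class. -/
  chbc : ℕ
  /-- The choice when the neighbours share a class. -/
  chabc : ℕ

/-- The contribution of an eliminated vertex to the value of a coalition. -/
noncomputable def Record.term (r : Record) (S : Finset ℕ) : ℝ :=
  (if r.a ∈ S ∧ r.b ∈ S then r.wab else 0) + (if r.a ∈ S ∧ r.c ∈ S then r.wac else 0) +
  (if r.b ∈ S ∧ r.c ∈ S then r.wbc else 0) + (if r.a ∈ S ∧ r.b ∈ S ∧ r.c ∈ S then r.wabc else 0)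

/-- The vertex whose label the eliminated vertex copies. -/
def Record.choice (r : Record) (l : ℕ → ℕ) : ℕ :=
  if l r.a = l r.b then (if l r.a = l r.c then r.chabc else r.chab)
  else if l r.a = l r.c then r.chac else if l r.b = l r.c then r.chbc else r.chz

/-- The labelling extended to the eliminated vertex. -/
def Record.extend (r : Record) (l : ℕ → ℕ) : ℕ → ℕ :=
  Function.update l r.u (if r.choice l = r.u then r.u else l (r.choice l))

/-- The gain of adding `u` to the coalition `A`, compared with leaving it alone. -/
noncomputable def gain (v : Finset ℕ → ℝ) (u : ℕ) (A : Finset ℕ) : ℝ :=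
  v (insert u A) - v A - v {u}

/-- The record of the elimination of `u`. -/
noncomputable def mkRecord (v : Finset ℕ → ℝ) (u a b c : ℕ) : Record :=
  let d := gain v u
  let z := best u [(d {a}, a), (d {b}, b), (d {c}, c)]
  let ab := best u [(d {a, b}, a), (d {c}, c)]
  let ac := best u [(d {a, c}, a), (d {b}, b)]
  let bc := best u [(d {b, c}, b), (d {a}, a)]
  let abc := best u [(d {a, b, c}, a)]
  ⟨u, a, b, c, ab.1 - z.1, ac.1 - z.1, bc.1 - z.1, abc.1 - ab.1 - ac.1 - bc.1 + z.1 + z.1,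
    z.2, ab.2, ac.2, bc.2, abc.2⟩

/-- The largest gain from adding `u` to a class of `l`, and an element of that class. -/
noncomputable def bestPair (v : Finset ℕ → ℝ) (u a b c : ℕ) (l : ℕ → ℕ) : ℝ × ℕ :=
  let d := gain v u
  if l a = l b then
    (if l a = l c then best u [(d {a, b, c}, a)] else best u [(d {a, b}, a), (d {c}, c)])
  else if l a = l c then best u [(d {a, c}, a), (d {b}, b)]
  else if l b = l c then best u [(d {b, c}, b), (d {a}, a)]
  else best u [(d {a}, a), (d {b}, b), (d {c}, c)]

/-- The conditions for eliminating `u`. -/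
structure Eliminable (H : SimpleGraph ℕ) (R : Finset ℕ) (u a b c : ℕ) : Prop where
  hu : u ∈ R
  ha : a ∈ R.erase u
  hb : b ∈ R.erase u
  hc : c ∈ R.erase u
  hab : a ≠ b
  hac : a ≠ c
  hbc : b ≠ c
  nbr : ∀ x ∈ R, H.Adj u x → x = a ∨ x = b ∨ x = c

/-! ### Optimality and independence under elimination -/

section Elimination

variable {H : SimpleGraph ℕ} {R : Finset ℕ} {v : Finset ℕ → ℝ} {u a b c : ℕ}

/-- The weights interpolate the best gain over the five partitions of the triple. The all-separate
partition is the base value, each pair weight is the excess of its partition over the base, and the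
triple weight corrects the sum of the pair weights when all three agree. -/
theorem obj_term (he : Eliminable H R u a b c) (l : ℕ → ℕ) :
    obj (mkRecord v u a b c).term (R.erase u) l = (bestPair v u a b c l).1 -
      (best u [(gain v u {a}, a), (gain v u {b}, b), (gain v u {c}, c)]).1 := by
  have := he.ha
  have := he.hb
  have := he.hc
  have h : (mkRecord v u a b c).term = fun S =>
      (if a ∈ S ∧ b ∈ S then (mkRecord v u a b c).wab else 0) +
      (if a ∈ S ∧ c ∈ S then (mkRecord v u a b c).wac else 0) +
      (if b ∈ S ∧ c ∈ S then (mkRecord v u a b c).wbc else 0) +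
      (if a ∈ S ∧ b ∈ S ∧ c ∈ S then (mkRecord v u a b c).wabc else 0) := rfl
  rw [h, obj_add (w := fun S => if a ∈ S ∧ b ∈ S ∧ c ∈ S then (mkRecord v u a b c).wabc else 0),
    obj_add (w := fun S => if b ∈ S ∧ c ∈ S then (mkRecord v u a b c).wbc else 0),
    obj_add, obj_pair l he.ha he.hb, obj_pair l he.ha he.hc, obj_pair l he.hb he.hc,
    obj_triple l he.ha he.hb he.hc]
  simp only [mkRecord, bestPair]
  by_cases h1 : l a = l b <;> by_cases h2 : l a = l c
  · simp only [if_pos h1, if_pos h2, if_pos (h1 ▸ h2 : l b = l c), if_pos (And.intro h1 h2)]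
    ring
  · simp only [if_pos h1, if_neg h2, if_neg (h1 ▸ h2 : ¬ l b = l c),
      if_neg (fun h => h2 h.2 : ¬ (l a = l b ∧ l a = l c))]
    ring
  · have h3 : ¬ l b = l c := fun h => h1 (h2.trans h.symm)
    simp only [if_neg h1, if_pos h2, if_neg h3, if_neg (fun h => h1 h.1 : ¬ (l a = l b ∧ l a = l c))]
    ring
  · simp only [if_neg h1, if_neg h2, if_neg (fun h => h1 h.1 : ¬ (l a = l b ∧ l a = l c))]
    split_ifs <;> ring

/-- By `IDMOn.insert_sub`, the part of the class outside `{a, b, c}` does not influence what `u`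
adds. -/
theorem gain_class (hI : IDMOn H R v) (he : Eliminable H R u a b c) (l : ℕ → ℕ) (z : ℕ) :
    v (insert u ((R.erase u).filter (l · = z))) - v ((R.erase u).filter (l · = z)) =
      v {u} + gain v u (({a, b, c} : Finset ℕ).filter (l · = z)) := by
  have h : v (insert u ((R.erase u).filter (l · = z))) - v ((R.erase u).filter (l · = z)) = _ :=
    hI.insert_sub (A := ({a, b, c} : Finset ℕ).filter (l · = z)) he.hu
    (by
      refine Finset.filter_subset_filter _ ?_
      have := he.ha
      have := he.hb
      have := he.hc
      simp [Finset.insert_subset_iff, *])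
    ((Finset.filter_subset _ _).trans (Finset.erase_subset _ _)) (by simp)
    (by
      intro x hx hx' hadj
      rw [Finset.mem_filter] at hx
      refine hx' (Finset.mem_filter.2 ⟨?_, hx.2⟩)
      simpa using he.nbr x (Finset.mem_of_mem_erase hx.1) hadj)
  rw [h, gain]
  ring

theorem gain_empty (hv : v ∅ = 0) : gain v u ∅ = 0 := by simp [gain, hv]

/-- A class meets `{a, b, c}` either in a block of the induced partition, whose gain is among the
candidates, or not at all, when the gain is zero, the starting value of `best`. -/
theorem gain_le_bestPair (hv : v ∅ = 0) (l : ℕ → ℕ) (z : ℕ) :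
    gain v u (({a, b, c} : Finset ℕ).filter (l · = z)) ≤ (bestPair v u a b c l).1 := by
  have h0 := gain_empty (u := u) hv
  simp only [Finset.filter_insert, Finset.filter_singleton, bestPair, apply_ite Prod.fst,
    best_fst, List.map_cons, List.map_nil, List.foldl_cons, List.foldl_nil]
  by_cases h1 : l a = z <;> by_cases h2 : l b = z <;> by_cases h3 : l c = z <;>
    simp only [h1, h2, h3, if_true, if_false, insert_empty_eq, h0] <;>
    (try split_ifs) <;> first | omega | simp [*]

theorem extend_mkRecord_apply (l : ℕ → ℕ) :
    (mkRecord v u a b c).extend l u =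
      if (bestPair v u a b c l).2 = u then u else l (bestPair v u a b c l).2 := by
  have h : (mkRecord v u a b c).choice l = (bestPair v u a b c l).2 := by
    change (if l a = l b then
        (if l a = l c then (best u [(gain v u {a, b, c}, a)]).2
          else (best u [(gain v u {a, b}, a), (gain v u {c}, c)]).2)
      else if l a = l c then (best u [(gain v u {a, c}, a), (gain v u {b}, b)]).2
      else if l b = l c then (best u [(gain v u {b, c}, b), (gain v u {a}, a)]).2
      else (best u [(gain v u {a}, a), (gain v u {b}, b), (gain v u {c}, c)]).2) = _
    simp only [bestPair]
    split_ifs <;> rfl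
  have hu : (mkRecord v u a b c).u = u := rfl
  rw [Record.extend, h, hu, Function.update_self]

/-- Each candidate gain comes with a representative of its block, so copying that representative's
label puts `u` into the class realising the maximum. -/
theorem bestPair_spec (he : Eliminable H R u a b c) (l : ℕ → ℕ) :
    bestPair v u a b c l = (0, u) ∨ (bestPair v u a b c l).2 ∈ R.erase u ∧
      (bestPair v u a b c l).1 =
        gain v u (({a, b, c} : Finset ℕ).filter (l · = l (bestPair v u a b c l).2)) := by
  have ha := he.ha
  have hb := he.hb
  have hc := he.hc
  have key : ∀ q : List (ℝ × ℕ), (∀ p ∈ q, p.2 ∈ R.erase u ∧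
      p.1 = gain v u (({a, b, c} : Finset ℕ).filter (l · = l p.2))) →
      (best u q = (0, u) ∨ (best u q).2 ∈ R.erase u ∧
        (best u q).1 = gain v u (({a, b, c} : Finset ℕ).filter (l · = l (best u q).2))) :=
    fun q hq => (best_mem u q).imp_right fun h => hq _ h
  simp only [bestPair]
  split_ifs with h1 h2 h2 h3 <;> refine key _ ?_ <;>
    simp only [List.mem_cons, List.not_mem_nil, or_false, forall_eq_or_imp, forall_eq,
      Finset.filter_insert, Finset.filter_singleton, ha, hb, hc, true_and, if_true]
  · simp [← h1, ← h2]
  · simp [← h1, h2, Ne.symm h2]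
  · simp [← h2, h1, Ne.symm h1]
  · simp [← h3, h1, Ne.symm h1]
  · simp [h1, h2, h3, Ne.symm h1, Ne.symm h2, Ne.symm h3]

theorem gain_choice (hv : v ∅ = 0) (he : Eliminable H R u a b c)
    {l : ℕ → ℕ}
    (hl : ∀ x ∈ R.erase u, l x ∈ R.erase u) :
    gain v u (({a, b, c} : Finset ℕ).filter (l · = (mkRecord v u a b c).extend l u)) =
      (bestPair v u a b c l).1 := by
  -- Labels in use are elements of `R.erase u`; hence `u` itself is a fresh label and labelling `u`
  -- by it leaves `u` apart from its neighbours.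
  have hla := Finset.ne_of_mem_erase (hl a he.ha)
  have hlb := Finset.ne_of_mem_erase (hl b he.hb)
  have hlc := Finset.ne_of_mem_erase (hl c he.hc)
  rw [extend_mkRecord_apply]
  rcases bestPair_spec (v := v) he l with h | ⟨h1, h2⟩
  · simp [h, Finset.filter_insert, Finset.filter_singleton, hla, hlb, hlc, gain_empty hv]
  · rw [if_neg (Finset.ne_of_mem_erase h1), h2]

/-- The labelling `l` takes values in `R` on `R`. -/
def Closed (R : Finset ℕ) (l : ℕ → ℕ) : Prop := ∀ x ∈ R, l x ∈ R

theorem Closed.extend (he : Eliminable H R u a b c) {l : ℕ → ℕ} (hl : Closed (R.erase u) l) :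
    Closed R ((mkRecord v u a b c).extend l) := by
  intro x hx
  by_cases hxu : x = u
  · rw [hxu, extend_mkRecord_apply]
    split_ifs with h
    · exact he.hu
    · rcases bestPair_spec (v := v) he l with h' | h'
      · rw [h'] at h
        exact absurd rfl h
      · exact Finset.mem_of_mem_erase (hl _ h'.1)
  · have : (mkRecord v u a b c).extend l x = l x := Function.update_of_ne hxu _ _
    rw [this]
    exact Finset.mem_of_mem_erase (hl x (Finset.mem_erase.2 ⟨hxu, hx⟩))

/-- An optimal labelling for the reduced problem extends to an optimal labelling. -/
theorem IDMOn.extend_isOpt (hI : IDMOn H R v) (hv : v ∅ = 0) (he : Eliminable H R u a b c)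
    {l : ℕ → ℕ}
    (hl : Closed (R.erase u) l)
    (hopt : IsOpt (fun S => v S + (mkRecord v u a b c).term S) (R.erase u) l) :
    IsOpt v R ((mkRecord v u a b c).extend l) := by
  intro l'
  have hR : insert u (R.erase u) = R := Finset.insert_erase he.hu
  have h1 := hopt l'
  -- The reduced objective is the old one on the remaining vertices plus the best gain, up to a
  -- constant that cancels. A competitor achieves at most the best gain, the extension achieves it
  -- exactly.
  rw [obj_add, obj_add, obj_term he, obj_term he] at h1
  rw [← hR, obj_insert hv (R.erase u), obj_insert hv (R.erase u),
    gain_class hI he, gain_class hI he]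
  have hcongr : ∀ x ∈ R.erase u, (mkRecord v u a b c).extend l x = l x := fun x hx =>
    Function.update_of_ne (Finset.ne_of_mem_erase hx) _ _
  rw [obj_congr v hcongr]
  have h2 := gain_le_bestPair (u := u) (a := a) (b := b) (c := c) hv l' (l' u)
  have h3 := gain_choice hv he hl
  have h4 : ({a, b, c} : Finset ℕ).filter
      ((mkRecord v u a b c).extend l · = (mkRecord v u a b c).extend l u) =
      ({a, b, c} : Finset ℕ).filter (l · = (mkRecord v u a b c).extend l u) := by
    refine Finset.filter_congr fun x hx => ?_
    rw [hcongr x]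
    simp only [Finset.mem_insert, Finset.mem_singleton] at hx
    rcases hx with rfl | rfl | rfl
    · exact he.ha
    · exact he.hb
    · exact he.hc
  rw [h4, h3]
  linarith

theorem gain_insert (hI : IDMOn H R v) (he : Eliminable H R u a b c) {A : Finset ℕ}
    (hA : A ⊆ R.erase u) {x : ℕ} (hx : x ∈ R.erase u) (hadj : ¬ H.Adj u x) :
    gain v u (insert x A) = gain v u A := by
  have := hI.insert_sub he.hu (Finset.subset_insert x A)
    ((Finset.insert_subset hx hA).trans (Finset.erase_subset _ _))
    (fun h => Finset.notMem_erase u R (Finset.insert_subset hx hA h)) (by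
      intro y hy hyA
      rwa [(Finset.mem_insert.1 hy).resolve_right hyA])
  simp only [gain]
  linarith

/-- A vertex not adjacent to `u` is invisible to the added term. Outside `{a, b, c}` this is
immediate; inside, all gains agree with and without `x`, and the weights involving `x` cancel
accordingly. This case covers the pads. -/
theorem term_insert (hI : IDMOn H R v) (hv : v ∅ = 0) (he : Eliminable H R u a b c) {x : ℕ}
    (hx : x ∈ R.erase u) (hadj : ¬ H.Adj u x) (S : Finset ℕ) :
    (mkRecord v u a b c).term (insert x S) = (mkRecord v u a b c).term S := by
  have hab := he.hab
  have hac := he.hac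
  have hbc := he.hbc
  have hsub : ∀ {A : Finset ℕ}, A ⊆ {a, b, c} → A ⊆ R.erase u := fun {A} hA => hA.trans (by
    simp only [Finset.insert_subset_iff, Finset.singleton_subset_iff]
    exact ⟨he.ha, he.hb, he.hc⟩)
  have hins : ∀ A : Finset ℕ, A ⊆ {a, b, c} → gain v u (insert x A) = gain v u A :=
    fun A hA => gain_insert hI he (hsub hA) hx hadj
  have h1 : gain v u {x} = 0 := by
    rw [← insert_empty_eq, hins ∅ (by simp), gain_empty hv]
  by_cases h : x = a ∨ x = b ∨ x = c
  · rcases h with rfl | rfl | rfl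
    · have h2 := hins {b} (by simp)
      have h3 := hins {c} (by simp)
      have h4 := hins {b, c} (by simp)
      simp only [Record.term, mkRecord, best_fst, List.map_cons, List.map_nil, List.foldl_cons,
        List.foldl_nil, h1, h2, h3, h4, Finset.mem_insert, hab.symm, hac.symm, false_or]
      grind
    · have h2 := hins {a} (by simp)
      have h3 := hins {c} (by simp)
      have h4 := hins {a, c} (by simp [Finset.insert_subset_iff])
      rw [Finset.pair_comm] at h2
      rw [Finset.insert_comm] at h4
      simp only [Record.term, mkRecord, best_fst, List.map_cons, List.map_nil, List.foldl_cons,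
        List.foldl_nil, h1, h2, h3, h4, Finset.mem_insert, hab, hbc.symm, false_or]
      grind
    · have h2 := hins {a} (by simp)
      have h3 := hins {b} (by simp)
      have h4 := hins {a, b} (by simp [Finset.insert_subset_iff])
      rw [Finset.pair_comm] at h2 h3
      rw [Finset.insert_comm, Finset.pair_comm x b] at h4
      simp only [Record.term, mkRecord, best_fst, List.map_cons, List.map_nil, List.foldl_cons,
        List.foldl_nil, h1, h2, h3, h4, Finset.mem_insert, hac, hbc, false_or]
      grind
  · push Not at h
    have key : ∀ r : Record, x ≠ r.a ∧ x ≠ r.b ∧ x ≠ r.c → r.term (insert x S) = r.term S :=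
      fun r hr => by
        simp only [Record.term, Finset.mem_insert, hr.1.symm, hr.2.1.symm, hr.2.2.symm, false_or]
    exact key _ h

/-- Independence of disconnected members is inherited by the reduced problem. -/
theorem IDMOn.eliminate (hI : IDMOn H R v) (hv : v ∅ = 0) (he : Eliminable H R u a b c) :
    IDMOn (GCSG.eliminate H u) (R.erase u) (fun S => v S + (mkRecord v u a b c).term S) := by
  intro i j C hi hj hC hij hadj hiC hjC
  have hiu := Finset.ne_of_mem_erase hi
  have hju := Finset.ne_of_mem_erase hj
  rw [eliminate_adj] at hadj
  have h1 := hI i j C (Finset.mem_of_mem_erase hi) (Finset.mem_of_mem_erase hj)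
    (hC.trans (Finset.erase_subset _ _)) hij (fun h => hadj ⟨hiu, hju, .inl h⟩) hiC hjC
  -- Two neighbours of `u` would have become adjacent. So the added term ignores `i` or `j` and
  -- contributes nothing to their mixed difference.
  have h2 : ¬ H.Adj u i ∨ ¬ H.Adj u j := by
    by_contra h
    push Not at h
    exact hadj ⟨hiu, hju, .inr ⟨hij, h.1, h.2⟩⟩
  rcases h2 with h2 | h2
  · have h3 := term_insert hI hv he hi h2
    simp only [h3]
    linarith
  · have h3 := term_insert hI hv he hj h2
    simp only [Finset.insert_comm i j, h3]
    rw [Finset.insert_comm i j] at h1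
    linarith

end Elimination

/-! ### Inputs as functions on sets of natural numbers -/

/-- The graph of the input on the natural numbers; the numbers that are not nodes are isolated. -/
def Input.natGraph (I : Input) : SimpleGraph ℕ where
  Adj x y := ∃ (hx : x < I.n) (hy : y < I.n), I.graph.Adj ⟨x, hx⟩ ⟨y, hy⟩
  symm := ⟨fun _ _ ⟨hx, hy, h⟩ => ⟨hy, hx, h.symm⟩⟩
  loopless := ⟨fun _ ⟨_, _, h⟩ => I.graph.irrefl h⟩

/-- The nodes in a set of natural numbers. -/
def Input.nodes (I : Input) (S : Finset ℕ) : Finset (Fin I.n) :=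
  Finset.univ.filter fun i => (i : ℕ) ∈ S

/-- The value of the nodes in a set of natural numbers. -/
def Input.natValue (I : Input) (S : Finset ℕ) : ℝ := I.value (I.nodes S)

theorem Input.natGraph_adj {I : Input} {x y : ℕ} : I.natGraph.Adj x y ↔
    ∃ (hx : x < I.n) (hy : y < I.n), I.graph.Adj ⟨x, hx⟩ ⟨y, hy⟩ := Iff.rfl

theorem Input.nodes_insert_of_lt (I : Input) {x : ℕ} (hx : x < I.n) (S : Finset ℕ) :
    I.nodes (insert x S) = insert ⟨x, hx⟩ (I.nodes S) := by
  ext i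
  simp [Input.nodes, Fin.ext_iff]

theorem Input.nodes_insert_of_le (I : Input) {x : ℕ} (hx : I.n ≤ x) (S : Finset ℕ) :
    I.nodes (insert x S) = I.nodes S := by
  ext i
  have := i.2
  have : (i : ℕ) ≠ x := by omega
  simp [Input.nodes, this]

theorem Input.nodes_empty (I : Input) : I.nodes ∅ = ∅ := by simp [Input.nodes]

theorem Input.natValue_empty {I : Input} (hI : I.value ∅ = 0) : I.natValue ∅ = 0 := by
  rw [Input.natValue, I.nodes_empty, hI]

theorem Input.natValue_singleton {I : Input} (hI : I.value ∅ = 0) {x : ℕ} (hx : I.n ≤ x) :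
    I.natValue {x} = 0 := by
  rw [Input.natValue, ← insert_empty_eq, I.nodes_insert_of_le hx, I.nodes_empty, hI]

theorem Input.natValue_idm {I : Input} (hI : IDM I.graph I.value) (R : Finset ℕ) :
    IDMOn I.natGraph R I.natValue := by
  intro i j C _ _ _ hij hadj hiC hjC
  simp only [Input.natValue]
  by_cases hi : i < I.n
  · by_cases hj : j < I.n
    · simp only [I.nodes_insert_of_lt hi, I.nodes_insert_of_lt hj]
      have := hI ⟨i, hi⟩ ⟨j, hj⟩ (I.nodes C) (by simpa using hij)
        (fun h => hadj ⟨hi, hj, h⟩) (by simpa [Input.nodes] using hiC)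
        (by simpa [Input.nodes] using hjC)
      linarith
    · have hj' := not_lt.1 hj
      simp only [Finset.insert_comm i j, I.nodes_insert_of_le hj']
  · have hi' := not_lt.1 hi
    simp only [I.nodes_insert_of_le hi']
    ring

/-- Numbers that are not nodes are isolated, so they may be modelled by the empty set. -/
theorem HasMinor.of_natGraph {I : Input} {W : Type*} {K : SimpleGraph W}
    (hK : ∀ w, ∃ w', K.Adj w w') (h : HasMinor I.natGraph K) : HasMinor I.graph K := by
  refine h.of_model (fun x => {i : Fin I.n | (i : ℕ) = x}) hK ?_ ?_ ?_
  · rintro x y ⟨hx, -, -⟩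
    have : {i : Fin I.n | (i : ℕ) = x} = {⟨x, hx⟩} := by
      ext i
      simp [Fin.ext_iff]
    rw [this]
    exact induce_singleton_connected _ _
  · intro x y hxy
    rw [Set.disjoint_left]
    rintro i rfl
    exact hxy
  · rintro x y ⟨hx, hy, h⟩
    exact ⟨_, rfl, _, rfl, h⟩

/-! ### Coalition structures and labellings -/

theorem obj_univ_eq_sum {n : ℕ} {v : Finset (Fin n) → ℝ} (hv : v ∅ = 0) (l : Fin n → ℕ)
    {L : Finset ℕ} (hL : ∀ x, l x ∈ L) :
    obj v Finset.univ l = ∑ c ∈ L, v (Finset.univ.filter (l · = c)) :=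
  obj_eq_sum hv fun x _ => hL x

/-- Pads are discarded by `Input.nodes`, so the padded problem has the same total values whatever
labels the pads receive. -/
theorem obj_natValue {I : Input} (hI : I.value ∅ = 0) {m : ℕ} (hm : I.n ≤ m) (l : ℕ → ℕ) :
    obj I.natValue (Finset.range m) l = obj I.value Finset.univ fun i : Fin I.n => l i := by
  rw [obj_univ_eq_sum hI _ (L := (Finset.range m).image l), obj]
  · refine Finset.sum_congr rfl fun c _ => ?_
    rw [Input.natValue]
    congr 1
    ext i
    have := i.2
    have : (i : ℕ) < m := by omega
    simp [Input.nodes, this]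
  · intro x
    have := x.2
    exact Finset.mem_image_of_mem _ (Finset.mem_range.2 (by omega))

theorem totalValue_eq_obj {n : ℕ} (v : Finset (Fin n) → ℝ) (P : CoalitionStructure n)
    {l : Fin n → ℕ} (hl : ∀ i j, l i = l j ↔ P.part i = P.part j) :
    totalValue v P = obj v Finset.univ l := by
  have hfil : ∀ i, Finset.univ.filter (l · = l i) = P.part i := by
    intro i
    ext j
    rw [Finset.mem_filter, and_iff_right (Finset.mem_univ j), hl,
      ← P.mem_part_iff_part_eq_part (Finset.mem_univ _) (Finset.mem_univ _)]
  refine (Finset.sum_bij (fun c _ => Finset.univ.filter (l · = c)) ?_ ?_ ?_ ?_).symm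
  · intro c hc
    obtain ⟨i, -, rfl⟩ := Finset.mem_image.1 hc
    rw [hfil]
    exact P.part_mem.2 (Finset.mem_univ i)
  · intro c hc d hd hcd
    obtain ⟨i, -, rfl⟩ := Finset.mem_image.1 hc
    obtain ⟨j, -, rfl⟩ := Finset.mem_image.1 hd
    simp only [hfil] at hcd
    exact (hl i j).2 hcd
  · intro C hC
    obtain ⟨i, hi⟩ := P.nonempty_of_mem_parts hC
    refine ⟨l i, Finset.mem_image_of_mem _ (Finset.mem_univ i), ?_⟩
    rw [hfil]
    exact P.part_eq_of_mem hC hi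
  · exact fun _ _ => rfl

/-- Labels that distinguish the components of a subgraph and whose classes have maximum total value
encode a solution. -/
theorem isSolution_of_reachable {I : Input} {F : SimpleGraph (Fin I.n)} (hF : F ≤ I.graph)
    {label : Fin I.n → ℕ} (hl : ∀ i j, label i = label j ↔ F.Reachable i j)
    (hopt : IsOpt I.value Finset.univ label) : I.IsSolution label := by
  let _ : DecidableRel (Setoid.ker label).r :=
    fun i j => inferInstanceAs (Decidable (label i = label j))
  have hpart : ∀ i j, j ∈ (Finpartition.ofSetoid (Setoid.ker label)).part i ↔
      label i = label j := fun i j => Finpartition.mem_part_ofSetoid_iff_rel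
  have hlP : ∀ i j, label i = label j ↔ (Finpartition.ofSetoid (Setoid.ker label)).part i =
      (Finpartition.ofSetoid (Setoid.ker label)).part j := by
    intro i j
    rw [← hpart, Finpartition.mem_part_iff_part_eq_part _ (Finset.mem_univ _) (Finset.mem_univ _)]
    exact eq_comm
  refine ⟨Finpartition.ofSetoid (Setoid.ker label), hlP, ?_, ?_⟩
  · intro C hC
    obtain ⟨i, hi⟩ := Finpartition.nonempty_of_mem_parts _ hC
    have hCi := Finpartition.part_eq_of_mem _ hC hi
    have hmem : ∀ j, j ∈ C ↔ F.Reachable i j := fun j => by rw [← hCi, hpart, hl]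
    have key : ∀ x y : Fin I.n, F.Walk x y → ∀ (hx : x ∈ (C : Set _)) (hy : y ∈ (C : Set _)),
        (I.graph.induce (C : Set (Fin I.n))).Reachable ⟨x, hx⟩ ⟨y, hy⟩ := by
      intro x y W
      induction W with
      | nil => exact fun _ _ => SimpleGraph.Reachable.refl _
      | @cons x z y h _ ih =>
        intro hx hy
        have hz : z ∈ (C : Set (Fin I.n)) :=
          (hmem z).2 (((hmem x).1 hx).trans h.reachable)
        exact (SimpleGraph.Adj.reachable (G := I.graph.induce (C : Set (Fin I.n)))
          (u := ⟨x, hx⟩) (v := ⟨z, hz⟩) (hF h)).trans (ih hz hy)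
    refine (SimpleGraph.connected_iff _).2 ⟨?_, ⟨⟨i, hi⟩⟩⟩
    rintro ⟨x, hx⟩ ⟨y, hy⟩
    obtain ⟨W⟩ := ((hmem x).1 hx).symm.trans ((hmem y).1 hy)
    exact key x y W hx hy
  · intro Q
    -- Encoding the part of each node as a number turns an arbitrary coalition structure into a
    -- labelling to compare with.
    rw [totalValue_eq_obj I.value _ hlP, totalValue_eq_obj I.value Q
      (l := fun i => Encodable.encode (Q.part i)) fun i j => Encodable.encode_inj]
    exact hopt _

/-- The edges of the graph within the classes of a labelling. -/
def sameLabelGraph {V : Type*} (G : SimpleGraph V) (l : V → ℕ) : SimpleGraph V where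
  Adj x y := G.Adj x y ∧ l x = l y
  symm := ⟨fun _ _ h => ⟨h.1.symm, h.2.symm⟩⟩
  loopless := ⟨fun _ h => G.irrefl h.1⟩

/-- The connected components of the classes of an optimal labelling form a solution. -/
theorem isSolution_of_isOpt {I : Input} (hI : I.IsInstance) {l label : Fin I.n → ℕ}
    (hopt : IsOpt I.value Finset.univ l)
    (hl : ∀ i j, label i = label j ↔ (sameLabelGraph I.graph l).Reachable i j) :
    I.IsSolution label := by
  refine isSolution_of_reachable (F := sameLabelGraph I.graph l) (fun x y h => h.1) hl ?_
  have hidm : IDMOn I.graph Finset.univ I.value := by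
    intro i j C _ _ _ hij hadj hiC hjC
    have := hI.2.2 i j C hij hadj hiC hjC
    linarith
  intro l'
  rw [hidm.obj_refine (l := l) (l' := label) hI.2.1]
  · exact hopt l'
  · intro x _ y _ hxy
    obtain ⟨W⟩ := (hl x y).1 hxy
    clear hxy
    induction W with
    | nil => rfl
    | cons h _ ih => exact h.2.trans (ih (Finset.mem_univ _) (Finset.mem_univ _))
  · intro x _ y _ hxy hlxy
    exact (hl x y).2 (SimpleGraph.Adj.reachable ⟨hxy, hlxy⟩)

/-! ### Trees -/

section Tree

set_option linter.unusedSectionVars false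

variable {V : Type*} [DecidableEq V] {G : SimpleGraph V} {v : Finset V → ℝ}

/-- The synergy of two vertices. -/
def synergy (v : Finset V → ℝ) (x y : V) : ℝ := v {x, y} - v {x} - v {y}

theorem synergy_comm (v : Finset V → ℝ) (x y : V) : synergy v x y = synergy v y x := by
  rw [synergy, synergy, Finset.pair_comm]
  ring

/-- Without triangles, no vertex `z` is adjacent to both `x` and `y`. By independence at the end not
adjacent to `z`, adding `z` to `S` does not change the mixed difference, so it equals its value at
the empty set. -/
theorem second_difference (hv : v ∅ = 0)
    (hI : ∀ (i j : V) (C : Finset V), i ≠ j → ¬ G.Adj i j → i ∉ C → j ∉ C →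
      v (insert i C) + v (insert j C) = v (insert i (insert j C)) + v C)
    (hG : ∀ x y z, G.Adj x y → G.Adj x z → ¬ G.Adj y z) {x y : V} (hxy : G.Adj x y)
    (S : Finset V) (hx : x ∉ S) (hy : y ∉ S) :
    v (insert x (insert y S)) - v (insert y S) - v (insert x S) + v S = synergy v x y := by
  have hne := hxy.ne
  induction S using Finset.induction_on with
  | empty => simp [synergy, hv]; ring
  | insert z S hz ih =>
    rw [Finset.mem_insert, not_or] at hx hy
    rw [← ih hx.2 hy.2]
    by_cases hxz : G.Adj x z
    · have h1 := hI y z S hy.1 (hG x y z hxy hxz) hy.2 hz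
      have h2 := hI y z (insert x S) hy.1 (hG x y z hxy hxz) (by simp [hne.symm, hy.2])
        (by simp [Ne.symm hx.1, hz])
      rw [Finset.insert_comm y x S, Finset.insert_comm z x S,
        Finset.insert_comm y x (insert z S)] at h2
      linarith
    · have h1 := hI x z S hx.1 hxz hx.2 hz
      have h2 := hI x z (insert y S) hx.1 hxz (by simp [hne, hx.2]) (by simp [Ne.symm hy.1, hz])
      rw [Finset.insert_comm y z]
      linarith

theorem insert_value (hv : v ∅ = 0)
    (hI : ∀ (i j : V) (C : Finset V), i ≠ j → ¬ G.Adj i j → i ∉ C → j ∉ C →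
      v (insert i C) + v (insert j C) = v (insert i (insert j C)) + v C)
    (hG : ∀ x y z, G.Adj x y → G.Adj x z → ¬ G.Adj y z) [DecidableRel G.Adj] {x : V}
    (S : Finset V) (hx : x ∉ S) :
    v (insert x S) - v S = v {x} + ∑ y ∈ S, if G.Adj x y then synergy v x y else 0 := by
  induction S using Finset.induction_on with
  | empty => simp [hv]
  | insert y S hy ih =>
    rw [Finset.mem_insert, not_or] at hx
    have h1 := ih hx.2
    rw [Finset.sum_insert hy]
    split_ifs with hadj
    · have := second_difference hv hI hG hadj S hx.2 hy
      linarith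
    · have := hI x y S hx.1 hadj hx.2 hy
      linarith

theorem value_eq_sum (hv : v ∅ = 0)
    (hI : ∀ (i j : V) (C : Finset V), i ≠ j → ¬ G.Adj i j → i ∉ C → j ∉ C →
      v (insert i C) + v (insert j C) = v (insert i (insert j C)) + v C)
    (hG : ∀ x y z, G.Adj x y → G.Adj x z → ¬ G.Adj y z) [DecidableRel G.Adj] (S : Finset V) :
    v S = ∑ x ∈ S, v {x} +
      (∑ x ∈ S, ∑ y ∈ S, if G.Adj x y then synergy v x y else 0) / 2 := by
  induction S using Finset.induction_on with
  | empty => simp [hv]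
  | insert x S hx ih =>
    have h1 := insert_value hv hI hG S hx
    have h2 : ∑ y ∈ S, (if G.Adj y x then synergy v y x else 0) =
        ∑ y ∈ S, if G.Adj x y then synergy v x y else 0 :=
      Finset.sum_congr rfl fun y _ => by simp only [G.adj_comm y x, synergy_comm v y x]
    simp only [Finset.sum_insert hx, Finset.sum_add_distrib, h2, G.irrefl, if_false]
    linarith

theorem obj_eq_sum_synergy (hv : v ∅ = 0)
    (hI : ∀ (i j : V) (C : Finset V), i ≠ j → ¬ G.Adj i j → i ∉ C → j ∉ C →
      v (insert i C) + v (insert j C) = v (insert i (insert j C)) + v C)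
    (hG : ∀ x y z, G.Adj x y → G.Adj x z → ¬ G.Adj y z) [DecidableRel G.Adj] (R : Finset V)
    (l : V → ℕ) :
    obj v R l = ∑ x ∈ R, v {x} +
      (∑ x ∈ R, ∑ y ∈ R, if l y = l x then (if G.Adj x y then synergy v x y else 0) else 0) / 2 := by
  rw [obj, Finset.sum_congr rfl fun c _ => value_eq_sum hv hI hG _, Finset.sum_add_distrib,
    ← Finset.sum_div, Finset.sum_fiberwise_of_maps_to fun x hx => Finset.mem_image_of_mem _ hx]
  congr 2
  rw [← Finset.sum_fiberwise_of_maps_to (g := l) (t := R.image l)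
    fun x hx => Finset.mem_image_of_mem _ hx]
  refine Finset.sum_congr rfl fun c _ => Finset.sum_congr rfl fun x hx => ?_
  rw [← (Finset.mem_filter.1 hx).2, Finset.sum_filter]

/-- The edges with positive synergy. -/
def positiveGraph (G : SimpleGraph V) (v : Finset V → ℝ) : SimpleGraph V where
  Adj x y := G.Adj x y ∧ 0 < synergy v x y
  symm := ⟨fun x y h => ⟨h.1.symm, synergy_comm v x y ▸ h.2⟩⟩
  loopless := ⟨fun _ h => G.irrefl h.1⟩

/-- A path in `F` is a path in the forest `G`, where paths are unique; so it is the single edge. -/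
theorem adj_of_reachable {F : SimpleGraph V} (hG : G.IsAcyclic) (hF : F ≤ G) {x y : V}
    (hxy : G.Adj x y) (h : F.Reachable x y) : F.Adj x y := by
  obtain ⟨p, hp⟩ := h.exists_isPath
  have h1 := (hG.subsingleton_path x y).elim ⟨p.mapLe hF, hp.mapLe hF⟩
    (SimpleGraph.Path.singleton hxy)
  have h2 : p.length = 1 := by
    have := congrArg (fun q : G.Path x y => (q : G.Walk x y).length) h1
    simpa [SimpleGraph.Path.singleton] using this
  exact SimpleGraph.Walk.adj_of_length_eq_one h2

/-- In a forest the components of the graph of the edges with positive synergy are optimal. -/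
theorem isOpt_positive (hv : v ∅ = 0)
    (hI : ∀ (i j : V) (C : Finset V), i ≠ j → ¬ G.Adj i j → i ∉ C → j ∉ C →
      v (insert i C) + v (insert j C) = v (insert i (insert j C)) + v C)
    (hG : G.IsAcyclic) (R : Finset V) {label : V → ℕ}
    (hl : ∀ i j, label i = label j ↔ (positiveGraph G v).Reachable i j) : IsOpt v R label := by
  classical
  have hF : positiveGraph G v ≤ G := fun x y h => h.1
  -- In a triangle, deleting `xy` leaves `x` and `y` connected through `z`, so `adj_of_reachable`
  -- would return the deleted edge.
  have htri : ∀ x y z, G.Adj x y → G.Adj x z → ¬ G.Adj y z := by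
    intro x y z hxy hxz hyz
    have : (G.deleteEdges {s(x, y)}).Adj x y := by
      refine adj_of_reachable hG (SimpleGraph.deleteEdges_le _) hxy ?_
      refine (SimpleGraph.Adj.reachable (v := z) ?_).trans (SimpleGraph.Adj.reachable ?_)
      · simp [SimpleGraph.deleteEdges_adj, hxz, hxy.ne, hyz.ne.symm]
      · have := hyz.ne
        simp [SimpleGraph.deleteEdges_adj, hyz.symm, hxz.ne.symm, this.symm]
    simp [SimpleGraph.deleteEdges_adj] at this
  intro l'
  rw [obj_eq_sum_synergy hv hI htri, obj_eq_sum_synergy hv hI htri]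
  -- Pairs can be compared one by one: the components keep the positive synergies and no others,
  -- which is the best possible at every pair.
  gcongr with x hx y hy
  by_cases hxy : G.Adj x y
  · have : label y = label x ↔ 0 < synergy v x y := by
      rw [eq_comm, hl]
      exact ⟨fun h => (adj_of_reachable hG hF hxy h).2, fun h => SimpleGraph.Adj.reachable ⟨hxy, h⟩⟩
    rw [if_pos hxy]
    by_cases hs : 0 < synergy v x y
    · rw [if_pos (this.2 hs)]
      split_ifs
      · exact le_rfl
      · exact hs.le
    · rw [if_neg (mt this.1 hs)]
      split_ifs
      · exact not_lt.1 hs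
      · exact le_rfl
  · simp [hxy]

end Tree

/-! ### Program logic -/

/-- The storage with a new value of an integer variable. -/
def Store.setI (s : Store) (x k : ℕ) : Store := { s with ivar := Function.update s.ivar x k }

/-- Started with `s`, the command halts within `T` steps with a storage satisfying `Q`. -/
def Triple (I : Input) (c : Cmd) (s : Store) (T : ℕ) (Q : Store → Prop) : Prop :=
  ∃ s' t, Exec I c s s' t ∧ t ≤ T ∧ Q s'

/-- The integer variables that a command may write. -/
def Cmd.writesI : Cmd → ℕ → Bool
  | .iset x _, y => x == y
  | .seq c₁ c₂, y => c₁.writesI y || c₂.writesI y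
  | .ite _ c₁ c₂, y => c₁.writesI y || c₂.writesI y
  | .loop _ c, y => c.writesI y
  | _, _ => false

/-- The real variables that a command may write. -/
def Cmd.writesR : Cmd → ℕ → Bool
  | .rset x _, y => x == y
  | .query x _, y => x == y
  | .seq c₁ c₂, y => c₁.writesR y || c₂.writesR y
  | .ite _ c₁ c₂, y => c₁.writesR y || c₂.writesR y
  | .loop _ c, y => c.writesR y
  | _, _ => false

/-- The integer arrays that a command may write. -/
def Cmd.writesIA : Cmd → ℕ → Bool
  | .iput a _ _, y => a == y
  | .seq c₁ c₂, y => c₁.writesIA y || c₂.writesIA y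
  | .ite _ c₁ c₂, y => c₁.writesIA y || c₂.writesIA y
  | .loop _ c, y => c.writesIA y
  | _, _ => false

/-- The real arrays that a command may write. -/
def Cmd.writesRA : Cmd → ℕ → Bool
  | .rput a _ _, y => a == y
  | .seq c₁ c₂, y => c₁.writesRA y || c₂.writesRA y
  | .ite _ c₁ c₂, y => c₁.writesRA y || c₂.writesRA y
  | .loop _ c, y => c.writesRA y
  | _, _ => false

/-- The storages agree on everything that the command does not write. -/
structure Frame (c : Cmd) (s s' : Store) : Prop where
  ivar : ∀ x, c.writesI x = false → s'.ivar x = s.ivar x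
  rvar : ∀ x, c.writesR x = false → s'.rvar x = s.rvar x
  iarr : ∀ a, c.writesIA a = false → s'.iarr a = s.iarr a
  rarr : ∀ a, c.writesRA a = false → s'.rarr a = s.rarr a

theorem Frame.refl (c : Cmd) (s : Store) : Frame c s s :=
  ⟨fun _ _ => rfl, fun _ _ => rfl, fun _ _ => rfl, fun _ _ => rfl⟩

theorem Frame.trans {c : Cmd} {s₁ s₂ s₃ : Store} (h : Frame c s₁ s₂) (h' : Frame c s₂ s₃) :
    Frame c s₁ s₃ :=
  ⟨fun x hx => (h'.ivar x hx).trans (h.ivar x hx), fun x hx => (h'.rvar x hx).trans (h.rvar x hx),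
    fun x hx => (h'.iarr x hx).trans (h.iarr x hx), fun x hx => (h'.rarr x hx).trans (h.rarr x hx)⟩

theorem Frame.mono {c c' : Cmd} {s s' : Store} (h : Frame c s s')
    (hI : ∀ x, c'.writesI x = false → c.writesI x = false)
    (hR : ∀ x, c'.writesR x = false → c.writesR x = false)
    (hIA : ∀ x, c'.writesIA x = false → c.writesIA x = false)
    (hRA : ∀ x, c'.writesRA x = false → c.writesRA x = false) : Frame c' s s' :=
  ⟨fun x hx => h.ivar x (hI x hx), fun x hx => h.rvar x (hR x hx),
    fun x hx => h.iarr x (hIA x hx), fun x hx => h.rarr x (hRA x hx)⟩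

theorem Frame.seq_left {c₁ c₂ : Cmd} {s s' : Store} (h : Frame c₁ s s') :
    Frame (.seq c₁ c₂) s s' :=
  h.mono (fun _ hx => (Bool.or_eq_false_iff.1 hx).1) (fun _ hx => (Bool.or_eq_false_iff.1 hx).1)
    (fun _ hx => (Bool.or_eq_false_iff.1 hx).1) (fun _ hx => (Bool.or_eq_false_iff.1 hx).1)

theorem Frame.seq_right {c₁ c₂ : Cmd} {s s' : Store} (h : Frame c₂ s s') :
    Frame (.seq c₁ c₂) s s' :=
  h.mono (fun _ hx => (Bool.or_eq_false_iff.1 hx).2) (fun _ hx => (Bool.or_eq_false_iff.1 hx).2)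
    (fun _ hx => (Bool.or_eq_false_iff.1 hx).2) (fun _ hx => (Bool.or_eq_false_iff.1 hx).2)

/-- The sets of written locations are computable from the command, so for concrete commands
preservation of a variable or array reduces to `rfl`. -/
theorem Exec.frame {I : Input} {c : Cmd} {s s' : Store} {t : ℕ} (h : Exec I c s s' t) :
    Frame c s s' := by
  induction h with
  | skip s => exact .refl _ _
  | iset s x e =>
    exact ⟨fun y hy => Function.update_of_ne (fun h => by simp [Cmd.writesI, h] at hy) _ _,
      fun _ _ => rfl, fun _ _ => rfl, fun _ _ => rfl⟩
  | rset s x e =>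
    exact ⟨fun _ _ => rfl,
      fun y hy => Function.update_of_ne (fun h => by simp [Cmd.writesR, h] at hy) _ _,
      fun _ _ => rfl, fun _ _ => rfl⟩
  | iput s a e₁ e₂ =>
    exact ⟨fun _ _ => rfl, fun _ _ => rfl,
      fun y hy => Function.update_of_ne (fun h => by simp [Cmd.writesIA, h] at hy) _ _,
      fun _ _ => rfl⟩
  | rput s a e₁ e₂ =>
    exact ⟨fun _ _ => rfl, fun _ _ => rfl, fun _ _ => rfl,
      fun y hy => Function.update_of_ne (fun h => by simp [Cmd.writesRA, h] at hy) _ _⟩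
  | query s x a =>
    exact ⟨fun _ _ => rfl,
      fun y hy => Function.update_of_ne (fun h => by simp [Cmd.writesR, h] at hy) _ _,
      fun _ _ => rfl, fun _ _ => rfl⟩
  | seq _ _ ih₁ ih₂ => exact ih₁.seq_left.trans ih₂.seq_right
  | ite_true _ _ ih =>
    exact ih.mono (fun _ hx => (Bool.or_eq_false_iff.1 hx).1)
      (fun _ hx => (Bool.or_eq_false_iff.1 hx).1) (fun _ hx => (Bool.or_eq_false_iff.1 hx).1)
      (fun _ hx => (Bool.or_eq_false_iff.1 hx).1)
  | ite_false _ _ ih =>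
    exact ih.mono (fun _ hx => (Bool.or_eq_false_iff.1 hx).2)
      (fun _ hx => (Bool.or_eq_false_iff.1 hx).2) (fun _ hx => (Bool.or_eq_false_iff.1 hx).2)
      (fun _ hx => (Bool.or_eq_false_iff.1 hx).2)
  | loop_true _ _ _ ih₁ ih₂ =>
    refine Frame.trans ?_ ih₂
    exact ih₁.mono (fun _ => id) (fun _ => id) (fun _ => id) (fun _ => id)
  | loop_false _ => exact .refl _ _

theorem Triple.mono {I : Input} {c : Cmd} {s : Store} {T T' : ℕ} {Q Q' : Store → Prop}
    (h : Triple I c s T Q) (hT : T ≤ T') (hQ : ∀ s', Frame c s s' → Q s' → Q' s') :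
    Triple I c s T' Q' := by
  obtain ⟨s', t, he, ht, hs⟩ := h
  exact ⟨s', t, he, ht.trans hT, hQ s' he.frame hs⟩

theorem Triple.seq {I : Input} {c₁ c₂ : Cmd} {s : Store} {T₁ T₂ : ℕ} {Q₁ Q : Store → Prop}
    (h₁ : Triple I c₁ s T₁ Q₁) (h₂ : ∀ s₁, Frame c₁ s s₁ → Q₁ s₁ → Triple I c₂ s₁ T₂ Q) :
    Triple I (.seq c₁ c₂) s (T₁ + T₂) Q := by
  obtain ⟨s₁, t₁, he₁, ht₁, hs₁⟩ := h₁
  obtain ⟨s₂, t₂, he₂, ht₂, hs₂⟩ := h₂ s₁ he₁.frame hs₁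
  exact ⟨s₂, _, he₁.seq he₂, add_le_add ht₁ ht₂, hs₂⟩

theorem Triple.ite {I : Input} {b : BExpr} {c₁ c₂ : Cmd} {s : Store} {T : ℕ}
    {Q : Store → Prop} (h₁ : b.Holds I s → Triple I c₁ s T Q)
    (h₂ : ¬ b.Holds I s → Triple I c₂ s T Q) : Triple I (.ite b c₁ c₂) s (b.cost + 1 + T) Q := by
  by_cases hb : b.Holds I s
  · obtain ⟨s', t, he, ht, hs⟩ := h₁ hb
    exact ⟨s', _, .ite_true hb he, by omega, hs⟩
  · obtain ⟨s', t, he, ht, hs⟩ := h₂ hb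
    exact ⟨s', _, .ite_false hb he, by omega, hs⟩

/-- Commands without loops. -/
def Cmd.loopFree : Cmd → Bool
  | .seq c₁ c₂ => c₁.loopFree && c₂.loopFree
  | .ite _ c₁ c₂ => c₁.loopFree && c₂.loopFree
  | .loop _ _ => false
  | _ => true

open Classical in
/-- The effect of a command without loops. -/
noncomputable def Cmd.run (I : Input) : Cmd → Store → Store
  | .skip, s => s
  | .iset x e, s => s.setI x (e.eval I s)
  | .rset x e, s => { s with rvar := Function.update s.rvar x (e.eval I s) }
  | .iput a e₁ e₂, s =>
      { s with
        iarr := Function.update s.iarr a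
                  (Function.update (s.iarr a) (e₁.eval I s) (e₂.eval I s)) }
  | .rput a e₁ e₂, s =>
      { s with
        rarr := Function.update s.rarr a
                  (Function.update (s.rarr a) (e₁.eval I s) (e₂.eval I s)) }
  | .query x a, s => { s with rvar := Function.update s.rvar x (I.value (s.coalition I a)) }
  | .seq c₁ c₂, s => c₂.run I (c₁.run I s)
  | .ite b c₁ c₂, s => if b.Holds I s then c₁.run I s else c₂.run I s
  | .loop _ _, s => s

/-- A bound for the number of steps of a command without loops. -/
def Cmd.maxSteps (n : ℕ) : Cmd → ℕ
  | .skip => 1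
  | .iset _ e => e.cost + 1
  | .rset _ e => e.cost + 1
  | .iput _ e₁ e₂ => e₁.cost + e₂.cost + 1
  | .rput _ e₁ e₂ => e₁.cost + e₂.cost + 1
  | .query _ _ => n + 1
  | .seq c₁ c₂ => c₁.maxSteps n + c₂.maxSteps n
  | .ite b c₁ c₂ => b.cost + 1 + (c₁.maxSteps n + c₂.maxSteps n)
  | .loop _ _ => 0

theorem Triple.run {I : Input} {c : Cmd} (hc : c.loopFree = true) (s : Store) :
    Triple I c s (c.maxSteps I.n) fun s' => s' = c.run I s := by
  induction c generalizing s with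
  | skip => exact ⟨_, _, .skip s, le_rfl, rfl⟩
  | iset x e => exact ⟨_, _, .iset s x e, le_rfl, rfl⟩
  | rset x e => exact ⟨_, _, .rset s x e, le_rfl, rfl⟩
  | iput a e₁ e₂ => exact ⟨_, _, .iput s a e₁ e₂, le_rfl, rfl⟩
  | rput a e₁ e₂ => exact ⟨_, _, .rput s a e₁ e₂, le_rfl, rfl⟩
  | query x a => exact ⟨_, _, .query s x a, le_rfl, rfl⟩
  | seq c₁ c₂ ih₁ ih₂ =>
    have hc' := (Bool.and_eq_true _ _).mp hc
    refine (ih₁ hc'.1 s).seq fun s₁ _ hs₁ => ?_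
    subst hs₁
    exact ih₂ hc'.2 _
  | ite b c₁ c₂ ih₁ ih₂ =>
    have hc' := (Bool.and_eq_true _ _).mp hc
    refine Triple.ite (fun hb => ?_) fun hb => ?_
    · exact (ih₁ hc'.1 s).mono (Nat.le_add_right _ _) fun s' _ hs' => by
        rw [hs', Cmd.run, if_pos hb]
    · exact (ih₂ hc'.2 s).mono (Nat.le_add_left _ _) fun s' _ hs' => by
        rw [hs', Cmd.run, if_neg hb]
  | loop b c => simp [Cmd.loopFree] at hc

/-- `for x from 0 to e - 1 do c`. -/
def Cmd.forTo (x : ℕ) (e : IExpr) (c : Cmd) : Cmd :=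
  .seq (.iset x (.const 0))
    (.loop (.ilt (.var x) e) (.seq c (.iset x (.plus (.var x) (.const 1)))))

/-- Each round costs the body, `e.cost + 3` steps for the test and `4` for the increment. The extra
summand in `m + 1` pays for the initialisation and the failing test. Letting `T` depend on the
counter allows an amortised bound. -/
theorem Triple.forTo {I : Input} {x : ℕ} {e : IExpr} {c : Cmd} {s : Store} {m : ℕ} {T : ℕ → ℕ}
    {Inv : ℕ → Store → Prop}
    (he : ∀ s', Frame (.forTo x e c) s s' → e.eval I s' = m)
    (hx : c.writesI x = false)
    (h0 : Inv 0 (s.setI x 0))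
    (hstep : ∀ k s', k < m → Frame (.forTo x e c) s s' → s'.ivar x = k → Inv k s' →
      Triple I c s' (T k) fun s'' => Inv (k + 1) (s''.setI x (k + 1))) :
    Triple I (.forTo x e c) s (∑ k ∈ Finset.range m, T k + (m + 1) * (e.cost + 7))
      fun s' => Inv m s' ∧ s'.ivar x = m := by
  have hloop : ∀ d k s', k + d = m → Frame (.forTo x e c) s s' → s'.ivar x = k → Inv k s' →
      Triple I (.loop (.ilt (.var x) e) (.seq c (.iset x (.plus (.var x) (.const 1))))) s'
        (∑ i ∈ Finset.Ico k m, T i + d * (e.cost + 7) + (e.cost + 3))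
        fun s' => Inv m s' ∧ s'.ivar x = m := by
    intro d
    induction d with
    | zero =>
      intro k s' hk hf hxk hinv
      obtain rfl : k = m := by omega
      refine ⟨s', _, .loop_false ?_, ?_, hinv, hxk⟩
      · simp [BExpr.Holds, IExpr.eval, he s' hf, hxk]
      · simp [BExpr.cost, IExpr.cost]
        omega
    | succ d ih =>
      intro k s' hk hf hxk hinv
      obtain ⟨s₁, t₁, he₁, ht₁, hs₁⟩ := hstep k s' (by omega) hf hxk hinv
      have hx₁ : s₁.ivar x = k := by rw [he₁.frame.ivar x hx, hxk]
      have he₂ := Exec.iset (I := I) s₁ x (.plus (.var x) (.const 1))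
      have h₂ : IExpr.eval I s₁ (.plus (.var x) (.const 1)) = k + 1 := by
        simp [IExpr.eval, hx₁]
      rw [h₂] at he₂
      have hf₂ : Frame (.forTo x e c) s (s₁.setI x (k + 1)) :=
        hf.trans (Frame.seq_right
          ((he₁.seq he₂).frame.mono (fun _ => id) (fun _ => id) (fun _ => id) (fun _ => id)))
      obtain ⟨s₃, t₃, he₃, ht₃, hs₃⟩ := ih (k + 1) (s₁.setI x (k + 1)) (by omega) hf₂
        (by simp [Store.setI]) hs₁
      refine ⟨s₃, _, .loop_true ?_ (he₁.seq he₂) he₃, ?_, hs₃⟩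
      · simp [BExpr.Holds, IExpr.eval, he s' hf, hxk]
        omega
      · rw [Finset.sum_eq_sum_Ico_succ_bot (by omega : k < m)]
        simp only [BExpr.cost, IExpr.cost, add_mul]
        omega
  have he₀ := Exec.iset (I := I) s x (.const 0)
  obtain ⟨s', t, he', ht, hs'⟩ := hloop m 0 (s.setI x 0) (by omega) (Frame.seq_left he₀.frame)
    (by simp [Store.setI]) h0
  refine ⟨s', _, he₀.seq he', ?_, hs'⟩
  simp only [Finset.range_eq_Ico, IExpr.cost, add_mul]
  omega

theorem Triple.forTo_const {I : Input} {x : ℕ} {e : IExpr} {c : Cmd} {s : Store} {m T : ℕ}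
    {Inv : ℕ → Store → Prop}
    (he : ∀ s', Frame (.forTo x e c) s s' → e.eval I s' = m)
    (hx : c.writesI x = false)
    (h0 : Inv 0 (s.setI x 0))
    (hstep : ∀ k s', k < m → Frame (.forTo x e c) s s' → s'.ivar x = k → Inv k s' →
      Triple I c s' T fun s'' => Inv (k + 1) (s''.setI x (k + 1))) :
    Triple I (.forTo x e c) s ((m + 1) * (T + e.cost + 7))
      fun s' => Inv m s' ∧ s'.ivar x = m := by
  refine (Triple.forTo (T := fun _ => T) he hx h0 hstep).mono ?_ fun _ _ h => h
  rw [Finset.sum_const, Finset.card_range, smul_eq_mul]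
  nlinarith

/-! ### Evaluating the value function of the reduced problem

Storage of the elimination program: integer variables `0` (number of eliminated vertices),
`1`, …, `6` (search for a vertex), `7`, …, `10` (the vertex to be eliminated and three further
vertices that include its neighbours), `11`, `12` (auxiliary), `13`, …, `17` (merging);
integer arrays `0` (output), `1` (eliminated vertices), `2`, `3` (additional edges and row offsets),
`4`, …, `12` (records), `13` (characteristic vector), `14` (labels); real arrays `0`, …, `3`
(records). -/

/-- The `k`-th record in the storage. -/
noncomputable def Store.record (s : Store) (k : ℕ) : Record :=
  ⟨s.iarr 4 k, s.iarr 5 k, s.iarr 6 k, s.iarr 7 k, s.rarr 0 k, s.rarr 1 k, s.rarr 2 k, s.rarr 3 k,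
    s.iarr 8 k, s.iarr 9 k, s.iarr 10 k, s.iarr 11 k, s.iarr 12 k⟩

/-- The value function after `m` eliminations. -/
noncomputable def Store.val (I : Input) (s : Store) (m : ℕ) (S : Finset ℕ) : ℝ :=
  I.natValue S + ∑ k ∈ Finset.range m, (s.record k).term S

/-- The command does not write the records. -/
def Cmd.keepsRecords (c : Cmd) : Bool :=
  ((List.range 9).all fun a => !c.writesIA (a + 4)) && (List.range 4).all fun a => !c.writesRA a

theorem Frame.record_eq {c : Cmd} {s s' : Store} (h : Frame c s s')
    (hc : c.keepsRecords = true) : s'.record = s.record := by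
  simp only [Cmd.keepsRecords, Bool.and_eq_true, List.all_eq_true, List.mem_range,
    Bool.not_eq_true'] at hc
  have hi : ∀ a < 9, s'.iarr (a + 4) = s.iarr (a + 4) := fun a ha => h.iarr _ (hc.1 a ha)
  have hr : ∀ a < 4, s'.rarr a = s.rarr a := fun a ha => h.rarr _ (hc.2 a ha)
  funext k
  simp only [Store.record, hi 0 (by omega), hi 1 (by omega), hi 2 (by omega), hi 3 (by omega),
    hi 4 (by omega), hi 5 (by omega), hi 6 (by omega), hi 7 (by omega), hi 8 (by omega),
    hr 0 (by omega), hr 1 (by omega), hr 2 (by omega), hr 3 (by omega)]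

theorem Frame.val_eq {c : Cmd} {s s' : Store} (h : Frame c s s')
    (hc : c.keepsRecords = true) (I : Input) : s'.val I = s.val I := by
  funext m S
  simp only [Store.val, h.record_eq hc]

theorem Store.coalition_eq {I : Input} {s : Store} {a : ℕ} {S : Finset ℕ}
    (hX : ∀ x, s.iarr a x ≠ 0 ↔ x ∈ S) : s.coalition I a = I.nodes S := by
  ext i
  simp [Store.coalition, Input.nodes, hX]

/-- The vertex stored in the integer array `a` of the current record is in the coalition. -/
def inCoalition (a : ℕ) : BExpr := .not (.ieq (.get 13 (.get a (.var 11))) (.const 0))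

/-- Increase the result by a weight of the current record. -/
def increase (a : ℕ) : Cmd := .rset 0 (.plus (.var 0) (.get a (.var 11)))

/-- Add the contribution of a record. -/
def evalStep : Cmd :=
  .seq (.ite (.and (inCoalition 5) (inCoalition 6)) (increase 0) .skip)
    (.seq (.ite (.and (inCoalition 5) (inCoalition 7)) (increase 1) .skip)
      (.seq (.ite (.and (inCoalition 6) (inCoalition 7)) (increase 2) .skip)
        (.ite (.and (inCoalition 5) (.and (inCoalition 6) (inCoalition 7))) (increase 3) .skip)))

/-- Evaluate the value function of the reduced problem at the coalition in array `13`. -/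
def evalCmd : Cmd := .seq (.query 0 13) (.forTo 11 (.var 0) evalStep)

open Classical in
theorem run_ite_increase (I : Input) (b : BExpr) (a : ℕ) (s : Store) :
    (Cmd.ite b (increase a) .skip).run I s =
      ⟨s.ivar, Function.update s.rvar 0
          (s.rvar 0 + if b.Holds I s then s.rarr a (s.ivar 11) else 0), s.iarr, s.rarr⟩ := by
  by_cases hb : b.Holds I s <;> simp [Cmd.run, hb, increase, RExpr.eval, IExpr.eval]

theorem evalStep_spec {I : Input} {s : Store} {S : Finset ℕ} {k : ℕ}
    (hX : ∀ x, s.iarr 13 x ≠ 0 ↔ x ∈ S) (hk : s.ivar 11 = k) :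
    Triple I evalStep s 87 fun s' => s'.rvar 0 = s.rvar 0 + (s.record k).term S := by
  refine (Triple.run (c := evalStep) rfl s).mono (by
    simp [evalStep, Cmd.maxSteps, inCoalition, increase, BExpr.cost, IExpr.cost, RExpr.cost])
    fun s' _ hs' => ?_
  subst hs'
  -- Only sequential composition is unfolded, so that `run_ite_increase` treats each conditional as
  -- a whole and no case split is needed.
  simp only [evalStep, Cmd.run.eq_7, run_ite_increase]
  simp [BExpr.Holds, inCoalition, IExpr.eval, hX, hk, Record.term, Store.record, add_assoc]
  congr

theorem evalCmd_spec {I : Input} {s : Store} {S : Finset ℕ} {m : ℕ}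
    (hX : ∀ x, s.iarr 13 x ≠ 0 ↔ x ∈ S) (hm : s.ivar 0 = m) (hmn : m ≤ I.n) :
    Triple I evalCmd s (100 * (I.n + 1)) fun s' => s'.rvar 0 = s.val I m S := by
  refine Triple.mono (T := I.n + 1 + (m + 1) * (87 + 1 + 7))
    ((Triple.run (c := .query 0 13) rfl s).seq
    (Q := fun s' => s'.rvar 0 = s.val I m S) fun s₁ hf₁ hs₁ => ?_) (by omega) fun _ _ h => h
  have hX₁ : ∀ x, s₁.iarr 13 x ≠ 0 ↔ x ∈ S := by rwa [hf₁.iarr 13 rfl]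
  refine (Triple.forTo_const (m := m) (T := 87)
    (Inv := fun k s' => s'.rvar 0 = I.natValue S + ∑ k ∈ Finset.range k, (s.record k).term S)
    ?_ rfl ?_ ?_).mono le_rfl fun s' _ h => h.1
  · intro s' hf
    rw [IExpr.eval, hf.ivar 0 rfl, hf₁.ivar 0 rfl, hm]
  · simp [hs₁, Cmd.run, Store.setI, Store.coalition_eq hX, Input.natValue]
  · intro k s' hk hf hxk hinv
    refine (evalStep_spec (S := S) (by rwa [hf.iarr 13 rfl]) hxk).mono le_rfl fun s'' _ h => ?_
    change s''.rvar 0 = _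
    rw [h, hinv, Finset.sum_range_succ, hf.record_eq rfl, hf₁.record_eq rfl, add_assoc]

/-- Write `k` into the entries of the characteristic vector with indices in the variables `es`. -/
def markCmd (k : ℕ) (es : List ℕ) : Cmd :=
  es.foldr (fun e c => .seq (.iput 13 (.var e) (.const k)) c) .skip

theorem markCmd_spec {I : Input} (k : ℕ) (es : List ℕ) (s : Store) :
    Triple I (markCmd k es) s (3 * es.length + 1) fun s' =>
      s'.iarr 13 = (fun x => if x ∈ es.map s.ivar then k else s.iarr 13 x) ∧
      s'.ivar = s.ivar ∧ s'.rvar = s.rvar ∧ s'.rarr = s.rarr ∧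
      ∀ a, a ≠ 13 → s'.iarr a = s.iarr a := by
  induction es generalizing s with
  | nil => exact ⟨_, _, .skip s, by simp, by simp⟩
  | cons e es ih =>
    refine Triple.mono (T := 3 + (3 * es.length + 1))
      (Triple.seq (c₁ := .iput 13 (.var e) (.const k))
      (c₂ := markCmd k es)
      (Triple.run rfl s) fun s₁ _ hs₁ => ?_) (by simp; omega) fun _ _ h => h
    refine (ih s₁).mono le_rfl fun s' _ h => ?_
    subst hs₁
    obtain ⟨h1, h2, h3, h4, h5⟩ := h
    refine ⟨?_, h2, h3, h4, fun a ha => ?_⟩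
    · rw [h1]
      funext x
      by_cases h : x ∈ es.map s.ivar <;> by_cases h' : x = s.ivar e <;>
        simp [Cmd.run, IExpr.eval, h, h', -List.mem_map]
    · rw [h5 a ha]
      simp [Cmd.run, Function.update_of_ne ha]

/-- Evaluate the value function of the reduced problem at the coalition of the vertices in the
variables `es`. -/
def valCmd (es : List ℕ) : Cmd := .seq (markCmd 1 es) (.seq evalCmd (markCmd 0 es))

/-- Unmarking the same vertices makes array `13` zero again, as the next evaluation requires.
Variable `11` is excluded because it is the loop counter of the evaluation; length four accommodates
a vertex with its three neighbours. -/
theorem valCmd_spec {I : Input} {s : Store} {m : ℕ} {es : List ℕ} (hX : ∀ x, s.iarr 13 x = 0)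
    (hes : es.length ≤ 4) (h11 : 11 ∉ es) (hm : s.ivar 0 = m) (hmn : m ≤ I.n) :
    Triple I (valCmd es) s (130 * (I.n + 1)) fun s' => s'.iarr = s.iarr ∧ s'.rarr = s.rarr ∧
      (∀ x, x ≠ 11 → s'.ivar x = s.ivar x) ∧ (∀ x, x ≠ 0 → s'.rvar x = s.rvar x) ∧
      s'.rvar 0 = s.val I m (es.map s.ivar).toFinset := by
  refine Triple.mono (T := (3 * es.length + 1) + (100 * (I.n + 1) + (3 * es.length + 1))) ?_
    (by omega) fun _ _ h => h
  refine (markCmd_spec 1 es s).seq fun s₁ _ ⟨hX₁, hi₁, hr₁, ha₁, hb₁⟩ => ?_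
  have hY₁ : ∀ x, s₁.iarr 13 x ≠ 0 ↔ x ∈ (es.map s.ivar).toFinset := by
    intro x
    by_cases h : x ∈ es.map s.ivar <;> simp [hX₁, h, hX, -List.mem_map]
  refine (evalCmd_spec hY₁ (by rw [hi₁, hm]) hmn).seq fun s₂ f₂ h₂ => ?_
  refine (markCmd_spec 0 es s₂).mono le_rfl fun s₃ _ ⟨hX₃, hi₃, hr₃, ha₃, hb₃⟩ => ?_
  have hw : ∀ x, x ≠ 11 → s₂.ivar x = s₁.ivar x := fun x hx => f₂.ivar x (by
    simp [evalCmd, Cmd.writesI, Cmd.forTo, evalStep, increase, Ne.symm hx])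
  have hwr : ∀ x, x ≠ 0 → s₂.rvar x = s₁.rvar x := fun x hx => f₂.rvar x (by
    simp [evalCmd, Cmd.writesR, Cmd.forTo, evalStep, increase, Ne.symm hx])
  have hwa : ∀ a, s₂.iarr a = s₁.iarr a := fun a => f₂.iarr a (by
    simp [evalCmd, Cmd.writesIA, Cmd.forTo, evalStep, increase])
  refine ⟨?_, ?_, ?_, ?_, ?_⟩
  · funext a
    by_cases h13 : a = 13
    · subst h13
      rw [hX₃]
      funext x
      have hes₂ : es.map s₂.ivar = es.map s.ivar := List.map_congr_left fun x hx => by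
        rw [hw x fun h => h11 (h ▸ hx), hi₁]
      by_cases h : x ∈ es.map s.ivar <;> simp [hes₂, h, hX, hwa, hX₁, -List.mem_map]
    · rw [hb₃ a h13, hwa, hb₁ a h13]
  · rw [ha₃, ← ha₁]
    funext a
    exact f₂.rarr a (by simp [evalCmd, Cmd.writesRA, Cmd.forTo, evalStep, increase])
  · intro x hx
    rw [hi₃, hw x hx, hi₁]
  · intro x hx
    rw [hr₃, hwr x hx, hr₁]
  · rw [hr₃, h₂, Store.val, Store.val, (show s₁.record = s.record from ?_)]
    funext k
    simp [Store.record, ha₁, hb₁]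

/-- Compute, into the real variable `r`, the gain of adding the vertex in variable `7` to the
coalition of the vertices in the variables `es`. -/
def gainCmd (r : ℕ) (es : List ℕ) : Cmd :=
  .seq (valCmd es) (.seq (.rset r (.minus .zero (.var 0)))
    (.seq (valCmd (7 :: es)) (.seq (.rset r (.plus (.var r) (.var 0)))
      (.seq (valCmd [7]) (.rset r (.minus (.var r) (.var 0)))))))

theorem gainCmd_spec {I : Input} {s : Store} {m r : ℕ} {es : List ℕ} (hr : r ≠ 0)
    (hes : es.length ≤ 3) (hX : ∀ x, s.iarr 13 x = 0) (hm : s.ivar 0 = m) (hmn : m ≤ I.n)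
    (h11 : 11 ∉ es) :
    Triple I (gainCmd r es) s (402 * (I.n + 1)) fun s' => s'.iarr = s.iarr ∧ s'.rarr = s.rarr ∧
      (∀ x, x ≠ 11 → s'.ivar x = s.ivar x) ∧ (∀ x, x ≠ 0 → x ≠ r → s'.rvar x = s.rvar x) ∧
      s'.rvar r = gain (s.val I m) (s.ivar 7) (es.map s.ivar).toFinset := by
  have hset : ∀ (e : RExpr) (s : Store), Triple I (.rset r e) s (e.cost + 1) fun s' =>
      s' = { s with rvar := Function.update s.rvar r (e.eval I s) } := fun e s =>
    Triple.run (c := .rset r e) rfl s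
  have hval : ∀ {s' : Store}, s'.iarr = s.iarr → s'.rarr = s.rarr → s'.val I m = s.val I m := by
    intro s' h1 h2
    funext S
    simp [Store.val, Store.record, h1, h2]
  refine Triple.mono (T := 130 * (I.n + 1) + (4 + (130 * (I.n + 1) + (4 + (130 * (I.n + 1) + 4)))))
    ?_ (by omega) fun _ _ h => h
  refine (valCmd_spec hX (by omega) h11 hm hmn).seq fun s₁ _ ⟨ha₁, hra₁, hi₁, hr₁, hv₁⟩ => ?_
  refine (hset _ s₁).seq fun s₂ _ h₂ => ?_
  subst h₂
  refine (valCmd_spec (m := m) (by simpa [ha₁] using hX) (by simp; omega)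
    (by simpa using h11)
    (by simp [hi₁, hm]) hmn).seq fun s₃ _ ⟨ha₃, hra₃, hi₃, hr₃, hv₃⟩ => ?_
  simp only at ha₃ hra₃ hi₃ hr₃
  rw [show Store.val I _ m = s.val I m from hval (by exact ha₁) (by exact hra₁)] at hv₃
  refine (hset _ s₃).seq fun s₄ _ h₄ => ?_
  subst h₄
  refine (valCmd_spec (m := m) (by simpa [ha₁, ha₃] using hX) (by simp) (by simp)
    (by simp [hi₁, hi₃, hm]) hmn).seq fun s₅ _ ⟨ha₅, hra₅, hi₅, hr₅, hv₅⟩ => ?_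
  simp only at ha₅ hra₅ hi₅ hr₅
  rw [show Store.val I _ m = s.val I m from
    hval (by exact ha₃.trans ha₁) (by exact hra₃.trans hra₁)] at hv₅
  refine (hset _ s₅).mono le_rfl fun s' _ h₆ => ?_
  subst h₆
  have hes₁ : es.map s₁.ivar = es.map s.ivar := List.map_congr_left fun x hx =>
    hi₁ x fun h => h11 (h ▸ hx)
  refine ⟨ha₅.trans (ha₃.trans ha₁), hra₅.trans (hra₃.trans hra₁), fun x hx => ?_,
    fun x hx hxr => ?_, ?_⟩
  · simp [hi₅ x hx, hi₃ x hx, hi₁ x hx]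
  · simp [Function.update_of_ne hxr, hr₅ x hx, hr₃ x hx, hr₁ x hx]
  · simp [RExpr.eval, hr₅ r hr, hr₃ r hr, hv₁, hv₃, hv₅, hi₃, hi₁, hes₁, gain]
    ring

/-- Compute the largest of zero and the real variables in the list `q` into the real variable `g`,
and record the corresponding vertex in the array `a`. -/
def bestCmd (g a : ℕ) (q : List (ℕ × ℕ)) : Cmd :=
  .seq (.rset g .zero) (.seq (.iput a (.var 0) (.var 7))
    (q.foldr (fun p c => .seq (.ite (.rlt (.var g) (.var p.1))
      (.seq (.rset g (.var p.1)) (.iput a (.var 0) (.var p.2))) .skip) c) .skip))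

theorem bestCmd_spec {I : Input} {s : Store} {g a : ℕ} {q : List (ℕ × ℕ)}
    (hq : ∀ p ∈ q, p.1 ≠ g) :
    Triple I (bestCmd g a q) s (12 * q.length + 6) fun s' => s'.ivar = s.ivar ∧ s'.rarr = s.rarr ∧
      s'.rvar = Function.update s.rvar g
        (best (s.ivar 7) (q.map fun p => (s.rvar p.1, s.ivar p.2))).1 ∧
      s'.iarr = Function.update s.iarr a (Function.update (s.iarr a) (s.ivar 0)
        (best (s.ivar 7) (q.map fun p => (s.rvar p.1, s.ivar p.2))).2) := by
  have key : ∀ (q : List (ℕ × ℕ)) (p₀ : ℝ × ℕ), (∀ p ∈ q, p.1 ≠ g) →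
      Triple I (q.foldr (fun p c => .seq (.ite (.rlt (.var g) (.var p.1))
          (.seq (.rset g (.var p.1)) (.iput a (.var 0) (.var p.2))) .skip) c) .skip)
        { s with
          rvar := Function.update s.rvar g p₀.1
          iarr := Function.update s.iarr a (Function.update (s.iarr a) (s.ivar 0) p₀.2) }
        (12 * q.length + 1) fun s' =>
        s' = { s with
          rvar := Function.update s.rvar g ((q.map fun p => (s.rvar p.1, s.ivar p.2)).foldl
            (fun p q => if p.1 < q.1 then q else p) p₀).1
          iarr := Function.update s.iarr a (Function.update (s.iarr a) (s.ivar 0)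
            ((q.map fun p => (s.rvar p.1, s.ivar p.2)).foldl
              (fun p q => if p.1 < q.1 then q else p) p₀).2) } := by
    intro q
    induction q with
    | nil => exact fun p₀ _ => ⟨_, _, .skip _, by simp, rfl⟩
    | cons p q ih =>
      intro p₀ hq
      have hp := hq p List.mem_cons_self
      refine Triple.mono (T := 12 + (12 * q.length + 1)) ?_ (by simp; omega) fun _ _ h => h
      refine ((Triple.run (c := .ite (.rlt (.var g) (.var p.1))
        (.seq (.rset g (.var p.1)) (.iput a (.var 0) (.var p.2))) .skip) rfl _).mono
        (by simp [Cmd.maxSteps, BExpr.cost, IExpr.cost, RExpr.cost]) fun _ _ h => h).seq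
        fun s₁ _ h₁ => ?_
      have h₂ : s₁ = { s with
          rvar := Function.update s.rvar g
            (if p₀.1 < s.rvar p.1 then (s.rvar p.1, s.ivar p.2) else p₀).1
          iarr := Function.update s.iarr a (Function.update (s.iarr a) (s.ivar 0)
            (if p₀.1 < s.rvar p.1 then (s.rvar p.1, s.ivar p.2) else p₀).2) } := by
        rw [h₁]
        by_cases h : p₀.1 < s.rvar p.1 <;>
          simp [Cmd.run, BExpr.Holds, RExpr.eval, IExpr.eval, hp, h]
      rw [h₂]
      exact ih _ fun p' hp' => hq p' (List.mem_cons_of_mem _ hp')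
  refine Triple.mono (T := 2 + (3 + (12 * q.length + 1))) ?_ (by omega) fun _ _ h => h
  refine (Triple.run (c := .rset g .zero) rfl s).seq fun s₁ _ h₁ => ?_
  refine (Triple.run (c := .iput a (.var 0) (.var 7)) rfl s₁).seq fun s₂ _ h₂ => ?_
  subst h₁ h₂
  refine (key q (0, s.ivar 7) hq).mono le_rfl fun s' _ h => ?_
  rw [h]
  exact ⟨rfl, rfl, rfl, rfl⟩

/-! ### Eliminating the chosen vertex -/

/-- Compute the gains of the seven coalitions. -/
def gainsCmd : Cmd :=
  .seq (gainCmd 2 [8]) (.seq (gainCmd 3 [9]) (.seq (gainCmd 4 [10]) (.seq (gainCmd 5 [8, 9])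
    (.seq (gainCmd 6 [8, 10]) (.seq (gainCmd 7 [9, 10]) (gainCmd 8 [8, 9, 10]))))))

/-- Compute the largest gains for the five partitions and record the choices. -/
def bestsCmd : Cmd :=
  .seq (bestCmd 9 8 [(2, 8), (3, 9), (4, 10)]) (.seq (bestCmd 10 9 [(5, 8), (4, 10)])
    (.seq (bestCmd 11 10 [(6, 8), (3, 9)]) (.seq (bestCmd 12 11 [(7, 9), (2, 8)])
      (bestCmd 13 12 [(8, 8)]))))

/-- Record the vertices and the weights, mark the vertex as eliminated and join its first two
neighbours. -/
def recordCmd : Cmd :=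
  .seq (.iput 4 (.var 0) (.var 7)) (.seq (.iput 5 (.var 0) (.var 8))
    (.seq (.iput 6 (.var 0) (.var 9)) (.seq (.iput 7 (.var 0) (.var 10))
      (.seq (.rput 0 (.var 0) (.minus (.var 10) (.var 9)))
        (.seq (.rput 1 (.var 0) (.minus (.var 11) (.var 9)))
          (.seq (.rput 2 (.var 0) (.minus (.var 12) (.var 9)))
            (.seq (.rput 3 (.var 0) (.plus (.plus (.minus (.minus (.minus (.var 13) (.var 10))
                (.var 11)) (.var 12)) (.var 9)) (.var 9)))
              (.seq (.iput 1 (.var 7) (.const 1))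
                (.seq (.iput 2 (.plus (.get 3 (.var 8)) (.var 9)) (.const 1))
                  (.iput 2 (.plus (.get 3 (.var 9)) (.var 8)) (.const 1)))))))))))

/-- Eliminate the chosen vertex. -/
def elimCmd : Cmd := .seq gainsCmd (.seq bestsCmd recordCmd)

theorem gainsCmd_spec {I : Input} {s : Store} {m : ℕ} (hX : ∀ x, s.iarr 13 x = 0)
    (hm : s.ivar 0 = m) (hmn : m ≤ I.n) :
    Triple I gainsCmd s (2814 * (I.n + 1)) fun s' => s'.iarr = s.iarr ∧ s'.rarr = s.rarr ∧
      (∀ x, x ≠ 11 → s'.ivar x = s.ivar x) ∧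
      s'.rvar 2 = gain (s.val I m) (s.ivar 7) {s.ivar 8} ∧
      s'.rvar 3 = gain (s.val I m) (s.ivar 7) {s.ivar 9} ∧
      s'.rvar 4 = gain (s.val I m) (s.ivar 7) {s.ivar 10} ∧
      s'.rvar 5 = gain (s.val I m) (s.ivar 7) {s.ivar 8, s.ivar 9} ∧
      s'.rvar 6 = gain (s.val I m) (s.ivar 7) {s.ivar 8, s.ivar 10} ∧
      s'.rvar 7 = gain (s.val I m) (s.ivar 7) {s.ivar 9, s.ivar 10} ∧
      s'.rvar 8 = gain (s.val I m) (s.ivar 7) {s.ivar 8, s.ivar 9, s.ivar 10} := by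
  have step : ∀ (r : ℕ) (es : List ℕ) (s₁ : Store), r ≠ 0 → es.length ≤ 3 → 11 ∉ es →
      s₁.iarr = s.iarr → s₁.rarr = s.rarr → (∀ x, x ≠ 11 → s₁.ivar x = s.ivar x) →
      Triple I (gainCmd r es) s₁ (402 * (I.n + 1)) fun s' => s'.iarr = s.iarr ∧ s'.rarr = s.rarr ∧
        (∀ x, x ≠ 11 → s'.ivar x = s.ivar x) ∧ (∀ x, x ≠ 0 → x ≠ r → s'.rvar x = s₁.rvar x) ∧
        s'.rvar r = gain (s.val I m) (s.ivar 7) (es.map s.ivar).toFinset := by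
    intro r es s₁ hr hes h11 ha hra hi
    refine (gainCmd_spec (m := m) hr hes (by simpa [ha] using hX) (by rw [hi 0 (by simp), hm]) hmn
      h11).mono le_rfl fun s' _ ⟨h1, h2, h3, h4, h5⟩ => ?_
    refine ⟨h1.trans ha, h2.trans hra, fun x hx => (h3 x hx).trans (hi x hx), h4, ?_⟩
    have hval : s₁.val I m = s.val I m := by
      funext S
      simp [Store.val, Store.record, ha, hra]
    rw [h5, hval, hi 7 (by simp),
      List.map_congr_left fun x hx => hi x fun h => h11 (h ▸ hx)]
  refine Triple.mono (T := 402 * (I.n + 1) + (402 * (I.n + 1) + (402 * (I.n + 1) +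
    (402 * (I.n + 1) + (402 * (I.n + 1) + (402 * (I.n + 1) + 402 * (I.n + 1))))))) ?_ (by omega)
    fun _ _ h => h
  refine (step 2 [8] s (by simp) (by simp) (by simp) rfl rfl fun _ _ => rfl).seq
    fun s₁ _ ⟨a₁, b₁, c₁, d₁, e₁⟩ => ?_
  refine (step 3 [9] s₁ (by simp) (by simp) (by simp) a₁ b₁ c₁).seq
    fun s₂ _ ⟨a₂, b₂, c₂, d₂, e₂⟩ => ?_
  refine (step 4 [10] s₂ (by simp) (by simp) (by simp) a₂ b₂ c₂).seq
    fun s₃ _ ⟨a₃, b₃, c₃, d₃, e₃⟩ => ?_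
  refine (step 5 [8, 9] s₃ (by simp) (by simp) (by simp) a₃ b₃ c₃).seq
    fun s₄ _ ⟨a₄, b₄, c₄, d₄, e₄⟩ => ?_
  refine (step 6 [8, 10] s₄ (by simp) (by simp) (by simp) a₄ b₄ c₄).seq
    fun s₅ _ ⟨a₅, b₅, c₅, d₅, e₅⟩ => ?_
  refine (step 7 [9, 10] s₅ (by simp) (by simp) (by simp) a₅ b₅ c₅).seq
    fun s₆ _ ⟨a₆, b₆, c₆, d₆, e₆⟩ => ?_
  refine (step 8 [8, 9, 10] s₆ (by simp) (by simp) (by simp) a₆ b₆ c₆).mono le_rfl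
    fun s₇ _ ⟨a₇, b₇, c₇, d₇, e₇⟩ => ?_
  refine ⟨a₇, b₇, c₇, ?_⟩
  simp_all

theorem update_update_apply {β : Type*} (f : ℕ → ℕ → β) (a j : ℕ) (z : β) {k : ℕ} (hk : k ≠ j)
    (a' : ℕ) : Function.update f a (Function.update (f a) j z) a' k = f a' k := by
  by_cases h : a' = a
  · subst h
    simp [hk]
  · simp [h]

/-- Quantifying over `d` separates the selection of maxima from the meaning of the gains. Arrays are
written only at the current index, so earlier records survive. -/
theorem bestsCmd_spec {I : Input} {s : Store} :
    Triple I bestsCmd s 150 fun s' => s'.ivar = s.ivar ∧ s'.rarr = s.rarr ∧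
      (∀ a, a < 8 ∨ 12 < a → s'.iarr a = s.iarr a) ∧
      (∀ k, k ≠ s.ivar 0 → ∀ a, s'.iarr a k = s.iarr a k) ∧
      ∀ d : Finset ℕ → ℝ,
      s.rvar 2 = d {s.ivar 8} → s.rvar 3 = d {s.ivar 9} → s.rvar 4 = d {s.ivar 10} →
      s.rvar 5 = d {s.ivar 8, s.ivar 9} → s.rvar 6 = d {s.ivar 8, s.ivar 10} →
      s.rvar 7 = d {s.ivar 9, s.ivar 10} → s.rvar 8 = d {s.ivar 8, s.ivar 9, s.ivar 10} →
      (s'.rvar 9, s'.iarr 8 (s.ivar 0)) = best (s.ivar 7)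
        [(d {s.ivar 8}, s.ivar 8), (d {s.ivar 9}, s.ivar 9), (d {s.ivar 10}, s.ivar 10)] ∧
      (s'.rvar 10, s'.iarr 9 (s.ivar 0)) = best (s.ivar 7)
        [(d {s.ivar 8, s.ivar 9}, s.ivar 8), (d {s.ivar 10}, s.ivar 10)] ∧
      (s'.rvar 11, s'.iarr 10 (s.ivar 0)) = best (s.ivar 7)
        [(d {s.ivar 8, s.ivar 10}, s.ivar 8), (d {s.ivar 9}, s.ivar 9)] ∧
      (s'.rvar 12, s'.iarr 11 (s.ivar 0)) = best (s.ivar 7)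
        [(d {s.ivar 9, s.ivar 10}, s.ivar 9), (d {s.ivar 8}, s.ivar 8)] ∧
      (s'.rvar 13, s'.iarr 12 (s.ivar 0)) = best (s.ivar 7)
        [(d {s.ivar 8, s.ivar 9, s.ivar 10}, s.ivar 8)] := by
  refine Triple.mono (T := (12 * 3 + 6) + ((12 * 2 + 6) + ((12 * 2 + 6) + ((12 * 2 + 6) +
    (12 * 1 + 6))))) ?_ (by omega) fun _ _ h => h
  refine (bestCmd_spec (by simp)).seq fun s₁ _ ⟨a₁, b₁, c₁, d₁⟩ => ?_
  refine (bestCmd_spec (by simp)).seq fun s₂ _ ⟨a₂, b₂, c₂, d₂⟩ => ?_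
  refine (bestCmd_spec (by simp)).seq fun s₃ _ ⟨a₃, b₃, c₃, d₃⟩ => ?_
  refine (bestCmd_spec (by simp)).seq fun s₄ _ ⟨a₄, b₄, c₄, d₄⟩ => ?_
  refine (bestCmd_spec (by simp)).mono le_rfl fun s₅ _ ⟨a₅, b₅, c₅, d₅⟩ => ?_
  refine ⟨by rw [a₅, a₄, a₃, a₂, a₁], by rw [b₅, b₄, b₃, b₂, b₁], fun a ha => ?_,
    fun k hk a => ?_, fun d h2 h3 h4 h5 h6 h7 h8 => ?_⟩
  · rw [d₅, d₄, d₃, d₂, d₁]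
    repeat rw [Function.update_of_ne (by omega)]
  · rw [d₅, d₄, d₃, d₂, d₁, a₄, a₃, a₂, a₁]
    repeat rw [update_update_apply _ _ _ _ hk]
  · simp only [a₁] at c₂ d₂ a₂
    simp only [a₂] at c₃ d₃ a₃
    simp only [a₃] at c₄ d₄ a₄
    simp only [a₄] at c₅ d₅
    have e₁ : ∀ r, r ≠ 9 → s₁.rvar r = s.rvar r := fun r hr => by
      rw [c₁, Function.update_of_ne hr]
    have e₂ : ∀ r, r ≠ 10 → s₂.rvar r = s₁.rvar r := fun r hr => by
      rw [c₂, Function.update_of_ne hr]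
    have e₃ : ∀ r, r ≠ 11 → s₃.rvar r = s₂.rvar r := fun r hr => by
      rw [c₃, Function.update_of_ne hr]
    have e₄ : ∀ r, r ≠ 12 → s₄.rvar r = s₃.rvar r := fun r hr => by
      rw [c₄, Function.update_of_ne hr]
    have e₅ : ∀ r, r ≠ 13 → s₅.rvar r = s₄.rvar r := fun r hr => by
      rw [c₅, Function.update_of_ne hr]
    have f₂ : ∀ r, r ≠ 9 → s₂.iarr r = s₁.iarr r := fun r hr => by
      rw [d₂, Function.update_of_ne hr]
    have f₃ : ∀ r, r ≠ 10 → s₃.iarr r = s₂.iarr r := fun r hr => by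
      rw [d₃, Function.update_of_ne hr]
    have f₄ : ∀ r, r ≠ 11 → s₄.iarr r = s₃.iarr r := fun r hr => by
      rw [d₄, Function.update_of_ne hr]
    have f₅ : ∀ r, r ≠ 12 → s₅.iarr r = s₄.iarr r := fun r hr => by
      rw [d₅, Function.update_of_ne hr]
    refine ⟨?_, ?_, ?_, ?_, ?_⟩
    · rw [e₅, e₄, e₃, e₂, f₅, f₄, f₃, f₂, c₁, d₁]
      · simp [h2, h3, h4]
      all_goals simp
    · rw [e₅, e₄, e₃, f₅, f₄, f₃, c₂, d₂]
      · simp [e₁, h5, h4]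
      all_goals simp
    · rw [e₅, e₄, f₅, f₄, c₃, d₃]
      · simp [e₂, e₁, h6, h3]
      all_goals simp
    · rw [e₅, f₅, c₄, d₄]
      · simp [e₃, e₂, e₁, h7, h2]
      all_goals simp
    · rw [c₅, d₅]
      simp [e₄, e₃, e₂, e₁, h8]

/-- Each vertex of the chosen quadruple stays in its variable while the gains are computed, since
only variable `11` changes. Exactly one edge, `ab`, has to be stored, in both orientations. -/
theorem elimCmd_spec {I : Input} {s : Store} {m u a b c : ℕ} (hX : ∀ x, s.iarr 13 x = 0)
    (hm : s.ivar 0 = m) (hmn : m ≤ I.n) (hu : s.ivar 7 = u) (ha : s.ivar 8 = a)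
    (hb : s.ivar 9 = b) (hc : s.ivar 10 = c) :
    Triple I elimCmd s (3100 * (I.n + 1)) fun s' =>
      s'.record m = mkRecord (s.val I m) u a b c ∧
      (∀ k, k ≠ m → s'.record k = s.record k) ∧
      s'.iarr 1 = Function.update (s.iarr 1) u 1 ∧
      s'.iarr 2 = Function.update (Function.update (s.iarr 2) (s.iarr 3 a + b) 1)
        (s.iarr 3 b + a) 1 ∧ s'.iarr 3 = s.iarr 3 ∧ s'.iarr 13 = s.iarr 13 := by
  refine Triple.mono (T := 2814 * (I.n + 1) + (150 + 100)) ?_ (by omega) fun _ _ h => h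
  refine (gainsCmd_spec hX hm hmn).seq fun s₁ _ ⟨a₁, b₁, c₁, h2, h3, h4, h5, h6, h7, h8⟩ => ?_
  refine bestsCmd_spec.seq fun s₂ _ ⟨a₂, b₂, c₂, d₂, e₂⟩ => ?_
  refine ((Triple.run (c := recordCmd) rfl s₂).mono (by
    simp [recordCmd, Cmd.maxSteps, IExpr.cost, RExpr.cost]) fun _ _ h => h).mono le_rfl
    fun s₃ _ h₃ => ?_
  simp only [hu, ha, hb, hc] at h2 h3 h4 h5 h6 h7 h8
  have hi : ∀ x, x ≠ 11 → s₂.ivar x = s.ivar x := fun x hx => by rw [a₂, c₁ x hx]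
  have hi0 : s₂.ivar 0 = m := (hi 0 (by simp)).trans hm
  have hi7 : s₂.ivar 7 = u := (hi 7 (by simp)).trans hu
  have hi8 : s₂.ivar 8 = a := (hi 8 (by simp)).trans ha
  have hi9 : s₂.ivar 9 = b := (hi 9 (by simp)).trans hb
  have hi10 : s₂.ivar 10 = c := (hi 10 (by simp)).trans hc
  have := e₂ (gain (s.val I m) u)
  rw [← a₂] at this
  simp only [hi0, hi7, hi8, hi9, hi10] at this
  obtain ⟨g0, g1, g2, g3, g4⟩ := this h2 h3 h4 h5 h6 h7 h8
  rw [h₃]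
  have hk : ∀ k, k ≠ m → ∀ a, s₂.iarr a k = s.iarr a k := by
    intro k hk a
    rw [d₂ k (by rwa [← a₂, hi0]), a₁]
  refine ⟨?_, fun k hk' => ?_, ?_, ?_, ?_, ?_⟩
  · simp only [Prod.ext_iff] at g0 g1 g2 g3 g4
    simp [Store.record, recordCmd, Cmd.run, IExpr.eval, RExpr.eval, mkRecord, hi0, hi7, hi8, hi9,
      hi10, ← g0.1, ← g0.2, ← g1.1, ← g1.2, ← g2.1, ← g2.2, ← g3.1, ← g3.2, ← g4.1, ← g4.2]
  · simp [Store.record, recordCmd, Cmd.run, IExpr.eval, RExpr.eval, hi0, hk', hk k hk', b₂, b₁]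
  · simp [recordCmd, Cmd.run, IExpr.eval, hi7, c₂, a₁]
  · simp [recordCmd, Cmd.run, IExpr.eval, hi8, hi9, c₂, a₁]
  · simp [recordCmd, Cmd.run, c₂, a₁]
  · simp [recordCmd, Cmd.run, c₂, a₁]

/-! ### Searching for a vertex to eliminate -/

/-- The storage represents the graph `H` on the vertex set `R`. -/
structure Models (I : Input) (s : Store) (R : Finset ℕ) (H : SimpleGraph ℕ) : Prop where
  mem : ∀ x, x ∈ R ↔ x < I.n + 3 ∧ s.iarr 1 x = 0
  dummy : ∀ x, I.n ≤ x → x < I.n + 3 → x ∈ R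
  adj : ∀ x y, H.Adj x y ↔ x ∈ R ∧ y ∈ R ∧ x ≠ y ∧ x < I.n ∧ y < I.n ∧
    (I.natGraph.Adj x y ∨ s.iarr 2 (s.iarr 3 x + y) ≠ 0)
  off : ∀ x < I.n + 3, s.iarr 3 x = x * (I.n + 3)

theorem Models.congr {I : Input} {s s' : Store} {R : Finset ℕ} {H : SimpleGraph ℕ}
    (h : Models I s R H) (h1 : s'.iarr 1 = s.iarr 1) (h2 : s'.iarr 2 = s.iarr 2)
    (h3 : s'.iarr 3 = s.iarr 3) : Models I s' R H :=
  ⟨by simpa only [h1] using h.mem, h.dummy, by simpa only [h2, h3] using h.adj,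
    by simpa only [h3] using h.off⟩

/-- The vertices are joined by an edge of the graph or by an additional edge. -/
def linked (e₁ e₂ : IExpr) : BExpr :=
  .not (.and (.not (.adj e₁ e₂)) (.ieq (.get 2 (.plus (.get 3 e₁) e₂)) (.const 0)))

theorem Models.holds_linked {I : Input} {s : Store} {R : Finset ℕ} {H : SimpleGraph ℕ}
    (h : Models I s R H) {e₁ e₂ : IExpr} {x y : ℕ} (he₁ : e₁.eval I s = x) (he₂ : e₂.eval I s = y)
    (hx : x ∈ R) (hy : y ∈ R) (hxy : x ≠ y) (hxn : x < I.n) (hyn : y < I.n) :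
    (linked e₁ e₂).Holds I s ↔ H.Adj x y := by
  rw [h.adj]
  subst he₁ he₂
  change ¬ (¬ I.natGraph.Adj (e₁.eval I s) (e₂.eval I s) ∧
    s.iarr 2 (s.iarr 3 (e₁.eval I s) + e₂.eval I s) = 0) ↔ _
  tauto

/-- Register the scanned vertex as a neighbour of the candidate. -/
def registerCmd : Cmd :=
  .seq (.ite (.ieq (.var 3) (.const 0)) (.iset 4 (.var 2))
    (.ite (.ieq (.var 3) (.const 1)) (.iset 5 (.var 2))
      (.ite (.ieq (.var 3) (.const 2)) (.iset 6 (.var 2)) .skip)))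
    (.iset 3 (.plus (.var 3) (.const 1)))

/-- Register the scanned vertex if it is a neighbour of the candidate. -/
def scanStep : Cmd :=
  .ite (.and (.not (.ieq (.var 1) (.var 2))) (.and (.ieq (.get 1 (.var 2)) (.const 0))
    (linked (.var 1) (.var 2)))) registerCmd .skip

/-- Count the neighbours of the candidate and list the first three. -/
def scanCmd : Cmd :=
  .seq (.seq (.iset 3 (.const 0)) (.seq (.iset 4 .size) (.seq (.iset 5 (.plus .size (.const 1)))
    (.iset 6 (.plus .size (.const 2)))))) (.forTo 2 .size scanStep)

open Classical in
/-- The neighbours of `u` below `k`. -/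
noncomputable def nbrsBelow (H : SimpleGraph ℕ) (u k : ℕ) : Finset ℕ :=
  (Finset.range k).filter (H.Adj u)

theorem mem_nbrsBelow {H : SimpleGraph ℕ} {u k x : ℕ} :
    x ∈ nbrsBelow H u k ↔ x < k ∧ H.Adj u x := by simp [nbrsBelow]

theorem nbrsBelow_succ_of_adj {H : SimpleGraph ℕ} {u k : ℕ} (h : H.Adj u k) :
    nbrsBelow H u (k + 1) = insert k (nbrsBelow H u k) := by
  simp [nbrsBelow, Finset.range_add_one, Finset.filter_insert, h]

theorem nbrsBelow_succ_of_not_adj {H : SimpleGraph ℕ} {u k : ℕ} (h : ¬ H.Adj u k) :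
    nbrsBelow H u (k + 1) = nbrsBelow H u k := by
  simp [nbrsBelow, Finset.range_add_one, Finset.filter_insert, h]

/-- The list `a, b, c` of the first three neighbours, of which there are `d`, padded by the numbers
`n`, `n + 1`, `n + 2`. -/
def IsNbrList (n : ℕ) (N : Finset ℕ) (d a b c : ℕ) : Prop :=
  (d = 0 ∧ a = n ∧ b = n + 1 ∧ c = n + 2 ∧ N = ∅) ∨
  (d = 1 ∧ b = n + 1 ∧ c = n + 2 ∧ N = {a}) ∨
  (d = 2 ∧ a ≠ b ∧ c = n + 2 ∧ N = {a, b}) ∨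
  (d = 3 ∧ a ≠ b ∧ a ≠ c ∧ b ≠ c ∧ N = {a, b, c}) ∨
  (4 ≤ d ∧ 4 ≤ N.card)

theorem scanStep_spec {I : Input} {s : Store} {R : Finset ℕ} {H : SimpleGraph ℕ} {u k : ℕ}
    (h : Models I s R H) (hu : s.ivar 1 = u) (huR : u ∈ R) (hun : u < I.n) (hk : s.ivar 2 = k)
    (hkn : k < I.n)
    (hinv : IsNbrList I.n (nbrsBelow H u k) (s.ivar 3) (s.ivar 4) (s.ivar 5) (s.ivar 6)) :
    Triple I scanStep s 58 fun s' =>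
      IsNbrList I.n (nbrsBelow H u (k + 1)) (s'.ivar 3) (s'.ivar 4) (s'.ivar 5) (s'.ivar 6) := by
  refine (Triple.run (c := scanStep) rfl s).mono (by
    simp [scanStep, registerCmd, linked, Cmd.maxSteps, IExpr.cost, BExpr.cost])
    fun s' _ hs' => ?_
  subst hs'
  by_cases hadj : H.Adj u k
  · rw [nbrsBelow_succ_of_adj hadj]
    have hkR : k ∈ R := ((h.adj u k).1 hadj).2.1
    have hb : BExpr.Holds I s (.and (.not (.ieq (.var 1) (.var 2)))
        (.and (.ieq (.get 1 (.var 2)) (.const 0)) (linked (.var 1) (.var 2)))) := by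
      refine ⟨?_, ?_, (h.holds_linked (e₁ := .var 1) (e₂ := .var 2)
        hu hk huR hkR hadj.ne hun hkn).2 hadj⟩
      · simpa [BExpr.Holds, IExpr.eval, hu, hk] using hadj.ne
      · simpa [BExpr.Holds, IExpr.eval, hk] using ((h.mem k).1 hkR).2
    have hnot : k ∉ nbrsBelow H u k := by simp [mem_nbrsBelow]
    rw [scanStep, Cmd.run, if_pos hb]
    rcases hinv with h' | h' | h' | h' | h'
    · refine .inr (.inl ?_)
      simp [registerCmd, Cmd.run, BExpr.Holds, IExpr.eval, Store.setI, h', hk]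
    · refine .inr (.inr (.inl ?_))
      have : s.ivar 4 ≠ k := by
        rintro rfl
        simp [h'] at hnot
      simp [registerCmd, Cmd.run, BExpr.Holds, IExpr.eval, Store.setI, h', hk, this,
        Finset.pair_comm]
    · refine .inr (.inr (.inr (.inl ?_)))
      have : s.ivar 4 ≠ k ∧ s.ivar 5 ≠ k := by
        constructor <;> rintro rfl <;> simp [h'] at hnot
      simp only [registerCmd, Cmd.run, BExpr.Holds, IExpr.eval, Store.setI, h', hk]
      simp [this, h']
      ext x
      simp
      tauto
    · refine .inr (.inr (.inr (.inr ?_)))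
      rw [Finset.card_insert_of_notMem hnot]
      have : (nbrsBelow H u k).card = 3 := by
        rw [h'.2.2.2.2, Finset.card_eq_three]
        exact ⟨_, _, _, h'.2.1, h'.2.2.1, h'.2.2.2.1, rfl⟩
      simp [registerCmd, Cmd.run, BExpr.Holds, IExpr.eval, Store.setI, h'.1, this]
    -- From the fourth neighbour on, the list is irrelevant and only the count is tracked.
    · refine .inr (.inr (.inr (.inr ?_)))
      rw [Finset.card_insert_of_notMem hnot]
      have h1 : s.ivar 3 ≠ 0 := by omega
      have h2 : s.ivar 3 ≠ 1 := by omega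
      have h3 : s.ivar 3 ≠ 2 := by omega
      simp [registerCmd, Cmd.run, BExpr.Holds, IExpr.eval, Store.setI, h1, h2, h3]
      omega
  · rw [nbrsBelow_succ_of_not_adj hadj]
    have hb : ¬ BExpr.Holds I s (.and (.not (.ieq (.var 1) (.var 2)))
        (.and (.ieq (.get 1 (.var 2)) (.const 0)) (linked (.var 1) (.var 2)))) := by
      rintro ⟨h1, h2, h3⟩
      simp only [BExpr.Holds, IExpr.eval, hu, hk] at h1 h2
      exact hadj ((h.holds_linked (e₁ := .var 1) (e₂ := .var 2) hu hk huR
        ((h.mem k).2 ⟨by omega, h2⟩) h1 hun hkn).1 h3)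
    rw [scanStep, Cmd.run, if_neg hb]
    exact hinv

theorem scanCmd_spec {I : Input} {s : Store} {R : Finset ℕ} {H : SimpleGraph ℕ} {u : ℕ}
    (h : Models I s R H) (hu : s.ivar 1 = u) (huR : u ∈ R) (hun : u < I.n) :
    Triple I scanCmd s (80 * (I.n + 1)) fun s' =>
      IsNbrList I.n (nbrsBelow H u I.n) (s'.ivar 3) (s'.ivar 4) (s'.ivar 5) (s'.ivar 6) := by
  refine Triple.mono (T := 12 + (I.n + 1) * (58 + 1 + 7)) ?_ (by omega) fun _ _ h => h
  refine ((Triple.run rfl s).mono (by simp [Cmd.maxSteps, IExpr.cost]) fun _ _ h => h).seq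
    fun s₁ f₁ h₁ => ?_
  refine (Triple.forTo_const (m := I.n) (T := 58) (Inv := fun k s' =>
    IsNbrList I.n (nbrsBelow H u k) (s'.ivar 3) (s'.ivar 4) (s'.ivar 5) (s'.ivar 6))
    (fun _ _ => rfl) rfl ?_ ?_).mono le_rfl fun s' _ h => h.1
  -- With no neighbour scanned, the list consists of the three pads.
  · refine .inl ?_
    simp [h₁, Store.setI, Cmd.run, IExpr.eval, nbrsBelow]
  · intro k s' hkn f hk hinv
    refine (scanStep_spec (h.congr ?_ ?_ ?_) ?_ huR hun hk hkn hinv).mono le_rfl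
      fun s'' _ h => h
    · rw [f.iarr 1 rfl, f₁.iarr 1 rfl]
    · rw [f.iarr 2 rfl, f₁.iarr 2 rfl]
    · rw [f.iarr 3 rfl, f₁.iarr 3 rfl]
    · rw [f.ivar 1 rfl, f₁.ivar 1 rfl, hu]

/-- The vertex `u` has at most two neighbours, or three neighbours that are pairwise adjacent. -/
def Good (H : SimpleGraph ℕ) (n u : ℕ) : Prop :=
  (nbrsBelow H u n).card ≤ 2 ∨ ((nbrsBelow H u n).card = 3 ∧
    ∀ y z, H.Adj u y → H.Adj u z → y ≠ z → H.Adj y z)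

/-- The vertex `u` can be eliminated, with neighbours among `a`, `b`, `c`, by joining `a` and
`b`. -/
structure Found (n : ℕ) (H : SimpleGraph ℕ) (R : Finset ℕ) (u a b c : ℕ) : Prop where
  elim : Eliminable H R u a b c
  lt : u < n
  simple : Simple H u
  fill : ∀ x y, x ≠ y → H.Adj u x → H.Adj u y → H.Adj x y ∨ (x = a ∧ y = b) ∨ (x = b ∧ y = a)
  adj : a < n → b < n → H.Adj u a ∧ H.Adj u b

/-- The candidate has at most two neighbours, or three pairwise adjacent neighbours. -/
def goodTest : BExpr :=
  .and (.ilt (.var 3) (.const 4)) (.not (.and (.ieq (.var 3) (.const 3))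
    (.not (.and (linked (.var 4) (.var 5)) (.and (linked (.var 4) (.var 6))
      (linked (.var 5) (.var 6)))))))

/-- Choose the candidate. -/
def chooseCmd : Cmd :=
  .seq (.iset 7 (.var 1)) (.seq (.iset 8 (.var 4)) (.seq (.iset 9 (.var 5)) (.iset 10 (.var 6))))

/-- Choose the candidate if it can be eliminated. -/
def findStep : Cmd :=
  .ite (.ieq (.get 1 (.var 1)) (.const 0)) (.seq scanCmd (.ite goodTest chooseCmd .skip)) .skip

/-- Search for a vertex that can be eliminated. -/
def findCmd : Cmd := .seq (.iset 7 .size) (.forTo 1 .size findStep)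

/-- Padding makes `a`, `b`, `c` distinct remaining vertices even when the degree is below three.
With two neighbours the possibly missing edge is `ab`; with three, the test guarantees a clique, so
adding `ab` changes nothing. -/
theorem goodTest_spec {I : Input} {s : Store} {R : Finset ℕ} {H : SimpleGraph ℕ} {u : ℕ}
    (h : Models I s R H) (huR : u ∈ R) (hun : u < I.n)
    (hN : IsNbrList I.n (nbrsBelow H u I.n) (s.ivar 3) (s.ivar 4) (s.ivar 5) (s.ivar 6)) :
    (goodTest.Holds I s → Found I.n H R u (s.ivar 4) (s.ivar 5) (s.ivar 6)) ∧
    (¬ goodTest.Holds I s → ¬ Good H I.n u) := by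
  have hmem : ∀ x, x ∈ nbrsBelow H u I.n ↔ H.Adj u x := fun x => by
    rw [mem_nbrsBelow]
    exact ⟨fun h => h.2, fun h' => ⟨((h.adj u x).1 h').2.2.2.2.1, h'⟩⟩
  have hprop : ∀ {x}, H.Adj u x → x < I.n ∧ x ∈ R.erase u := fun {x} hx => by
    have := (h.adj u x).1 hx
    exact ⟨this.2.2.2.2.1, Finset.mem_erase.2 ⟨hx.ne.symm, this.2.1⟩⟩
  have hd : ∀ i < 3, I.n + i ∈ R.erase u := fun i hi =>
    Finset.mem_erase.2 ⟨by omega, h.dummy _ (by omega) (by omega)⟩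
  generalize ha : s.ivar 4 = a at hN
  generalize hb : s.ivar 5 = b at hN
  generalize hc : s.ivar 6 = c at hN
  simp only [goodTest, BExpr.Holds, IExpr.eval]
  rcases hN with ⟨h3, rfl, rfl, rfl, hN⟩ | ⟨h3, rfl, rfl, hN⟩ | ⟨h3, hab, rfl, hN⟩ |
    ⟨h3, hab, hac, hbc, hN⟩ | ⟨h3, hN⟩
  · simp only [hN, Finset.notMem_empty, false_iff] at hmem
    simp only [h3]
    refine ⟨fun _ => ⟨⟨huR, hd 0 (by simp), hd 1 (by simp), hd 2 (by simp), by simp, by simp,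
      by simp, fun x _ hx => absurd hx (hmem x)⟩, hun, .inl fun x y hx => absurd hx (hmem x),
      fun x y _ hx => absurd hx (hmem x), fun h => absurd h (lt_irrefl _)⟩, fun h => ?_⟩
    simp at h
  · simp only [hN, Finset.mem_singleton] at hmem
    simp only [h3]
    have hua := hprop ((hmem a).1 rfl)
    refine ⟨fun _ => ⟨⟨huR, hua.2, hd 1 (by simp), hd 2 (by simp), by omega, by omega,
      by simp, fun x _ hx => .inl ((hmem x).2 hx)⟩, hun,
      .inr ⟨a, a, fun x hx => .inl ((hmem x).2 hx)⟩,
      fun x y hxy hx hy => absurd (((hmem x).2 hx).trans ((hmem y).2 hy).symm) hxy,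
      fun _ h => by omega⟩, fun h => ?_⟩
    simp at h
  · simp only [hN, Finset.mem_insert, Finset.mem_singleton] at hmem
    simp only [h3]
    have hua := hprop ((hmem a).1 (.inl rfl))
    have hub := hprop ((hmem b).1 (.inr rfl))
    refine ⟨fun _ => ⟨⟨huR, hua.2, hub.2, hd 2 (by simp), hab, by omega,
      by omega, fun x _ hx => ((hmem x).2 hx).imp_right .inl⟩, hun,
      .inr ⟨a, b, fun x hx => (hmem x).2 hx⟩, ?_,
      fun _ _ => ⟨(hmem a).1 (.inl rfl), (hmem b).1 (.inr rfl)⟩⟩, fun h => ?_⟩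
    · intro x y hxy hx hy
      rcases (hmem x).2 hx with rfl | rfl <;> rcases (hmem y).2 hy with rfl | rfl <;> simp_all
    · simp at h
  · simp only [hN, Finset.mem_insert, Finset.mem_singleton] at hmem
    have h1 := (hmem a).1 (.inl rfl)
    have h2 := (hmem b).1 (.inr (.inl rfl))
    have h3' := (hmem c).1 (.inr (.inr rfl))
    have hR : ∀ {x}, H.Adj u x → x ∈ R := fun hx => Finset.mem_of_mem_erase (hprop hx).2
    rw [h.holds_linked (e₁ := .var 4) (e₂ := .var 5) ha hb (hR h1) (hR h2) hab (hprop h1).1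
      (hprop h2).1, h.holds_linked (e₁ := .var 4) (e₂ := .var 6) ha hc (hR h1) (hR h3') hac
      (hprop h1).1 (hprop h3').1,
      h.holds_linked (e₁ := .var 5) (e₂ := .var 6) hb hc (hR h2) (hR h3') hbc (hprop h2).1 (hprop h3').1]
    simp only [h3, Nat.reduceLT, true_and, not_not]
    have hcl : (H.Adj a b ∧ H.Adj a c ∧ H.Adj b c) →
        ∀ x y, H.Adj u x → H.Adj u y → x ≠ y → H.Adj x y := by
      rintro ⟨hab', hac', hbc'⟩ x y hx hy hxy
      have := hab'.symm
      have := hac'.symm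
      have := hbc'.symm
      rcases (hmem x).2 hx with rfl | rfl | rfl <;> rcases (hmem y).2 hy with rfl | rfl | rfl <;>
        first | assumption | exact absurd rfl hxy
    refine ⟨fun hcl' => ⟨⟨huR, (hprop h1).2, (hprop h2).2, (hprop h3').2, hab, hac, hbc,
      fun x _ hx => (hmem x).2 hx⟩, hun, .inl (hcl hcl'),
      fun x y hxy hx hy => .inl (hcl hcl' x y hx hy hxy), fun _ _ => ⟨h1, h2⟩⟩, fun hn hg => ?_⟩
    have hcard : (nbrsBelow H u I.n).card = 3 := by
      rw [hN, Finset.card_eq_three]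
      exact ⟨_, _, _, hab, hac, hbc, rfl⟩
    rcases hg with hg | hg
    · omega
    · exact hn ⟨hg.2 a b h1 h2 hab, hg.2 a c h1 h3' hac, hg.2 b c h2 h3' hbc⟩
  · refine ⟨fun h => absurd h.1 (by omega), fun _ hg => ?_⟩
    rcases hg with hg | hg <;> omega

theorem findCmd_spec {I : Input} {s : Store} {R : Finset ℕ} {H : SimpleGraph ℕ}
    (h : Models I s R H) :
    Triple I findCmd s (250 * (I.n + 1) ^ 2) fun s' =>
      Found I.n H R (s'.ivar 7) (s'.ivar 8) (s'.ivar 9) (s'.ivar 10) ∨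
      ∀ x < I.n, x ∈ R → ¬ Good H I.n x := by
  have htime : 2 + (I.n + 1) * ((5 + (80 * (I.n + 1) + 100)) + 1 + 7) ≤ 250 * (I.n + 1) ^ 2 := by
    nlinarith
  refine Triple.mono (T := 2 + (I.n + 1) * ((5 + (80 * (I.n + 1) + 100)) + 1 + 7)) ?_ htime
    fun _ _ h => h
  refine ((Triple.run rfl s).mono (by simp [Cmd.maxSteps, IExpr.cost]) fun _ _ h => h).seq
    fun s₁ f₁ h₁ => ?_
  refine (Triple.forTo_const (m := I.n) (T := 5 + (80 * (I.n + 1) + 100)) (Inv := fun k s' =>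
    Found I.n H R (s'.ivar 7) (s'.ivar 8) (s'.ivar 9) (s'.ivar 10) ∨
      ∀ x < k, x ∈ R → ¬ Good H I.n x)
    (fun _ _ => rfl) rfl ?_ ?_).mono le_rfl fun s' _ h => h.1
  · exact .inr fun x hx => absurd hx (by omega)
  · intro k s' hkn f hk hinv
    have hM : Models I s' R H := h.congr (by rw [f.iarr 1 rfl, f₁.iarr 1 rfl])
      (by rw [f.iarr 2 rfl, f₁.iarr 2 rfl]) (by rw [f.iarr 3 rfl, f₁.iarr 3 rfl])
    have hdead : BExpr.Holds I s' (.ieq (.get 1 (.var 1)) (.const 0)) ↔ k ∈ R := by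
      rw [hM.mem]
      simp only [BExpr.Holds, IExpr.eval, hk]
      exact ⟨fun h => ⟨by omega, h⟩, fun h => h.2⟩
    refine Triple.mono (T := 4 + 1 + (80 * (I.n + 1) + 100)) (Triple.ite (fun hb => ?_) fun hb => ?_)
      (by omega) fun _ _ h => h
    · rw [hdead] at hb
      refine (scanCmd_spec hM hk hb hkn).seq fun s₂ f₂ h₂ => ?_
      have hM₂ : Models I s₂ R H := hM.congr (f₂.iarr 1 rfl) (f₂.iarr 2 rfl) (f₂.iarr 3 rfl)
      have hg := goodTest_spec hM₂ hb hkn h₂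
      refine Triple.mono (T := goodTest.cost + 1 + 20) (Triple.ite (fun hb' => ?_) fun hb' => ?_)
        (by simp [goodTest, linked, BExpr.cost, IExpr.cost]) fun _ _ h => h
      · refine (Triple.run (c := chooseCmd) rfl s₂).mono (by
          simp [chooseCmd, Cmd.maxSteps, IExpr.cost]) fun s₃ _ h₃ => .inl ?_
        have := hg.1 hb'
        have h1 : s₂.ivar 1 = k := by rw [f₂.ivar 1 rfl, hk]
        simpa [h₃, chooseCmd, Cmd.run, IExpr.eval, Store.setI, h1] using this
      · refine (Triple.run (c := .skip) rfl s₂).mono (by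
          simp [Cmd.maxSteps]) fun s₃ _ h₃ => ?_
        rw [h₃]
        -- A failed test does not touch the variables `7` to `10`, so an earlier find is kept.
        rcases hinv with hinv | hinv
        · left
          simpa [Cmd.run, Store.setI, f₂.ivar 7 rfl, f₂.ivar 8 rfl, f₂.ivar 9 rfl,
            f₂.ivar 10 rfl] using hinv
        · right
          intro x hx hxR
          rcases Nat.lt_succ_iff_lt_or_eq.1 hx with hx | rfl
          · exact hinv x hx hxR
          · exact hg.2 hb'
    · rw [hdead] at hb
      refine (Triple.run (c := .skip) rfl s').mono (by
          simp [Cmd.maxSteps]) fun s₃ _ h₃ => ?_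
      rw [h₃]
      rcases hinv with hinv | hinv
      · left
        simpa [Cmd.run, Store.setI] using hinv
      · right
        intro x hx hxR
        rcases Nat.lt_succ_iff_lt_or_eq.1 hx with hx | rfl
        · exact hinv x hx hxR
        · exact absurd hxR hb

/-! ### The elimination phase -/

/-- The labelling obtained by undoing the first `k` eliminations. -/
noncomputable def Store.back (s : Store) : ℕ → (ℕ → ℕ) → ℕ → ℕ
  | 0, l => l
  | k + 1, l => s.back k ((s.record k).extend l)

theorem Store.back_congr {s s' : Store} {k : ℕ} (h : ∀ i < k, s'.record i = s.record i)
    (l : ℕ → ℕ) : s'.back k l = s.back k l := by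
  induction k generalizing l with
  | zero => rfl
  | succ k ih =>
    rw [Store.back, Store.back, h k (by omega), ih fun i hi => h i (by omega)]

/-- The situation after `k` eliminations. -/
structure Stage {W : Type*} (I : Input) (K : SimpleGraph W) (k : ℕ) (s : Store) (R : Finset ℕ)
    (H : SimpleGraph ℕ) : Prop where
  models : Models I s R H
  minor : ¬ HasMinor H K
  idm : IDMOn H R (s.val I k)
  unmarked : ∀ x, s.iarr 13 x = 0
  card : R.card + k = I.n + 3
  empty : s.val I k ∅ = 0
  single : ∀ x, I.n ≤ x → s.val I k {x} = 0
  lift : ∀ l, Closed R l → IsOpt (s.val I k) R l →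
    IsOpt I.natValue (Finset.range (I.n + 3)) (s.back k l)

theorem Stage.congr {W : Type*} {I : Input} {K : SimpleGraph W} {k : ℕ} {s s' : Store}
    {R : Finset ℕ} {H : SimpleGraph ℕ} (h : Stage I K k s R H) (hi : s'.iarr = s.iarr)
    (hr : s'.rarr = s.rarr) : Stage I K k s' R H := by
  have hrec : s'.record = s.record := by
    funext k
    simp only [Store.record, hi, hr]
  have hval : s'.val I k = s.val I k := by
    funext S
    simp only [Store.val, hrec]
  refine ⟨h.models.congr (by rw [hi]) (by rw [hi]) (by rw [hi]), h.minor, ?_, ?_,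
    h.card, ?_, ?_, ?_⟩
  · rw [hval]; exact h.idm
  · rw [hi]; exact h.unmarked
  · rw [hval]; exact h.empty
  · rw [hval]; exact h.single
  · intro l hl hopt
    rw [hval] at hopt
    rw [Store.back_congr fun i _ => congrFun hrec i]
    exact h.lift l hl hopt

/-- Graphs without a minor `K` have vertices that can be eliminated. -/
def Reducible {W : Type*} (K : SimpleGraph W) : Prop :=
  (∀ w, ∃ w', K.Adj w w') ∧ ∀ (H : SimpleGraph ℕ) (R : Finset ℕ) (n : ℕ),
    (∀ x y, H.Adj x y → y < n ∧ y ∈ R) → (∃ x ∈ R, x < n) → ¬ HasMinor H K →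
    ∃ x < n, x ∈ R ∧ Good H n x

/-- Row-major addresses in a square array of width `N` are unambiguous. -/
theorem row_injective {N x y a b : ℕ} (hy : y < N) (hb : b < N) :
    x * N + y = a * N + b ↔ x = a ∧ y = b := by
  constructor
  · intro h
    have h1 : x = a := by
      rcases lt_trichotomy x a with hlt | rfl | hlt
      · have := Nat.mul_le_mul_right N (Nat.succ_le_of_lt hlt)
        rw [Nat.succ_mul] at this
        omega
      · rfl
      · have := Nat.mul_le_mul_right N (Nat.succ_le_of_lt hlt)
        rw [Nat.succ_mul] at this
        omega
    subst h1
    exact ⟨rfl, by omega⟩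
  · rintro ⟨rfl, rfl⟩
    rfl

/-- The field `fill` says that turning the neighbourhood into a clique needs no edge besides `ab`,
and `adj` that this edge is wanted if both ends are nodes. Entries written for pads are harmless,
since adjacency is read only between nodes. -/
theorem Models.eliminate {I : Input} {s s' : Store} {R : Finset ℕ} {H : SimpleGraph ℕ}
    {u a b c : ℕ} (h : Models I s R H) (hf : Found I.n H R u a b c)
    (h1 : s'.iarr 1 = Function.update (s.iarr 1) u 1)
    (h2 : s'.iarr 2 = Function.update (Function.update (s.iarr 2) (s.iarr 3 a + b) 1)
        (s.iarr 3 b + a) 1) (h3 : s'.iarr 3 = s.iarr 3) :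
    Models I s' (R.erase u) (GCSG.eliminate H u) := by
  have hmem : ∀ x ∈ R.erase u, x < I.n + 3 := fun x hx =>
    ((h.mem x).1 (Finset.mem_of_mem_erase hx)).1
  have han := hmem a hf.elim.ha
  have hbn := hmem b hf.elim.hb
  refine ⟨fun x => ?_, fun x hx hx' => ?_, fun x y => ?_, by simpa only [h3] using h.off⟩
  · rw [h1, Finset.mem_erase, h.mem]
    by_cases hxu : x = u <;> simp [hxu]
  · exact Finset.mem_erase.2 ⟨by have := hf.lt; omega, h.dummy x hx hx'⟩
  · have hfill : x < I.n → y < I.n → (s'.iarr 2 (s'.iarr 3 x + y) ≠ 0 ↔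
        s.iarr 2 (s.iarr 3 x + y) ≠ 0 ∨ (x = a ∧ y = b) ∨ (x = b ∧ y = a)) := by
      intro hx hy
      have e1 : (s.iarr 3 x + y = s.iarr 3 a + b) ↔ (x = a ∧ y = b) := by
        rw [h.off x (by omega), h.off a han]
        exact row_injective (by omega) hbn
      have e2 : (s.iarr 3 x + y = s.iarr 3 b + a) ↔ (x = b ∧ y = a) := by
        rw [h.off x (by omega), h.off b hbn]
        exact row_injective (by omega) han
      rw [h2, h3, Function.update_apply, Function.update_apply, ← e1, ← e2]
      by_cases p1 : s.iarr 3 x + y = s.iarr 3 b + a <;>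
        by_cases p2 : s.iarr 3 x + y = s.iarr 3 a + b <;> simp [p1, p2]
    rw [eliminate_adj, Finset.mem_erase, Finset.mem_erase]
    constructor
    · rintro ⟨hxu, hyu, hadj⟩
      have hxy : x ∈ R ∧ y ∈ R ∧ x ≠ y ∧ x < I.n ∧ y < I.n := by
        rcases hadj with hadj | ⟨hne, hx, hy⟩
        · have := (h.adj x y).1 hadj
          exact ⟨this.1, this.2.1, this.2.2.1, this.2.2.2.1, this.2.2.2.2.1⟩
        · have p1 := (h.adj u x).1 hx
          have p2 := (h.adj u y).1 hy
          exact ⟨p1.2.1, p2.2.1, hne, p1.2.2.2.2.1, p2.2.2.2.2.1⟩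
      refine ⟨⟨hxu, hxy.1⟩, ⟨hyu, hxy.2.1⟩, hxy.2.2.1, hxy.2.2.2.1, hxy.2.2.2.2, ?_⟩
      rw [hfill hxy.2.2.2.1 hxy.2.2.2.2]
      have : H.Adj x y ∨ (x = a ∧ y = b) ∨ (x = b ∧ y = a) := by
        rcases hadj with hadj | ⟨hne, hx, hy⟩
        · exact .inl hadj
        · exact hf.fill x y hne hx hy
      rcases this with hadj | hadj
      · exact ((h.adj x y).1 hadj).2.2.2.2.2.imp_right .inl
      · exact .inr (.inr hadj)
    · rintro ⟨⟨hxu, hxR⟩, ⟨hyu, hyR⟩, hne, hx, hy, hadj⟩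
      rw [hfill hx hy] at hadj
      refine ⟨hxu, hyu, ?_⟩
      rcases hadj with hadj | hadj | ⟨rfl, rfl⟩ | ⟨rfl, rfl⟩
      · exact .inl ((h.adj x y).2 ⟨hxR, hyR, hne, hx, hy, .inl hadj⟩)
      · exact .inl ((h.adj x y).2 ⟨hxR, hyR, hne, hx, hy, .inr hadj⟩)
      · exact .inr ⟨hne, hf.adj hx hy⟩
      · exact .inr ⟨hne, (hf.adj hy hx).2, (hf.adj hy hx).1⟩

/-- One pass of the elimination phase. -/
def passCmd : Cmd := .seq findCmd elimCmd

/-- The search cannot fail, as an excluded minor guarantees a suitable node. Undoing the new record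
first and then the old ones composes `IDMOn.extend_isOpt` with the field `lift`. -/
theorem passCmd_spec {W : Type*} {I : Input} {K : SimpleGraph W} (hK : Reducible K) {k : ℕ}
    {s : Store} {R : Finset ℕ} {H : SimpleGraph ℕ} (h : Stage I K k s R H) (hk : k < I.n)
    (hs : s.ivar 0 = k) :
    Triple I passCmd s (3350 * (I.n + 1) ^ 2) fun s' => ∃ R' H', Stage I K (k + 1) s' R' H' := by
  have htime : 250 * (I.n + 1) ^ 2 + 3100 * (I.n + 1) ≤ 3350 * (I.n + 1) ^ 2 := by nlinarith
  refine Triple.mono (T := 250 * (I.n + 1) ^ 2 + 3100 * (I.n + 1)) ?_ htime fun _ _ h => h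
  refine (findCmd_spec h.models).seq fun s₁ f₁ h₁ => ?_
  -- Before the last elimination more than three vertices remain, so they are not all pads.
  have hreal : ∃ x ∈ R, x < I.n := by
    by_contra hcon
    push Not at hcon
    have hsub : R ⊆ Finset.Ico I.n (I.n + 3) := fun x hx =>
      Finset.mem_Ico.2 ⟨hcon x hx, ((h.models.mem x).1 hx).1⟩
    have h1 := Finset.card_le_card hsub
    have h2 := h.card
    rw [Nat.card_Ico] at h1
    omega
  obtain ⟨x, hxn, hxR, hx⟩ := hK.2 H R I.n
    (fun x y hxy => ⟨((h.models.adj x y).1 hxy).2.2.2.2.1, ((h.models.adj x y).1 hxy).2.1⟩)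
    hreal h.minor
  have hf := h₁.resolve_right fun hno => hno x hxn hxR hx
  have hs₁ : s₁.record = s.record := f₁.record_eq rfl
  have hval₁ : s₁.val I = s.val I := f₁.val_eq rfl I
  refine (elimCmd_spec (m := k) (by rw [f₁.iarr 13 rfl]; exact h.unmarked)
    (by rw [f₁.ivar 0 rfl, hs]) hk.le rfl rfl rfl rfl).mono le_rfl
    fun s₂ _ ⟨h2, h3, h4, h5, h6, h7⟩ => ?_
  rw [hval₁] at h2
  generalize s₁.ivar 7 = u at *
  generalize s₁.ivar 8 = a at *
  generalize s₁.ivar 9 = b at *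
  generalize s₁.ivar 10 = c at *
  have hrec : ∀ i < k, s₂.record i = s.record i := fun i hi => by rw [h3 i (by omega), hs₁]
  have hval : s₂.val I (k + 1) =
      fun S => s.val I k S + (mkRecord (s.val I k) u a b c).term S := by
    funext S
    rw [Store.val, Finset.sum_range_succ, h2, Store.val, ← add_assoc,
      Finset.sum_congr rfl fun i hi => by rw [hrec i (Finset.mem_range.1 hi)]]
  refine ⟨R.erase u, eliminate H u, ?_, ?_, ?_, ?_, ?_, ?_, ?_, ?_⟩
  · refine (h.models.congr (s' := s₁) ?_ ?_ ?_).eliminate hf h4 h5 h6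
    · exact f₁.iarr 1 rfl
    · exact f₁.iarr 2 rfl
    · exact f₁.iarr 3 rfl
  · exact fun hm => h.minor (hm.of_eliminate hK.1 hf.simple)
  · rw [hval]
    exact h.idm.eliminate h.empty hf.elim
  · rw [h7, f₁.iarr 13 rfl]
    exact h.unmarked
  · have := h.card
    have := Finset.card_erase_add_one hf.elim.hu
    omega
  · rw [hval]
    simp [h.empty, Record.term]
  · intro x hx
    have e1 := hf.elim.hab
    have e2 := hf.elim.hac
    have e3 := hf.elim.hbc
    rw [hval]
    simp only [h.single x hx, Record.term, mkRecord, Finset.mem_singleton]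
    -- A singleton contains no two of the distinct vertices `a`, `b`, `c`, so none of the weights
    -- applies.
    rw [if_neg (by omega), if_neg (by omega), if_neg (by omega), if_neg (by omega)]
    ring
  · intro l hl hopt
    rw [Store.back, Store.back_congr hrec, h2]
    rw [hval] at hopt
    exact h.lift _ (hl.extend hf.elim) (h.idm.extend_isOpt h.empty hf.elim hl hopt)

/-- Compute the row offsets. -/
def offsetCmd : Cmd :=
  .forTo 1 (.plus .size (.const 3)) (.seq (.iput 3 (.var 1) (.var 12))
    (.iset 12 (.plus (.var 12) (.plus .size (.const 3)))))

/-- Multiples of `n + 3` are accumulated by repeated addition, because the machine cannot multiply.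
-/
theorem offsetCmd_spec {W : Type*} {I : Input} (hI : I.IsInstance) {K : SimpleGraph W}
    (hK : Reducible K) (hG : ¬ HasMinor I.graph K) :
    Triple I offsetCmd Store.init (100 * (I.n + 1))
      fun s' => Stage I K 0 s' (Finset.range (I.n + 3)) I.natGraph := by
  refine Triple.mono (T := (I.n + 3 + 1) * (9 + 3 + 7)) ((Triple.forTo_const (T := 9)
    (m := I.n + 3) (Inv := fun k s' => s'.ivar 12 = k * (I.n + 3) ∧
      ∀ x < k, s'.iarr 3 x = x * (I.n + 3)) (fun _ _ => rfl) rfl ?_ ?_).mono le_rfl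
      fun s' f ⟨⟨_, h⟩, _⟩ => ?_) (by omega) fun _ _ h => h
  · exact ⟨by simp [Store.setI, Store.init], fun x hx => absurd hx (by omega)⟩
  · rintro k s' - - hk ⟨h1, h2⟩
    refine (Triple.run rfl s').mono (by simp [Cmd.maxSteps, IExpr.cost]) fun s'' _ h => ?_
    rw [h]
    refine ⟨?_, fun x hx => ?_⟩
    · simp [Cmd.run, Store.setI, IExpr.eval, h1]
      ring
    · rcases Nat.lt_succ_iff_lt_or_eq.1 hx with hx | rfl
      · have : x ≠ k := by omega
        simp [Cmd.run, Store.setI, IExpr.eval, hk, this, h2 x hx]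
      · simp [Cmd.run, Store.setI, IExpr.eval, hk, h1]
  · have hval : s'.val I 0 = I.natValue := by
      funext S
      simp [Store.val]
    have hz : ∀ a, offsetCmd.writesIA a = false → ∀ x, s'.iarr a x = 0 := fun a ha x => by
      rw [f.iarr a ha]
      rfl
    refine ⟨⟨fun x => ?_, fun x _ hx => Finset.mem_range.2 hx, fun x y => ?_, h⟩,
      fun hm => hG (hm.of_natGraph hK.1), ?_, hz 13 rfl, by simp, ?_, ?_, fun l _ hl => ?_⟩
    · simp [hz 1 rfl]
    · simp only [hz 2 rfl, ne_eq, not_true_eq_false, or_false, Finset.mem_range]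
      refine ⟨fun hxy => ?_, fun hxy => hxy.2.2.2.2.2⟩
      have hne := hxy.ne
      obtain ⟨hx, hy, hadj⟩ := hxy
      exact ⟨by omega, by omega, hne, hx, hy, hx, hy, hadj⟩
    · rw [hval]
      exact Input.natValue_idm hI.2.2 _
    · rw [hval, Input.natValue_empty hI.2.1]
    · intro x hx
      rw [hval, Input.natValue_singleton hI.2.1 hx]
    · rwa [hval] at hl

/-- The elimination phase. -/
def reduceCmd : Cmd := .seq offsetCmd (.forTo 0 .size passCmd)

/-- After `n` eliminations just the three pads remain. They have no edges and no value, so every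
labelling of them is optimal; labelling each by itself is in addition closed. -/
theorem Stage.isOpt_back {W : Type*} {I : Input} {K : SimpleGraph W} {s : Store} {R : Finset ℕ}
    {H : SimpleGraph ℕ} (h : Stage I K I.n s R H) {l : ℕ → ℕ}
    (hl : ∀ x, I.n ≤ x → x < I.n + 3 → l x = x) :
    IsOpt I.natValue (Finset.range (I.n + 3)) (s.back I.n l) := by
  have hsub : Finset.Ico I.n (I.n + 3) ⊆ R := fun x hx =>
    h.models.dummy x (Finset.mem_Ico.1 hx).1 (Finset.mem_Ico.1 hx).2
  have hR : Finset.Ico I.n (I.n + 3) = R := Finset.eq_of_subset_of_card_le hsub (by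
    have := h.card
    rw [Nat.card_Ico]
    omega)
  have hmem : ∀ x ∈ R, I.n ≤ x ∧ x < I.n + 3 := fun x hx => by rwa [← hR, Finset.mem_Ico] at hx
  refine h.lift l (fun x hx => ?_) fun l' => ?_
  · rwa [hl x (hmem x hx).1 (hmem x hx).2]
  · have hzero := h.idm.obj_eq_zero h.empty (fun x hx y _ hadj => by
      have := ((h.models.adj x y).1 hadj).2.2.2.1
      have := (hmem x hx).1
      omega) fun x hx => h.single x (hmem x hx).1
    rw [hzero, hzero]

theorem reduceCmd_spec {W : Type*} {I : Input} (hI : I.IsInstance) {K : SimpleGraph W}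
    (hK : Reducible K) (hG : ¬ HasMinor I.graph K) :
    Triple I reduceCmd Store.init (3500 * (I.n + 1) ^ 3)
      fun s' => ∀ l : ℕ → ℕ, (∀ x, I.n ≤ x → x < I.n + 3 → l x = x) →
        IsOpt I.natValue (Finset.range (I.n + 3)) (s'.back I.n l) := by
  have htime : 100 * (I.n + 1) + (I.n + 1) * (3350 * (I.n + 1) ^ 2 + 1 + 7) ≤
      3500 * (I.n + 1) ^ 3 := by
    have h1 : I.n + 1 ≤ (I.n + 1) ^ 3 := Nat.le_self_pow (by simp) _
    nlinarith
  refine Triple.mono (T := 100 * (I.n + 1) + (I.n + 1) * (3350 * (I.n + 1) ^ 2 + 1 + 7)) ?_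
    htime fun _ _ h => h
  refine (offsetCmd_spec hI hK hG).seq fun s₁ _ h₁ => ?_
  refine (Triple.forTo_const (T := 3350 * (I.n + 1) ^ 2) (m := I.n)
    (Inv := fun k s' => ∃ R H, Stage I K k s' R H) (fun _ _ => rfl) rfl
    ⟨_, _, h₁.congr rfl rfl⟩ ?_).mono le_rfl ?_
  · rintro k s' hk - hs ⟨R, H, h⟩
    exact (passCmd_spec hK h hk hs).mono le_rfl fun s'' _ ⟨R', H', h'⟩ =>
      ⟨R', H', h'.congr rfl rfl⟩
  · rintro s' - ⟨⟨R, H, h⟩, -⟩ l hl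
    exact h.isOpt_back hl

/-! ### The labelling phase -/

/-- Label the vertex of the record with the index in variable `0`. -/
def extendCmd : Cmd :=
  .seq (.iset 7 (.get 4 (.var 0))) (.seq (.iset 8 (.get 14 (.get 5 (.var 0))))
    (.seq (.iset 9 (.get 14 (.get 6 (.var 0)))) (.seq (.iset 10 (.get 14 (.get 7 (.var 0))))
      (.seq (.ite (.ieq (.var 8) (.var 9))
          (.ite (.ieq (.var 8) (.var 10)) (.iset 12 (.get 12 (.var 0))) (.iset 12 (.get 9 (.var 0))))
          (.ite (.ieq (.var 8) (.var 10)) (.iset 12 (.get 10 (.var 0)))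
            (.ite (.ieq (.var 9) (.var 10)) (.iset 12 (.get 11 (.var 0)))
              (.iset 12 (.get 8 (.var 0))))))
        (.ite (.ieq (.var 12) (.var 7)) (.iput 14 (.var 7) (.var 7))
          (.iput 14 (.var 7) (.get 14 (.var 12))))))))

/-- Label the vertices in the reverse order of their elimination. -/
def labelCmd : Cmd :=
  .seq (.seq (.iput 14 .size .size) (.seq (.iput 14 (.plus .size (.const 1)) (.plus .size (.const 1)))
    (.iput 14 (.plus .size (.const 2)) (.plus .size (.const 2)))))
    (.forTo 1 .size (.seq (.iset 0 (.minus (.minus .size (.var 1)) (.const 1))) extendCmd))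

theorem extendCmd_spec {I : Input} {s : Store} {k : ℕ} (hk : s.ivar 0 = k) :
    Triple I extendCmd s 80 fun s' => s'.iarr 14 = (s.record k).extend (s.iarr 14) := by
  refine (Triple.run (c := extendCmd) rfl s).mono (by
    simp [extendCmd, Cmd.maxSteps, IExpr.cost, BExpr.cost]) fun s' _ h => ?_
  rw [h]
  simp only [extendCmd, Cmd.run, IExpr.eval, BExpr.Holds, Store.setI, hk, Record.extend,
    Record.choice, Store.record]
  by_cases h1 : s.iarr 14 (s.iarr 5 k) = s.iarr 14 (s.iarr 6 k) <;>
    by_cases h2 : s.iarr 14 (s.iarr 5 k) = s.iarr 14 (s.iarr 7 k) <;>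
    by_cases h3 : s.iarr 14 (s.iarr 6 k) = s.iarr 14 (s.iarr 7 k) <;>
    simp only [h1, h2, h3, if_true, if_false, Function.update_self, ne_eq, Nat.reduceEqDiff,
      not_false_eq_true, Function.update_of_ne] <;>
    split_ifs <;> simp_all

theorem labelCmd_spec {I : Input} (s : Store) :
    Triple I labelCmd s (120 * (I.n + 1)) fun s' =>
      ∃ l : ℕ → ℕ, (∀ x, I.n ≤ x → x < I.n + 3 → l x = x) ∧ s'.iarr 14 = s.back I.n l := by
  refine Triple.mono (T := 17 + (I.n + 1) * ((6 + 80) + 1 + 7)) ?_ (by omega) fun _ _ h => h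
  refine ((Triple.run rfl s).mono (by simp [Cmd.maxSteps, IExpr.cost]) fun _ _ h => h).seq
    fun s₁ f₁ h₁ => ?_
  -- Invariant: undoing the records still pending, applied to the current labels, gives the final
  -- labelling.
  refine (Triple.forTo_const (T := 6 + 80) (m := I.n) (Inv := fun k s' =>
    s.back (I.n - k) (s'.iarr 14) = s.back I.n (s₁.iarr 14)) (fun _ _ => rfl) rfl rfl ?_).mono
    le_rfl fun s' _ h => ⟨s₁.iarr 14, fun x hx hx' => ?_, ?_⟩
  · intro k s' hk f hxk hinv
    refine (Triple.run rfl s').seq fun s₂ f₂ h₂ => ?_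
    have h0 : s₂.ivar 0 = I.n - (k + 1) := by
      simp [h₂, Cmd.run, Store.setI, IExpr.eval, hxk]
      omega
    refine (extendCmd_spec h0).mono le_rfl fun s₃ _ h₃ => ?_
    change s.back (I.n - (k + 1)) (s₃.iarr 14) = _
    rw [← hinv, h₃, show I.n - k = I.n - (k + 1) + 1 by omega, Store.back, f₂.record_eq rfl,
      f.record_eq rfl, f₁.record_eq rfl, f₂.iarr 14 rfl]
  · have : x = I.n ∨ x = I.n + 1 ∨ x = I.n + 2 := by omega
    rcases this with rfl | rfl | rfl <;> simp [h₁, Cmd.run, IExpr.eval]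
  · have := h.1
    rwa [Nat.sub_self, Store.back] at this

/-! ### Merging adjacent vertices -/

/-- Equally labelled vertices are connected in `F`, and the edges of `F` in `D` join equally
labelled vertices. -/
structure Merged {V : Type*} (F : SimpleGraph V) (D : V → V → Prop) (l : V → ℕ) : Prop where
  reachable : ∀ x y, l x = l y → F.Reachable x y
  eq : ∀ x y, D x y → F.Adj x y → l x = l y

/-- Giving the class of `j` the label of `i` fuses two classes along an edge of `F`. Equal labels
stay equal, so the pairs treated earlier need no second visit. -/
theorem Merged.relabel {V : Type*} {F : SimpleGraph V} {D D' : V → V → Prop} {l l' : V → ℕ}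
    (h : Merged F D l) {i j : V} (hij : F.Adj i j)
    (hl : ∀ x, l' x = if l x = l j then l i else l x)
    (hD : ∀ x y, D' x y → D x y ∨ (x = i ∧ y = j)) : Merged F D' l' := by
  refine ⟨fun x y hxy => ?_, fun x y hxy hadj => ?_⟩
  · rw [hl, hl] at hxy
    split_ifs at hxy with h1 h2 h2
    · exact h.reachable _ _ (h1.trans h2.symm)
    · exact ((h.reachable _ _ h1).trans hij.symm.reachable).trans (h.reachable _ _ hxy)
    · exact ((h.reachable _ _ hxy).trans hij.reachable).trans (h.reachable _ _ h2.symm)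
    · exact h.reachable _ _ hxy
  · rw [hl, hl]
    rcases hD x y hxy with hxy | ⟨rfl, rfl⟩
    · rw [h.eq x y hxy hadj]
    · simp

theorem Merged.skip {V : Type*} {F : SimpleGraph V} {D D' : V → V → Prop} {l : V → ℕ}
    (h : Merged F D l) {i j : V} (hij : ¬ F.Adj i j)
    (hD : ∀ x y, D' x y → D x y ∨ (x = i ∧ y = j)) : Merged F D' l := by
  refine ⟨h.reachable, fun x y hxy hadj => ?_⟩
  rcases hD x y hxy with hxy | ⟨rfl, rfl⟩
  · exact h.eq x y hxy hadj
  · exact absurd hadj hij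

theorem Merged.iff_reachable {V : Type*} {F : SimpleGraph V} {D : V → V → Prop} {l : V → ℕ}
    (h : Merged F D l) (hD : ∀ x y, D x y) (x y : V) : l x = l y ↔ F.Reachable x y := by
  refine ⟨h.reachable x y, fun hxy => ?_⟩
  obtain ⟨p⟩ := hxy
  induction p with
  | nil => rfl
  | cons hadj _ ih => exact (h.eq _ _ (hD _ _) hadj).trans ih

/-- Merge the classes of the vertices in the variables `13` and `14`. -/
def relabelCmd : Cmd :=
  .seq (.seq (.iset 16 (.get 0 (.var 13))) (.iset 17 (.get 0 (.var 14))))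
    (.forTo 15 .size (.ite (.ieq (.get 0 (.var 15)) (.var 17)) (.iput 0 (.var 15) (.var 16)) .skip))

theorem relabelCmd_spec {I : Input} (s : Store) :
    Triple I relabelCmd s (30 * (I.n + 1)) fun s' => ∀ x < I.n, s'.iarr 0 x =
      if s.iarr 0 x = s.iarr 0 (s.ivar 14) then s.iarr 0 (s.ivar 13) else s.iarr 0 x := by
  refine Triple.mono (T := 6 + (I.n + 1) * (9 + 1 + 7)) ?_ (by omega) fun _ _ h => h
  refine (Triple.run rfl s).seq fun s₁ f₁ h₁ => ?_
  have h16 : s₁.ivar 16 = s.iarr 0 (s.ivar 13) := by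
    simp [h₁, Cmd.run, Store.setI, IExpr.eval]
  have h17 : s₁.ivar 17 = s.iarr 0 (s.ivar 14) := by
    simp [h₁, Cmd.run, Store.setI, IExpr.eval]
  refine (Triple.forTo_const (T := 9) (m := I.n) (Inv := fun k s' => ∀ x, s'.iarr 0 x =
    if x < k ∧ s.iarr 0 x = s.iarr 0 (s.ivar 14) then s.iarr 0 (s.ivar 13) else s.iarr 0 x)
    (fun _ _ => rfl) rfl ?_ ?_).mono le_rfl fun s' _ h x hx => ?_
  · intro x
    simp [Store.setI, f₁.iarr 0 rfl]
  · intro k s' hk f hxk hinv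
    refine (Triple.run rfl s').mono (by simp [Cmd.maxSteps, BExpr.cost, IExpr.cost])
      fun s'' _ h x => ?_
    have g16 : s'.ivar 16 = s.iarr 0 (s.ivar 13) := by rw [f.ivar 16 rfl, h16]
    have g17 : s'.ivar 17 = s.iarr 0 (s.ivar 14) := by rw [f.ivar 17 rfl, h17]
    have hkk := hinv k
    rw [if_neg (by omega)] at hkk
    by_cases h1 : s.iarr 0 k = s.iarr 0 (s.ivar 14) <;> by_cases h2 : x = k
    · simp [h, h1, h2, Cmd.run, BExpr.Holds, IExpr.eval, Store.setI, hxk, hkk, g16, g17]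
    · have : x < k + 1 ↔ x < k := by omega
      simp [h, h1, h2, Cmd.run, BExpr.Holds, IExpr.eval, Store.setI, hxk, hkk, g16, g17, hinv x,
        this]
    · simp [h, h1, h2, Cmd.run, BExpr.Holds, IExpr.eval, Store.setI, hxk, hkk, g17]
    · have : x < k + 1 ↔ x < k := by omega
      simp [h, h1, Cmd.run, BExpr.Holds, IExpr.eval, Store.setI, hxk, hkk, g17, hinv x, this]
  · rw [h.1 x]
    simp [hx]

/-- Run `body` on all pairs of nodes, starting with distinct labels. -/
def mergeCmd (body : Cmd) : Cmd :=
  .seq (.forTo 13 .size (.iput 0 (.var 13) (.var 13))) (.forTo 13 .size (.forTo 14 .size body))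

/-- Visiting all ordered pairs and merging along the edges of `F` produces its components. The time
bound per pair may depend on the pair, which is what makes the tree program quadratic. -/
theorem mergeCmd_spec {I : Input} {body : Cmd} {F : SimpleGraph (Fin I.n)} {P : Store → Prop}
    {T : ℕ → ℕ → ℕ} {s : Store}
    (hP : ∀ s s' : Store, (∀ a, a ≠ 0 → s'.iarr a = s.iarr a) → P s → P s')
    (hs : P s) (h13 : body.writesI 13 = false) (h14 : body.writesI 14 = false)
    (hbody : ∀ (i j : Fin I.n) (s' : Store), P s' → s'.ivar 13 = i → s'.ivar 14 = j →
      Triple I body s' (T i j) fun s'' => P s'' ∧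
        ((F.Adj i j ∧ ∀ x < I.n, s''.iarr 0 x =
          if s'.iarr 0 x = s'.iarr 0 j then s'.iarr 0 i else s'.iarr 0 x) ∨
        (¬ F.Adj i j ∧ s''.iarr 0 = s'.iarr 0))) :
    Triple I (mergeCmd body) s
      (∑ i ∈ Finset.range I.n, ∑ j ∈ Finset.range I.n, T i j + 30 * (I.n + 1) ^ 2) fun s' =>
      ∀ i j : Fin I.n, s'.iarr 0 i = s'.iarr 0 j ↔ F.Reachable i j := by
  have hset : ∀ (s : Store) (x k : ℕ), P s → P (s.setI x k) := fun s _ _ => hP s _ fun _ _ => rfl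
  refine Triple.mono (T := (I.n + 1) * (3 + 1 + 7) +
    (∑ i ∈ Finset.range I.n, (∑ j ∈ Finset.range I.n, T i j + (I.n + 1) * (1 + 7)) +
      (I.n + 1) * (1 + 7))) ?_ ?_ fun _ _ h => h
  · refine (Triple.forTo_const (T := 3) (m := I.n) (Inv := fun k s' => P s' ∧
      ∀ x < k, s'.iarr 0 x = x) (fun _ _ => rfl) rfl ⟨hP s _ (fun _ _ => rfl) hs,
        fun x hx => absurd hx (by omega)⟩ ?_).seq fun s₁ f₁ ⟨⟨h₁, h₁'⟩, _⟩ => ?_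
    · rintro k s' hk - hxk ⟨hinv, hinv'⟩
      refine (Triple.run rfl s').mono (by simp [Cmd.maxSteps, IExpr.cost])
        fun s'' f h => ⟨hP s' _ (fun a ha => f.iarr a ?_) hinv, fun x hx => ?_⟩
      · simpa [Cmd.writesIA] using ha.symm
      · by_cases hxk' : x = k
        · simp [h, Cmd.run, IExpr.eval, Store.setI, hxk, hxk']
        · simp [h, Cmd.run, IExpr.eval, Store.setI, hxk, hxk', hinv' x (by omega)]
    · refine (Triple.forTo (T := fun i => ∑ j ∈ Finset.range I.n, T i j + (I.n + 1) * (1 + 7))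
        (m := I.n) (Inv := fun i s' => P s' ∧
          Merged F (fun x _ => x.1 < i) (fun x => s'.iarr 0 x)) (fun _ _ => rfl)
        (by simp [Cmd.forTo, Cmd.writesI, h13]) ⟨hset _ _ _ h₁, ?_⟩ ?_).mono le_rfl
          fun s' _ h => h.1.2.iff_reachable fun x _ => x.2
      · refine ⟨fun x y hxy => ?_, fun x y hxy => absurd hxy (by omega)⟩
        have : x = y := by
          simpa [Store.setI, h₁' x x.2, h₁' y y.2, Fin.ext_iff] using hxy
        rw [this]
      · rintro i s' hi - hxi ⟨hinv, hinv'⟩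
        refine (Triple.forTo (T := T i) (m := I.n) (Inv := fun j s' => P s' ∧
          Merged F (fun x y => x.1 < i ∨ x.1 = i ∧ y.1 < j) (fun x => s'.iarr 0 x))
          (fun _ _ => rfl) h14 ⟨hset _ _ _ hinv, ?_⟩ ?_).mono le_rfl
            fun s'' _ h => ⟨hset _ _ _ h.1.1, ?_⟩
        · exact ⟨hinv'.reachable, fun x y hxy => hinv'.eq x y (by omega)⟩
        · rintro j s'' hj f hxj ⟨hP', hM⟩
          have hi' : s''.ivar 13 = i := by
            rw [f.ivar 13 (by simp [Cmd.forTo, Cmd.writesI, h13]), hxi]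
          have hD : ∀ x y : Fin I.n, (x.1 < i ∨ x.1 = i ∧ y.1 < j + 1) →
              (x.1 < i ∨ x.1 = i ∧ y.1 < j) ∨ (x = ⟨i, hi⟩ ∧ y = ⟨j, hj⟩) := by
            intro x y hxy
            simp only [Fin.ext_iff]
            omega
          refine (hbody ⟨i, hi⟩ ⟨j, hj⟩ s'' hP' hi' hxj).mono le_rfl
            fun s₃ _ ⟨h₃, h₃'⟩ => ⟨hset _ _ _ h₃, ?_⟩
          rcases h₃' with ⟨hadj, h₃'⟩ | ⟨hadj, h₃'⟩
          · exact hM.relabel hadj (fun x => h₃' x x.2) hD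
          · have : (fun x : Fin I.n => (s₃.setI 14 (j + 1)).iarr 0 x) =
                fun x : Fin I.n => s''.iarr 0 x := by
              funext x
              change s₃.iarr 0 x = _
              rw [h₃']
            rw [this]
            exact hM.skip hadj hD
        · exact ⟨h.1.2.reachable, fun x y hxy => h.1.2.eq x y (by omega)⟩
  · rw [Finset.sum_add_distrib, Finset.sum_const, Finset.card_range, smul_eq_mul]
    nlinarith

/-- Merge adjacent vertices with equal labels in array `14`. -/
def splitBody : Cmd :=
  .ite (.and (.adj (.var 13) (.var 14)) (.ieq (.get 14 (.var 13)) (.get 14 (.var 14))))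
    relabelCmd .skip

/-- Relabelling costs linear time and is charged to every one of the quadratically many pairs, which
is affordable within the cubic bound. -/
theorem splitCmd_spec {I : Input} (s : Store) :
    Triple I (mergeCmd splitBody) s (80 * (I.n + 1) ^ 3) fun s' =>
      ∀ i j : Fin I.n, s'.iarr 0 i = s'.iarr 0 j ↔
        (sameLabelGraph I.graph fun i : Fin I.n => s.iarr 14 i).Reachable i j := by
  refine (mergeCmd_spec (T := fun _ _ => 10 + 30 * (I.n + 1))
    (P := fun s' => s'.iarr 14 = s.iarr 14)
    (fun s₁ s₂ h h' => by rw [h 14 (by simp), h']) rfl rfl rfl ?_).mono ?_ fun _ _ h => h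
  · intro i j s' hs' hi hj
    have hb : BExpr.Holds I s' (.and (.adj (.var 13) (.var 14))
        (.ieq (.get 14 (.var 13)) (.get 14 (.var 14)))) ↔
        (sameLabelGraph I.graph fun i : Fin I.n => s.iarr 14 i).Adj i j := by
      simp [BExpr.Holds, IExpr.eval, hi, hj, hs', sameLabelGraph]
    refine Triple.mono (T := 9 + 1 + 30 * (I.n + 1)) (Triple.ite (fun h => ?_) fun h => ?_) le_rfl
      fun _ _ h => h
    · rw [hb] at h
      refine (relabelCmd_spec s').mono le_rfl fun s'' f h' =>
        ⟨by rw [f.iarr 14 rfl, hs'], .inl ⟨h, ?_⟩⟩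
      simpa only [hi, hj] using h'
    · rw [hb] at h
      refine (Triple.run (c := .skip) rfl s').mono (by simp [Cmd.maxSteps]; omega) fun s'' f h' =>
        ⟨by rw [f.iarr 14 rfl, hs'], .inr ⟨h, f.iarr 0 rfl⟩⟩
  · simp only [Finset.sum_const, Finset.card_range, smul_eq_mul]
    have : I.n * (I.n * (10 + 30 * (I.n + 1))) ≤ (I.n + 1) * ((I.n + 1) * (40 * (I.n + 1))) := by
      gcongr <;> omega
    nlinarith [Nat.pow_le_pow_right (show 0 < I.n + 1 by omega) (show 2 ≤ 3 by omega)]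

/-! ### The complete program for excluded minors -/

/-- The program for the graphs without a minor that allow elimination. -/
def solveCmd : Cmd := .seq reduceCmd (.seq labelCmd (mergeCmd splitBody))

theorem solveCmd_spec {W : Type*} {I : Input} (hI : I.IsInstance) {K : SimpleGraph W}
    (hK : Reducible K) (hG : ¬ HasMinor I.graph K) :
    Triple I solveCmd Store.init (4000 * (I.n + 1) ^ 3)
      fun s' => I.IsSolution fun i => s'.iarr 0 i := by
  refine Triple.mono (T := 3500 * (I.n + 1) ^ 3 + (120 * (I.n + 1) + 80 * (I.n + 1) ^ 3)) ?_ ?_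
    fun _ _ h => h
  · refine (reduceCmd_spec hI hK hG).seq fun s₁ _ h₁ => (labelCmd_spec s₁).seq fun s₂ _ h₂ =>
      (splitCmd_spec s₂).mono le_rfl fun s₃ _ h₃ => isSolution_of_isOpt hI ?_ h₃
    obtain ⟨l, hl, h₂⟩ := h₂
    intro l'
    have hle : I.n ≤ I.n + 3 := by omega
    -- A competing labelling of the nodes is extended to the pads arbitrarily, here by `0`, as pads
    -- do not count.
    have h := h₁ l hl fun x => if hx : x < I.n then l' ⟨x, hx⟩ else 0
    rw [← h₂, obj_natValue hI.2.1 hle, obj_natValue hI.2.1 hle] at h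
    simpa using h
  · have : I.n + 1 ≤ (I.n + 1) ^ 3 := Nat.le_self_pow (by simp) _
    omega

/-! ### Trees -/

/-- Compute the synergy of the nodes in the variables `13` and `14`. -/
def synergyCmd : Cmd :=
  .seq (.iput 13 (.var 13) (.const 1)) (.seq (.query 0 13) (.seq (.rset 1 (.minus .zero (.var 0)))
    (.seq (.iput 13 (.var 14) (.const 1)) (.seq (.query 0 13) (.seq (.rset 1 (.plus (.var 1) (.var 0)))
      (.seq (.iput 13 (.var 13) (.const 0)) (.seq (.query 0 13)
        (.seq (.rset 1 (.minus (.var 1) (.var 0))) (.iput 13 (.var 14) (.const 0))))))))))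

theorem synergyCmd_spec {I : Input} {s : Store} (hX : ∀ x, s.iarr 13 x = 0) {i j : Fin I.n}
    (hij : i ≠ j) (hi : s.ivar 13 = i) (hj : s.ivar 14 = j) :
    Triple I synergyCmd s (30 * (I.n + 1)) fun s' => s'.rvar 1 = synergy I.value i j ∧
      ∀ x, s'.iarr 13 x = 0 := by
  have hX' : s.iarr 13 = fun _ => 0 := funext hX
  have hij' : (i : ℕ) ≠ j := fun h => hij (Fin.ext h)
  have key : ∀ (s' : Store) (S : Finset (Fin I.n)), (∀ x : Fin I.n, s'.iarr 13 x ≠ 0 ↔ x ∈ S) →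
      s'.coalition I 13 = S := by
    intro s' S h
    ext x
    simp [Store.coalition, h]
  refine (Triple.run (c := synergyCmd) rfl s).mono (by
    simp [synergyCmd, Cmd.maxSteps, IExpr.cost, RExpr.cost]; omega) fun s' _ h => ?_
  rw [h]
  simp only [synergyCmd, Cmd.run, IExpr.eval, RExpr.eval, hi, hj, hX']
  refine ⟨?_, fun x => ?_⟩
  · rw [key _ {i}, key _ {i, j}, key _ {j}]
    · simp [synergy]
      ring
    all_goals
      intro x
      have h1 : (x : ℕ) = i ↔ x = i := Fin.ext_iff.symm
      have h2 : (x : ℕ) = j ↔ x = j := Fin.ext_iff.symm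
      by_cases hx : x = i <;> by_cases hx' : x = j <;>
        simp [h1, h2, hx, hx', hij, hij.symm, hij', hij'.symm]
  · by_cases h1 : x = i <;> by_cases h2 : x = j <;> simp [h1, h2, Function.update_apply]

/-- Merge adjacent vertices with positive synergy. -/
def synergyBody : Cmd :=
  .ite (.adj (.var 13) (.var 14)) (.seq synergyCmd (.ite (.rlt .zero (.var 1)) relabelCmd .skip))
    .skip

-- Queries and relabelling, the linear costs, occur only after a successful adjacency test; any
-- other pair costs five steps at most.
open Classical in
theorem synergyBody_spec {I : Input} {s : Store} (hX : ∀ x, s.iarr 13 x = 0) {i j : Fin I.n}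
    (hi : s.ivar 13 = i) (hj : s.ivar 14 = j) :
    Triple I synergyBody s (5 + if I.natGraph.Adj i j then 70 * (I.n + 1) else 0) fun s' =>
      (∀ x, s'.iarr 13 x = 0) ∧
        (((positiveGraph I.graph I.value).Adj i j ∧ ∀ x < I.n, s'.iarr 0 x =
          if s.iarr 0 x = s.iarr 0 j then s.iarr 0 i else s.iarr 0 x) ∨
        (¬ (positiveGraph I.graph I.value).Adj i j ∧ s'.iarr 0 = s.iarr 0)) := by
  have hb : BExpr.Holds I s (.adj (.var 13) (.var 14)) ↔ I.graph.Adj i j := by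
    simp [BExpr.Holds, IExpr.eval, hi, hj]
  have hadj : I.natGraph.Adj i j ↔ I.graph.Adj i j := by simp [Input.natGraph_adj]
  refine Triple.mono (T := 3 + 1 + (1 + if I.natGraph.Adj i j then 70 * (I.n + 1) else 0))
    (Triple.ite (fun h => ?_) fun h => ?_) (by omega) fun _ _ h => h
  · rw [hb] at h
    rw [if_pos (hadj.2 h)]
    refine Triple.mono (T := 30 * (I.n + 1) + (3 + 1 + 30 * (I.n + 1))) ?_ (by omega)
      fun _ _ h => h
    refine (synergyCmd_spec hX h.ne hi hj).seq fun s₁ f₁ ⟨h₁, hX₁⟩ => ?_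
    have h0 : s₁.iarr 0 = s.iarr 0 := f₁.iarr 0 rfl
    have hpos : BExpr.Holds I s₁ (.rlt .zero (.var 1)) ↔
        (positiveGraph I.graph I.value).Adj i j := by
      simp [BExpr.Holds, RExpr.eval, h₁, positiveGraph, h]
    refine Triple.ite (fun h' => ?_) fun h' => ?_
    · refine (relabelCmd_spec s₁).mono le_rfl fun s₂ f₂ h₂ =>
        ⟨by rwa [f₂.iarr 13 rfl], .inl ⟨hpos.1 h', ?_⟩⟩
      simpa only [h0, f₁.ivar 13 rfl, f₁.ivar 14 rfl, hi, hj] using h₂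
    · refine (Triple.run (c := .skip) rfl s₁).mono (by simp [Cmd.maxSteps]; omega) fun s₂ f₂ _ =>
        ⟨by rwa [f₂.iarr 13 rfl], .inr ⟨fun h => h' (hpos.2 h), by rw [f₂.iarr 0 rfl, h0]⟩⟩
  · rw [hb] at h
    refine (Triple.run (c := .skip) rfl s).mono (by simp [Cmd.maxSteps]) fun s₂ f₂ _ =>
      ⟨by rwa [f₂.iarr 13 rfl], .inr ⟨fun h' => h h'.1, f₂.iarr 0 rfl⟩⟩

-- Adjacent ordered pairs are counted by the sum of the degrees, twice the number of edges, and a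
-- tree has fewer edges than nodes.
open Classical in
theorem sum_natGraph_adj {I : Input} (hG : I.graph.IsTree) (c : ℕ) :
    ∑ i ∈ Finset.range I.n, ∑ j ∈ Finset.range I.n, (if I.natGraph.Adj i j then c else 0) ≤
      2 * I.n * c := by
  have hdeg : ∀ i : Fin I.n, ∑ j ∈ Finset.range I.n, (if I.natGraph.Adj i j then c else 0) =
      I.graph.degree i * c := by
    intro i
    rw [← Fin.sum_univ_eq_sum_range (fun j => if I.natGraph.Adj i j then c else 0),
      ← Finset.sum_filter, Finset.sum_const, smul_eq_mul,
      ← SimpleGraph.card_neighborFinset_eq_degree]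
    congr 2
    ext j
    simp [Input.natGraph_adj]
  rw [← Fin.sum_univ_eq_sum_range
    (fun i => ∑ j ∈ Finset.range I.n, if I.natGraph.Adj i j then c else 0),
    Finset.sum_congr rfl fun i _ => hdeg i, ← Finset.sum_mul,
    SimpleGraph.sum_degrees_eq_twice_card_edges]
  have := hG.card_edgeFinset
  rw [Fintype.card_fin] at this
  gcongr
  omega

theorem synergyBody_merge_spec {I : Input} (hI : I.IsInstance) (hG : I.graph.IsTree) :
    Triple I (mergeCmd synergyBody) Store.init (200 * (I.n + 1) ^ 2)
      fun s' => I.IsSolution fun i => s'.iarr 0 i := by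
  classical
  refine (mergeCmd_spec (F := positiveGraph I.graph I.value)
    (T := fun i j => 5 + if I.natGraph.Adj i j then 70 * (I.n + 1) else 0)
    (P := fun s => ∀ x, s.iarr 13 x = 0) (fun s s' h h' => by rwa [h 13 (by simp)])
    (fun _ => rfl) rfl rfl fun i j s' hX hi hj => synergyBody_spec hX hi hj).mono ?_
    fun s' _ h => isSolution_of_reachable (F := positiveGraph I.graph I.value)
      (fun _ _ h => h.1) h ?_
  · have := sum_natGraph_adj hG (70 * (I.n + 1))
    simp only [Finset.sum_add_distrib, Finset.sum_const, Finset.card_range, smul_eq_mul]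
    nlinarith
  · refine isOpt_positive hI.2.1 (fun i j C hij hadj hi hj => ?_) hG.isAcyclic Finset.univ h
    have := hI.2.2 i j C hij hadj hi hj
    linarith

/-! ### The graph classes -/

theorem reducible_of_exists {W : Type*} {K : SimpleGraph W} (hK : ∀ w, ∃ w', K.Adj w w')
    (h : ∀ (H : SimpleGraph ℕ) [DecidableRel H.Adj] (R : Finset ℕ), (∀ x y, H.Adj x y → y ∈ R) →
      R.Nonempty → ¬ HasMinor H K → ∃ x ∈ R, (R.filter (H.Adj x)).card ≤ 2 ∨
        (R.filter (H.Adj x)).card = 3 ∧ ∀ y z, H.Adj x y → H.Adj x z → y ≠ z → H.Adj y z) :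
    Reducible K := by
  classical
  refine ⟨hK, fun H R n hR ⟨x₀, hx₀, hx₀n⟩ hH => ?_⟩
  -- The pads are filtered out first: being isolated, they would satisfy the degree condition
  -- trivially.
  obtain ⟨x, hx, hgood⟩ := h H (R.filter (· < n))
    (fun x y hxy => Finset.mem_filter.2 ⟨(hR x y hxy).2, (hR x y hxy).1⟩)
    ⟨x₀, Finset.mem_filter.2 ⟨hx₀, hx₀n⟩⟩ hH
  have hN : (R.filter (· < n)).filter (H.Adj x) = nbrsBelow H x n := by
    ext y
    rw [mem_nbrsBelow, Finset.mem_filter, Finset.mem_filter]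
    exact ⟨fun h => ⟨h.1.2, h.2⟩, fun h => ⟨⟨(hR x y h.2).2, h.1⟩, h.2⟩⟩
  rw [hN] at hgood
  exact ⟨x, (Finset.mem_filter.1 hx).2, (Finset.mem_filter.1 hx).1, hgood⟩

theorem reducible_top : Reducible (⊤ : SimpleGraph (Fin 4)) :=
  reducible_of_exists (fun w => ⟨w + 1, by revert w; decide⟩) fun _ _ _ hR hne hH =>
    (exists_degree_le_two hR hne hH).imp fun _ h => ⟨h.1, .inl h.2⟩

theorem reducible_completeBipartiteGraph :
    Reducible (completeBipartiteGraph (Fin 2) (Fin 3)) :=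
  reducible_of_exists (fun w => by
    cases w with
    | inl _ => exact ⟨.inr 0, by simp⟩
    | inr _ => exact ⟨.inl 0, by simp⟩) fun _ _ _ hR hne hH =>
    exists_degree_le_two_or_simplicial hR hne hH

/-- A bound in terms of `n + 1` is a bound in terms of `n`, since instances have a node. -/
theorem solvableInSteps_of_triple {S : ∀ n : ℕ, SimpleGraph (Fin n) → Prop} (c : Cmd) (K d : ℕ)
    (h : ∀ I : Input, I.IsInstance → S I.n I.graph →
      Triple I c Store.init (K * (I.n + 1) ^ d) fun s' => I.IsSolution fun i => s'.iarr 0 i) :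
    SolvableInSteps S fun n => n ^ d := by
  refine ⟨c, K * 2 ^ d, fun I hI hS => ?_⟩
  obtain ⟨s, t, he, ht, hs⟩ := h I hI hS
  have hn : 0 < I.n := by
    obtain ⟨i⟩ := hI.1.nonempty
    exact i.pos
  refine ⟨s, t, he, ht.trans ?_, hs⟩
  rw [mul_assoc, ← mul_pow]
  gcongr
  omega

end GCSG

theorem theorem4 :
    GCSG.SolvableInSteps (fun _ G => G.IsTree) (fun n => n ^ 2) ∧
    GCSG.SolvableInSteps
      (fun _ G => ¬ GCSG.HasMinor G (completeBipartiteGraph (Fin 2) (Fin 3))) (fun n => n ^ 3) ∧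
    GCSG.SolvableInSteps
      (fun _ G => ¬ GCSG.HasMinor G (⊤ : SimpleGraph (Fin 4))) (fun n => n ^ 3) :=
  ⟨GCSG.solvableInSteps_of_triple (GCSG.mergeCmd GCSG.synergyBody) 200 2
      fun _ hI hG => GCSG.synergyBody_merge_spec hI hG,
    GCSG.solvableInSteps_of_triple GCSG.solveCmd 4000 3
      fun _ hI hG => GCSG.solveCmd_spec hI GCSG.reducible_completeBipartiteGraph hG,
    GCSG.solvableInSteps_of_triple GCSG.solveCmd 4000 3
      fun _ hI hG => GCSG.solveCmd_spec hI GCSG.reducible_top hG⟩
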